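/- **Definitions.** A model is a family of probability densities $p(x\mid\theta)$, $x\in\mathcal X$, $\theta\in\Theta\subseteq\mathbb R$; $\mathcal M^k$ denotes $k$ independent replications of the model $\mathcal M$. For a positive function $\pi$ on $\Theta$ write $\pi(\theta\mid x)=p(x\mid\theta)\pi(\theta)/\int_\Theta p(x\mid\tau)\pi(\tau)\,d\tau$, and let $\kappa\{\tilde p\mid p\}=\int p\log(p/\tilde p)$. The expected information of a proper prior $q$ is $I\{q\mid\mathcal M\}=\iint p(x\mid\theta)\,q(\theta)\log\frac{q(\theta\mid x)}{q(\theta)}\,dx\,d\theta$. A strictly positive continuous function $\pi$ on $\Theta$ is *permissible* if $\int_\Theta p(x\mid\theta)\pi(\theta)\,d\theta<\infty$ for all $x$ and, for some increasing sequence of compact sets $\Theta_i$ (of positive length) with union $\Theta$, the renormalized restrictions $\pi_i$ of $\pi$ to $\Theta_i$ satisfy $\int_{\mathcal X}\kappa\{\pi(\cdot\mid x)\mid\pi_i(\cdot\mid x)\}\,p_i(x)\,dx\to0$, where $p_i(x)=\int p(x\mid\theta)\pi_i(\theta)\,d\theta$ and all these quantities are finite. The class $\mathcal P_s$ of *standard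 priors* consists of the strictly positive continuous $p$ on $\Theta$ with $\int_\Theta p(x\mid\theta)p(\theta)\,d\theta<\infty$ for all $x$. A *reference prior* for $\mathcal M$ given $\mathcal P_s$ is a permissible $\pi$ such that for every compact $\Theta_0\subseteq\Theta$ of positive length and every $p\in\mathcal P_s$, with $\pi_0,p_0$ the renormalized restrictions of $\pi,p$ to $\Theta_0$, the informations $I\{\pi_0\mid\mathcal M^k\}$ and $I\{p_0\mid\mathcal M^k\}$ are finite for all $k$, and $\lim_{k\to\infty}\bigl(I\{\pi_0\mid\mathcal M^k\}-I\{p_0\mid\mathcal M^k\}\bigr)$ exists and is $\ge0$. **Theorem 8.** Let $\Theta=(\theta_0,\infty)$ with $\theta_0\in\mathbb R$, and let $a_1,a_2:\Theta\to\mathbb R$ be continuously differentiable with $0<a_1(\theta)<a_2(\theta)$ and $0<a_1'(\theta)<a_2'(\theta)$ for all $\theta\in\Theta$. Consider the uniform model with density $p(x\mid\theta)=1/(a_2(\theta)-a_1(\theta))$ for $a_1(\theta)<x<a_2(\theta)$, and $0$ otherwise. Set $$b_j(\theta)=\frac{a_2'(\theta)-a_1'(\theta)}{a_j'(\theta)},\qquad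 j=1,2 .$$ Then $$\pi(\theta)=\frac{a_2'(\theta)-a_1'(\theta)}{a_2(\theta)-a_1(\theta)}\exp\Bigl\{b_1+\frac1{b_1-b_2}\Bigl[b_1\psi\Bigl(\frac1{b_1}\Bigr)-b_2\psi\Bigl(\frac1{b_2}\Bigr)\Bigr]\Bigr\},$$ where $\psi(z)=\frac{d}{dz}\log\Gamma(z)$ for $z>0$, is a reference prior for this model given $\mathcal P_s$, and it is the only one up to a positive constant factor. -/

import Mathlib

open MeasureTheory Set Filter Topology

noncomputable section

/-- A parametric model `{p(x | θ), x ∈ X, θ ∈ Θ ⊆ ℝ}` with one real parameter, given by its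
densities with respect to a sigma-finite reference measure on the sample space `X`. -/
structure ParametricModel (X : Type*) [MeasurableSpace X] where
  /-- the reference measure on the sample space -/
  base : Measure X
  sigmaFinite_base : SigmaFinite base
  /-- the parameter space `Θ` -/
  param : Set ℝ
  measurableSet_param : MeasurableSet param
  /-- `density x θ` is `p(x | θ)`; its values for `θ ∉ Θ` play no role -/
  density : X → ℝ → ℝ
  density_nonneg : ∀ x, ∀ θ ∈ param, 0 ≤ density x θ
  integral_density : ∀ θ ∈ param, ∫ x, density x θ ∂base = 1

attribute [instance] ParametricModel.sigmaFinite_base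

/-- The logarithmic divergence `κ{p̃ | p} = ∫_Θ p log (p / p̃)` of `p̃` from the true density `p`. -/
def logDivergence (Θ : Set ℝ) (p' p : ℝ → ℝ) : ℝ :=
  ∫ θ in Θ, p θ * Real.log (p θ / p' θ)

/-- The logarithmic divergence `κ{p̃ | p}` is finite: `p` vanishes (a.e.) where `p̃` does, and the
defining integral converges absolutely. -/
def LogDivergenceFinite (Θ : Set ℝ) (p' p : ℝ → ℝ) : Prop :=
  (∀ᵐ θ ∂(volume.restrict Θ), p' θ = 0 → p θ = 0) ∧
    IntegrableOn (fun θ => p θ * Real.log (p θ / p' θ)) Θ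

/-- The renormalized restriction of a prior function `q` to the set `K`. -/
def restrictPrior (q : ℝ → ℝ) (K : Set ℝ) : ℝ → ℝ :=
  K.indicator fun θ => q θ / ∫ τ in K, q τ

namespace ParametricModel

variable {X : Type*} [MeasurableSpace X]

/-- `∫_Θ p(x | θ) q(θ) dθ`. -/
def marginal (M : ParametricModel X) (q : ℝ → ℝ) (x : X) : ℝ :=
  ∫ θ in M.param, M.density x θ * q θ

/-- The (formal) posterior density `q(θ | x)`. -/
def posterior (M : ParametricModel X) (q : ℝ → ℝ) (x : X) (θ : ℝ) : ℝ :=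
  M.density x θ * q θ / M.marginal q x

/-- The model `M^k` of `k` independent replications of `M`. -/
def replicate (M : ParametricModel X) (k : ℕ) : ParametricModel (Fin k → X) where
  base := Measure.pi fun _ => M.base
  sigmaFinite_base := inferInstance
  param := M.param
  measurableSet_param := M.measurableSet_param
  density := fun x θ => ∏ i, M.density (x i) θ
  density_nonneg := fun x θ hθ => Finset.prod_nonneg fun i _ => M.density_nonneg (x i) θ hθ
  integral_density := fun θ hθ => by
    rw [integral_fintype_prod_eq_prod (fun (_ : Fin k) (y : X) => M.density y θ)]
    simp [M.integral_density θ hθ]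

/-- An approximating compact sequence: an increasing sequence of compact subsets of `Θ` (of
positive length, so that renormalized restrictions exist) converging to `Θ`. -/
structure IsApproximatingCompactSequence (M : ParametricModel X) (K : ℕ → Set ℝ) : Prop where
  mono : Monotone K
  compact : ∀ i, IsCompact (K i)
  pos : ∀ i, 0 < volume (K i)
  iUnion_eq : ⋃ i, K i = M.param

/-- Expected logarithmic convergence of the posteriors `π_i(θ | x)`, from the renormalized
restrictions `π_i` of `π` to `K i`, to the formal posterior `π(θ | x)`:
`∫ κ{π(· | x) | π_i(· | x)} p_i(x) dx → 0`, all the integrals being finite. -/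
def ExpectedLogConvergent (M : ParametricModel X) (π : ℝ → ℝ) (K : ℕ → Set ℝ) : Prop :=
  (∀ i,
    (∀ᵐ x ∂M.base, M.marginal (restrictPrior π (K i)) x ≠ 0 →
      LogDivergenceFinite M.param (M.posterior π x) (M.posterior (restrictPrior π (K i)) x)) ∧
    Integrable (fun x =>
      logDivergence M.param (M.posterior π x) (M.posterior (restrictPrior π (K i)) x) *
        M.marginal (restrictPrior π (K i)) x) M.base) ∧
  Tendsto (fun i => ∫ x,
      logDivergence M.param (M.posterior π x) (M.posterior (restrictPrior π (K i)) x) *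
        M.marginal (restrictPrior π (K i)) x ∂M.base) atTop (𝓝 0)

/-- The class of standard prior functions: strictly positive continuous functions on `Θ` with
`∫_Θ p(x | θ) p(θ) dθ < ∞` for every `x`. -/
def standardPriors (M : ParametricModel X) : Set (ℝ → ℝ) :=
  {p | ContinuousOn p M.param ∧ (∀ θ ∈ M.param, 0 < p θ) ∧
    ∀ x, IntegrableOn (fun θ => M.density x θ * p θ) M.param}

/-- Permissible prior functions: strictly positive continuous functions on `Θ` such that
`∫_Θ p(x | θ) π(θ) dθ < ∞` for every `x`, and such that, for some approximating compact sequence,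
the posteriors are expected logarithmically convergent to the formal posterior. -/
structure IsPermissible (M : ParametricModel X) (π : ℝ → ℝ) : Prop where
  continuousOn : ContinuousOn π M.param
  pos : ∀ θ ∈ M.param, 0 < π θ
  integrableOn : ∀ x, IntegrableOn (fun θ => M.density x θ * π θ) M.param
  exists_expectedLogConvergent :
    ∃ K : ℕ → Set ℝ, M.IsApproximatingCompactSequence K ∧ M.ExpectedLogConvergent π K

/-- The expected information
`I{q | M} = ∫∫ p(x | θ) q(θ) log (q(θ | x) / q(θ)) dx dθ`. -/
def expectedInfo (M : ParametricModel X) (q : ℝ → ℝ) : ℝ :=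
  ∫ z : ℝ × X, M.density z.2 z.1 * q z.1 * Real.log (M.posterior q z.2 z.1 / q z.1)
    ∂((volume.restrict M.param).prod M.base)

/-- The double integral defining `I{q | M}` converges absolutely. -/
def ExpectedInfoFinite (M : ParametricModel X) (q : ℝ → ℝ) : Prop :=
  Integrable
    (fun z : ℝ × X => M.density z.2 z.1 * q z.1 * Real.log (M.posterior q z.2 z.1 / q z.1))
    ((volume.restrict M.param).prod M.base)

/-- The maximizing missing information property of `π` for the model `M` given the class `P`: for
every compact `K ⊆ Θ` (of positive length, so that renormalized restrictions exist) and every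
`p ∈ P`, with `π₀`, `p₀` the renormalized restrictions to `K`, the expected informations are finite
and `lim_k (I{π₀ | M^k} - I{p₀ | M^k})` exists and is nonnegative. -/
def HasMMI (M : ParametricModel X) (P : Set (ℝ → ℝ)) (π : ℝ → ℝ) : Prop :=
  ∀ K : Set ℝ, IsCompact K → K ⊆ M.param → 0 < volume K → ∀ p ∈ P,
    (∀ k, (M.replicate k).ExpectedInfoFinite (restrictPrior π K)) ∧
    (∀ k, (M.replicate k).ExpectedInfoFinite (restrictPrior p K)) ∧
    ∃ L : ℝ, 0 ≤ L ∧
      Tendsto (fun k => (M.replicate k).expectedInfo (restrictPrior π K) -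
        (M.replicate k).expectedInfo (restrictPrior p K)) atTop (𝓝 L)

/-- A reference prior for `M` given `P` is a permissible prior with the MMI property. -/
def IsReferencePrior (M : ParametricModel X) (P : Set (ℝ → ℝ)) (π : ℝ → ℝ) : Prop :=
  M.IsPermissible π ∧ M.HasMMI P π

end ParametricModel

/-- The uniform model on `(a₁(θ), a₂(θ))`, `θ > θ₀`: the density of `x` is `1 / (a₂(θ) - a₁(θ))` for
`a₁(θ) < x < a₂(θ)`, and zero otherwise. -/
def uniformModel (θ₀ : ℝ) (a₁ a₂ : ℝ → ℝ) (h : ∀ θ ∈ Ioi θ₀, a₁ θ < a₂ θ) :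
    ParametricModel ℝ where
  base := volume
  sigmaFinite_base := inferInstance
  param := Ioi θ₀
  measurableSet_param := measurableSet_Ioi
  density := fun x θ => (Ioo (a₁ θ) (a₂ θ)).indicator (fun _ => 1 / (a₂ θ - a₁ θ)) x
  density_nonneg := fun x θ hθ =>
    indicator_nonneg (fun _ _ => by have := h θ hθ; exact div_nonneg zero_le_one (by linarith)) x
  integral_density := fun θ hθ => by
    have h0 : 0 < a₂ θ - a₁ θ := by have := h θ hθ; linarith
    rw [integral_indicator measurableSet_Ioo]
    simp [h0.le, h0.ne']

/-- The digamma function `ψ(z) = d/dz log Γ(z)`, for real `z > 0`. -/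
def realDigamma (z : ℝ) : ℝ :=
  deriv (fun t => Real.log (Real.Gamma t)) z

end

noncomputable section

/-! ### The digamma function -/

/-! The likelihood of `k` observations depends on them only through their minimum and maximum. Write
`D = a₂ - a₁` at the true `θ`. The gaps between the extremes and the endpoints, multiplied by `k /
D`, tend to independent standard exponentials `E₁`, `E₂`. At `τ = θ + σ / k` the likelihood ratio
tends to `exp (-(a₂' - a₁') σ / D)` on the window `-D E₂ / a₂' < σ < D E₁ / a₁'` and to zero off its
closure. So the posterior density at `θ` under a flat prior, divided by `k`, tends to the reciprocal
of the mass of this window, `limitMass`.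

For a general prior `q` the marginal is the flat marginal times the flat-posterior mean of `q`, and
this mean tends to `q θ` at almost every `θ` (`integral_mul_log_div_mixture`,
`ae_tendsto_kernel_mean`). Hence the expected information minus `log k` converges to `∫ q F - ∫ q
log q`, where `F = E[-log limitMass]` (`EndpointPair.tendsto_expectedInfo`). With `z = a₁' / (a₂' -
a₁') = 1 / b₁`, so that `z + 1 = 1 / b₂`, one finds `F = log ((a₂' - a₁') / D) - 1 / (z + 1) +
E[-log (1 - exp (-(E₁ / z + E₂ / (z + 1))))]`. The last expectation is `ψ (z + 2)` plus a constant
(`expectedLogGap_sub_realDigamma`), so `F` is `log π` plus a constant (`localInfo_eq`,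
`digamma_exponent_eq`).

The limiting functional `∫ q log (π / q)` is therefore maximal at the restriction of `π`, and its
deficit at another prior is the relative entropy of that prior with respect to it
(`tendsto_expectedInfo_sub`). This gives the maximality of `π`. Conversely, a rival that does at
least as well as `π` has zero relative entropy on every compact interval, hence is proportional to
`π` (`eq_const_mul_of_hasMMI`).

Permissibility uses only `π ≤ a₂' / (a₂ - a₁)`, which follows from `ψ ≤ log`. For `[α, β]` the
expected divergence before normalization is at most an absolute constant
(`integral_partialMarginal_mul_log_le`). Dividing by `∫ π` over a growing interval sends it to zero
when `π` is improper; when `π` is proper, dominated convergence does. -/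

lemma differentiableAt_log_Gamma {x : ℝ} (hx : 0 < x) :
    DifferentiableAt ℝ (fun t => Real.log (Real.Gamma t)) x :=
  (Real.differentiableOn_Gamma_Ioi.differentiableAt (Ioi_mem_nhds hx)).log
    (Real.Gamma_pos_of_pos hx).ne'

lemma realDigamma_add_one {x : ℝ} (hx : 0 < x) : realDigamma (x + 1) = realDigamma x + 1 / x := by
  have h1 : deriv (fun t => Real.log (Real.Gamma (t + 1))) x = realDigamma (x + 1) :=
    deriv_comp_add_const (fun t => Real.log (Real.Gamma t)) 1 x
  have h2 : (fun t => Real.log (Real.Gamma (t + 1))) =ᶠ[𝓝 x]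
      fun t => Real.log (Real.Gamma t) + Real.log t := by
    filter_upwards [Ioi_mem_nhds hx] with t (ht : 0 < t)
    rw [Real.Gamma_add_one ht.ne', Real.log_mul ht.ne' (Real.Gamma_pos_of_pos ht).ne', add_comm]
  rw [← h1, h2.deriv_eq, deriv_fun_add (differentiableAt_log_Gamma hx)
    (Real.differentiableAt_log hx.ne'), Real.deriv_log, realDigamma, one_div]

lemma monotoneOn_realDigamma : MonotoneOn realDigamma (Ioi 0) :=
  Real.convexOn_log_Gamma.monotoneOn_deriv fun _ hx => differentiableAt_log_Gamma hx

/-- By convexity of `log Γ` its derivative at `x` is at most the slope of the chord to `x + 1`, and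
that slope is `log x` by the functional equation. -/
lemma realDigamma_le_log {x : ℝ} (hx : 0 < x) : realDigamma x ≤ Real.log x := by
  have h := Real.convexOn_log_Gamma.deriv_le_slope (mem_Ioi.2 hx)
    (mem_Ioi.2 (by linarith : 0 < x + 1)) (by linarith) (differentiableAt_log_Gamma hx)
  refine h.trans (le_of_eq ?_)
  simp only [slope_def_field, Function.comp, add_sub_cancel_left, div_one]
  rw [Real.Gamma_add_one hx.ne', Real.log_mul hx.ne' (Real.Gamma_pos_of_pos hx).ne']
  ring

/-- The complex Gamma function is holomorphic on the right half-plane, hence continuously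
differentiable there, and this passes to its restriction to the positive reals. -/
lemma continuousOn_realDigamma : ContinuousOn realDigamma (Ioi 0) := by
  have h : ContDiffOn ℝ 1 (fun t => Real.log (Real.Gamma t)) (Ioi 0) := by
    intro x (hx : 0 < x)
    have h1 : ContDiffAt ℂ 1 Complex.Gamma (x : ℂ) := by
      have hd : DifferentiableOn ℂ Complex.Gamma {s : ℂ | 0 < s.re} := fun s hs =>
        (Complex.differentiableAt_Gamma s fun m h => by
          have : (0 : ℝ) < s.re := hs
          rw [h] at this
          simp at this
          have := m.cast_nonneg (α := ℝ)
          linarith).differentiableWithinAt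
      have ho : IsOpen {s : ℂ | 0 < s.re} := isOpen_lt continuous_const Complex.continuous_re
      exact (hd.contDiffOn ho).contDiffAt (ho.mem_nhds (by simpa using hx))
    have h2 : ContDiffAt ℝ 1 Real.Gamma x := h1.real_of_complex
    exact (h2.log (Real.Gamma_pos_of_pos hx).ne').contDiffWithinAt
  exact h.continuousOn_deriv_of_isOpen isOpen_Ioi le_rfl

/-- Two monotone functions on the half-line with the same, vanishing at infinity, first difference
differ by a constant. -/
lemma sub_eq_const_of_monotoneOn_of_difference {f g d : ℝ → ℝ} (hf : MonotoneOn f (Ioi 0))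
    (hg : MonotoneOn g (Ioi 0)) (hfd : ∀ z, 0 < z → f (z + 1) = f z + d z)
    (hgd : ∀ z, 0 < z → g (z + 1) = g z + d z) (hd : ∀ z, 0 < z → d z ≤ 1 / z)
    {x y : ℝ} (hx : 0 < x) (hxy : x ≤ y) : f x - g x = f y - g y := by
  -- `f - g` has period one, so it can be compared at points arbitrarily far out, where monotonicity
  -- leaves `f` and `g` almost no room to vary.
  have per : ∀ n : ℕ, ∀ z, 0 < z → f (z + n) - g (z + n) = f z - g z := by
    intro n z hz
    induction n with
    | zero => simp
    | succ n ih =>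
      have hzn : 0 < z + n := by positivity
      rw [Nat.cast_succ, ← add_assoc, hfd _ hzn, hgd _ hzn, ← ih]; ring
  obtain ⟨N, hN⟩ := exists_nat_ge (y - x)
  have step : ∀ h : ℝ → ℝ, (∀ z, 0 < z → h (z + 1) = h z + d z) → ∀ z, 0 < z →
      h (z + N) ≤ h z + N / z := by
    intro h hh z hz
    clear hN
    induction N with
    | zero => simp
    | succ n ih =>
      have hzn : 0 < z + n := by positivity
      have h2 : 1 / (z + n) ≤ 1 / z := one_div_le_one_div_of_le hz (by simp)
      have := hd _ hzn
      rw [Nat.cast_succ, ← add_assoc, hh _ hzn, add_div]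
      linarith
  have key : ∀ n : ℕ, |(f x - g x) - (f y - g y)| ≤ N / (x + n) := by
    intro n
    have hxn : 0 < x + n := by positivity
    have hyn : 0 < y + n := by linarith
    rw [← per n x hx, ← per n y (by linarith)]
    have a1 := hf (mem_Ioi.2 hxn) (mem_Ioi.2 hyn) (by linarith)
    have a2 := hg (mem_Ioi.2 hxn) (mem_Ioi.2 hyn) (by linarith)
    have hle : y + n ≤ x + n + N := by linarith
    have hpos : 0 < x + n + N := by positivity
    have a3 := (hf (mem_Ioi.2 hyn) (mem_Ioi.2 hpos) hle).trans (step f hfd _ hxn)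
    have a4 := (hg (mem_Ioi.2 hyn) (mem_Ioi.2 hpos) hle).trans (step g hgd _ hxn)
    rw [abs_le]; constructor <;> linarith
  have lim : Tendsto (fun n : ℕ => (N : ℝ) / (x + n)) atTop (𝓝 0) :=
    tendsto_const_nhds.div_atTop
      (tendsto_atTop_add_const_left _ _ tendsto_natCast_atTop_atTop)
  have := ge_of_tendsto' lim key
  exact sub_eq_zero.1 (abs_nonpos_iff.1 this)

/-! ### The expected logarithm of a hypoexponential gap -/

/-- Lebesgue measure on the positive quadrant. -/
abbrev quadrantMeasure : Measure (ℝ × ℝ) :=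
  (volume.restrict (Ioi 0)).prod (volume.restrict (Ioi 0))

lemma ae_quadrantMeasure : ∀ᵐ p ∂quadrantMeasure, 0 < p.1 ∧ 0 < p.2 := by
  rw [quadrantMeasure, Measure.prod_restrict]
  filter_upwards [ae_restrict_mem (measurableSet_Ioi.prod measurableSet_Ioi)] with p hp
  exact hp

lemma integrable_exp_mul_quadrant {a b : ℝ} (ha : 0 < a) (hb : 0 < b) :
    Integrable (fun p : ℝ × ℝ => Real.exp (-a * p.1) * Real.exp (-b * p.2)) quadrantMeasure :=
  Integrable.mul_prod (f := fun x => Real.exp (-a * x)) (g := fun x => Real.exp (-b * x))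
    (integrableOn_exp_mul_Ioi (by linarith) 0) (integrableOn_exp_mul_Ioi (by linarith) 0)

lemma integral_exp_mul_quadrant {a b : ℝ} (ha : 0 < a) (hb : 0 < b) :
    ∫ p : ℝ × ℝ, Real.exp (-a * p.1) * Real.exp (-b * p.2) ∂quadrantMeasure = 1 / (a * b) := by
  rw [quadrantMeasure, integral_prod_mul (fun x => Real.exp (-a * x)) (fun x => Real.exp (-b * x)),
    integral_exp_mul_Ioi (by linarith), integral_exp_mul_Ioi (by linarith)]
  simp; field_simp

/-- The integrand of `expectedLogGap`. -/
def logGap (z : ℝ) (p : ℝ × ℝ) : ℝ := -Real.log (1 - Real.exp (-(p.1 / z + p.2 / (z + 1))))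

/-- `E[-log (1 - exp (-(E₁ / z + E₂ / (z + 1))))]` for independent standard exponential variables
`E₁` and `E₂`. -/
def expectedLogGap (z : ℝ) : ℝ :=
  ∫ p : ℝ × ℝ, Real.exp (-(p.1 + p.2)) * logGap z p ∂quadrantMeasure

lemma logGap_nonneg {z : ℝ} (hz : 0 < z) {p : ℝ × ℝ} (h1 : 0 < p.1) (h2 : 0 < p.2) :
    0 ≤ logGap z p := by
  have : Real.exp (-(p.1 / z + p.2 / (z + 1))) < 1 := by
    rw [Real.exp_lt_one_iff, neg_lt_zero]; positivity
  rw [logGap, Left.nonneg_neg_iff]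
  exact Real.log_nonpos (by linarith) (by linarith [Real.exp_pos (-(p.1 / z + p.2 / (z + 1)))])

lemma logGap_mono {z w : ℝ} (hz : 0 < z) (hzw : z ≤ w) {p : ℝ × ℝ} (h1 : 0 < p.1) (h2 : 0 < p.2) :
    logGap z p ≤ logGap w p := by
  have hw : 0 < w := hz.trans_le hzw
  have : Real.exp (-(p.1 / w + p.2 / (w + 1))) < 1 := by
    rw [Real.exp_lt_one_iff, neg_lt_zero]; positivity
  unfold logGap
  apply neg_le_neg
  apply Real.log_le_log (by linarith)
  gcongr

/-- With `w = p.1 / z`, the argument of the logarithm is at least `1 - e⁻ʷ ≥ w e⁻ʷ`, which leaves `w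
- log w`. The bound `-log w ≤ 2 w ^ (-1/2)` trades the logarithmic singularity for an integrable
power. -/
lemma logGap_le {z : ℝ} (hz : 0 < z) {p : ℝ × ℝ} (h1 : 0 < p.1) (h2 : 0 < p.2) :
    logGap z p ≤ 2 * (1 + z) * p.1 ^ (-(1 / 2) : ℝ) + p.1 / z := by
  have hw : 0 < p.1 / z := by positivity
  set w := p.1 / z with hwdef
  have he : Real.exp (-(w + p.2 / (z + 1))) ≤ Real.exp (-w) := by
    gcongr; linarith [show 0 < p.2 / (z + 1) by positivity]
  have h3 : w * Real.exp (-w) ≤ 1 - Real.exp (-w) := by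
    have h4 : Real.exp (-w) * Real.exp w = 1 := by rw [← Real.exp_add]; simp
    have h5 : w + 1 ≤ Real.exp w := Real.add_one_le_exp w
    have h6 : 0 < Real.exp (-w) := Real.exp_pos _
    nlinarith [mul_le_mul_of_nonneg_left h5 h6.le]
  have h7 : Real.log (w * Real.exp (-w)) ≤ Real.log (1 - Real.exp (-(w + p.2 / (z + 1)))) :=
    Real.log_le_log (by positivity) (by linarith)
  rw [Real.log_mul hw.ne' (Real.exp_pos _).ne', Real.log_exp] at h7
  have h8 : -Real.log w ≤ 2 * (1 + z) * p.1 ^ (-(1 / 2) : ℝ) := by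
    have h9 : -Real.log w ≤ w ^ (-(1 / 2) : ℝ) / (1 / 2) := by
      have := Real.log_le_rpow_div (x := w⁻¹) (by positivity) (show (0 : ℝ) < 1 / 2 by norm_num)
      rwa [Real.log_inv, Real.inv_rpow hw.le, ← Real.rpow_neg hw.le] at this
    have h10 : w ^ (-(1 / 2) : ℝ) = z ^ (1 / 2 : ℝ) * p.1 ^ (-(1 / 2) : ℝ) := by
      rw [hwdef, Real.div_rpow h1.le hz.le, Real.rpow_neg hz.le]; field_simp
    have h11 : z ^ (1 / 2 : ℝ) ≤ 1 + z := by
      rw [← Real.sqrt_eq_rpow]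
      nlinarith [Real.sq_sqrt hz.le, sq_nonneg (Real.sqrt z - 1), Real.sqrt_nonneg z]
    have h12 : 0 < p.1 ^ (-(1 / 2) : ℝ) := by positivity
    calc _ ≤ _ := h9
      _ = 2 * z ^ (1 / 2 : ℝ) * p.1 ^ (-(1 / 2) : ℝ) := by rw [h10]; ring
      _ ≤ _ := by gcongr
  simp only [logGap, ← hwdef]
  linarith

lemma measurable_logGap (z : ℝ) : Measurable (logGap z) := by
  unfold logGap; fun_prop

/-- A dominating function for integrals of logarithms on the quadrant. -/
lemma integrable_logDominating (c : ℝ) (hc : 0 < c) (A B : ℝ) :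
    Integrable (fun p : ℝ × ℝ => Real.exp (-(c * (p.1 + p.2))) *
      (A * (1 + p.1 + p.2) + B * p.1 ^ (-(1 / 2) : ℝ))) quadrantMeasure := by
  have pw : ∀ s : ℝ, -1 < s → IntegrableOn (fun x : ℝ => x ^ s * Real.exp (-c * x)) (Ioi 0) := by
    intro s hs
    have := integrableOn_rpow_mul_exp_neg_mul_rpow hs one_pos hc
    simpa using this
  have e0 : IntegrableOn (fun x : ℝ => Real.exp (-c * x)) (Ioi 0) :=
    integrableOn_exp_mul_Ioi (by linarith) 0
  have e1 : IntegrableOn (fun x : ℝ => x * Real.exp (-c * x)) (Ioi 0) := by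
    have := pw 1 (by norm_num)
    simpa using this
  have eh := pw (-(1 / 2)) (by norm_num)
  have i00 := Integrable.mul_prod e0 e0
  have i10 := Integrable.mul_prod e1 e0
  have i01 := Integrable.mul_prod e0 e1
  have ih0 := Integrable.mul_prod eh e0
  refine ((((i00.add i10).add i01).const_mul A).add (ih0.const_mul B)).congr (ae_of_all _ ?_)
  intro p
  have : Real.exp (-(c * (p.1 + p.2))) = Real.exp (-c * p.1) * Real.exp (-c * p.2) := by
    rw [← Real.exp_add]; ring_nf
  simp only [Pi.add_apply, this]
  ring

lemma integrable_logGap {z : ℝ} (hz : 0 < z) :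
    Integrable (fun p : ℝ × ℝ => Real.exp (-(p.1 + p.2)) * logGap z p) quadrantMeasure := by
  refine (integrable_logDominating 1 one_pos (1 / z) (2 * (1 + z))).mono'
    (by have := measurable_logGap z; fun_prop) ?_
  filter_upwards [ae_quadrantMeasure] with p hp
  rw [Real.norm_eq_abs, abs_of_nonneg (mul_nonneg (Real.exp_pos _).le
    (logGap_nonneg hz hp.1 hp.2)), one_mul]
  gcongr
  refine (logGap_le hz hp.1 hp.2).trans ?_
  have : p.1 / z ≤ 1 / z * (1 + p.1 + p.2) := by
    rw [div_mul_eq_mul_div]; gcongr; linarith [hp.1, hp.2]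
  linarith

lemma monotoneOn_expectedLogGap : MonotoneOn expectedLogGap (Ioi 0) := by
  intro z (hz : 0 < z) w (hw : 0 < w) hzw
  refine integral_mono_ae (integrable_logGap hz) (integrable_logGap hw) ?_
  filter_upwards [ae_quadrantMeasure] with p hp
  have := logGap_mono hz hzw hp.1 hp.2
  gcongr

/-- Expand `-log (1 - x) = ∑ xᵐ / m` and integrate term by term: the `m`-th exponential moment
factors into `1 / (1 + m / z)` and `1 / (1 + m / (z + 1))`. Here `m = n + 1`. -/
lemma hasSum_expectedLogGap {z : ℝ} (hz : 0 < z) :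
    HasSum (fun n : ℕ => z * (z + 1) / ((n + 1) * (z + (n + 1)) * (z + (n + 1) + 1)))
      (expectedLogGap z) := by
  set F : ℕ → ℝ × ℝ → ℝ := fun n p => 1 / (n + 1 : ℝ) *
    (Real.exp (-(1 + (n + 1) / z) * p.1) * Real.exp (-(1 + (n + 1) / (z + 1)) * p.2)) with hF
  have hFi : ∀ n, Integrable (F n) quadrantMeasure := fun n =>
    (integrable_exp_mul_quadrant (by positivity) (by positivity)).const_mul _
  have hFv : ∀ n, ∫ p, F n p ∂quadrantMeasure =
      z * (z + 1) / ((n + 1) * (z + (n + 1)) * (z + (n + 1) + 1)) := by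
    intro n
    rw [hF]
    simp only
    rw [integral_const_mul, integral_exp_mul_quadrant (by positivity) (by positivity)]
    field_simp
    ring
  have hnorm : ∀ n, ∫ p, ‖F n p‖ ∂quadrantMeasure =
      z * (z + 1) / ((n + 1) * (z + (n + 1)) * (z + (n + 1) + 1)) := by
    intro n
    rw [← hFv n]
    congr 1; ext p
    rw [Real.norm_eq_abs, abs_of_nonneg]
    simp only [hF]; positivity
  have hs : Summable fun n => ∫ p, ‖F n p‖ ∂quadrantMeasure := by
    have h2 : Summable fun n : ℕ => z * (z + 1) * (1 / ((n + 1 : ℕ) : ℝ) ^ 2) :=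
      ((summable_nat_add_iff 1).2 (Real.summable_one_div_nat_pow.2 one_lt_two)).mul_left _
    refine h2.of_nonneg_of_le (fun n => by rw [hnorm]; positivity) fun n => ?_
    rw [hnorm, mul_one_div]
    push_cast
    have hn : (0 : ℝ) ≤ n := n.cast_nonneg
    gcongr
    nlinarith [mul_pos hz hz, mul_nonneg hz.le hn, mul_nonneg hn hn, mul_nonneg (mul_nonneg hn hn) hn,
      mul_nonneg (mul_nonneg hn hn) hz.le, mul_nonneg hn (mul_pos hz hz).le]
  have h := hasSum_integral_of_summable_integral_norm hFi hs
  simp only [hFv] at h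
  suffices hv : expectedLogGap z = ∫ p, ∑' n, F n p ∂quadrantMeasure by rwa [hv]
  refine integral_congr_ae ?_
  filter_upwards [ae_quadrantMeasure] with p hp
  set x := Real.exp (-(p.1 / z + p.2 / (z + 1))) with hx
  have hx0 : 0 < x := Real.exp_pos _
  have hx1 : x < 1 := by
    rw [hx, Real.exp_lt_one_iff, neg_lt_zero]
    have := hp.1; have := hp.2; positivity
  have hsum := (Real.hasSum_pow_div_log_of_abs_lt_one (x := x)
    (by rwa [abs_of_pos hx0])).mul_left (Real.exp (-(p.1 + p.2)))
  rw [logGap, ← hx, ← hsum.tsum_eq]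
  congr 1; ext n
  simp only [hF]
  rw [hx, ← Real.exp_nat_mul, ← mul_div_assoc, ← Real.exp_add, ← Real.exp_add, one_div_mul_eq_div]
  congr 2
  push_cast; field_simp; ring

/-- Subtracting the two series termwise cancels the factor `m = n + 1` in the denominator, and what
remains telescopes along `1 / ((z + m) (z + m + 1))`. -/
lemma expectedLogGap_add_one {z : ℝ} (hz : 0 < z) :
    expectedLogGap (z + 1) = expectedLogGap z + 1 / (z + 2) := by
  have h1 := hasSum_expectedLogGap (by linarith : 0 < z + 1)
  have h0 := hasSum_expectedLogGap hz
  have hd := h1.sub h0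
  have htel : HasSum (fun n : ℕ => (z + 1) * ((1 / (z + (n + 1)) - 1 / (z + (n + 1) + 1)) -
      (1 / (z + ((n + 1 : ℕ) + 1)) - 1 / (z + ((n + 1 : ℕ) + 1) + 1)))) (1 / (z + 2)) := by
    set e : ℕ → ℝ := fun n => 1 / (z + (n + 1)) - 1 / (z + (n + 1) + 1) with he
    have hl : Tendsto e atTop (𝓝 0) := by
      have t1 : Tendsto (fun n : ℕ => z + ((n : ℝ) + 1)) atTop atTop :=
        tendsto_atTop_add_const_left _ _
          (tendsto_atTop_add_const_right _ _ tendsto_natCast_atTop_atTop)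
      have t2 := tendsto_atTop_add_const_right _ (1 : ℝ) t1
      simpa [he] using ((tendsto_const_nhds (x := (1 : ℝ))).div_atTop t1).sub
        ((tendsto_const_nhds (x := (1 : ℝ))).div_atTop t2)
    have hnn : ∀ n : ℕ, 0 ≤ e n - e (n + 1) := by
      intro n
      have : e n - e (n + 1) = 2 / ((z + (n + 1)) * (z + (n + 1) + 1) * (z + (n + 2) + 1)) := by
        simp only [he]; push_cast; field_simp; ring
      rw [this]; positivity
    have hh : HasSum (fun n => e n - e (n + 1)) (e 0) := by
      rw [hasSum_iff_tendsto_nat_of_nonneg hnn]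
      simp_rw [Finset.sum_range_sub']
      simpa using hl.const_sub (e 0)
    have he0 : 1 / (z + 2) = (z + 1) * e 0 := by
      show _ = (z + 1) * (1 / (z + ((0 : ℕ) + 1)) - 1 / (z + ((0 : ℕ) + 1) + 1))
      push_cast; field_simp; ring
    rw [he0]
    exact hh.mul_left (z + 1)
  have := hd.unique (htel.congr_fun ?_)
  · linarith
  · intro n
    push_cast; field_simp; ring

/-- Both functions are monotone with first difference `1 / (z + 2)`, so they differ by a constant.
Its value is never needed: an additive constant in the local information cancels when two priors are
compared. -/
lemma expectedLogGap_sub_realDigamma {z : ℝ} (hz : 0 < z) :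
    expectedLogGap z - realDigamma (z + 2) = expectedLogGap 1 - realDigamma (1 + 2) := by
  have hg : MonotoneOn (fun z => realDigamma (z + 2)) (Ioi 0) := fun a ha b hb hab =>
    monotoneOn_realDigamma (mem_Ioi.2 (by linarith [mem_Ioi.1 ha]))
      (mem_Ioi.2 (by linarith [mem_Ioi.1 hb])) (by linarith)
  have key := fun {x y : ℝ} (hx : 0 < x) (hxy : x ≤ y) =>
    sub_eq_const_of_monotoneOn_of_difference (d := fun z => 1 / (z + 2)) monotoneOn_expectedLogGap
      hg (fun z hz => expectedLogGap_add_one hz)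
      (fun z hz => by
        rw [show z + 1 + 2 = z + 2 + 1 by ring, realDigamma_add_one (by linarith)])
      (fun z hz => one_div_le_one_div_of_le hz (by linarith)) hx hxy
  rcases le_total z 1 with h | h
  · exact key hz h
  · exact (key one_pos h).symm

/-! ### The joint law of the minimum and the maximum of a sample -/

/-- The pair formed by the smallest and the largest entry of a finite sample. -/
def sampleRange {n : ℕ} (x : Fin (n + 2) → ℝ) : ℝ × ℝ :=
  (Finset.univ.inf' Finset.univ_nonempty x, Finset.univ.sup' Finset.univ_nonempty x)

/-- The density of the image of Lebesgue measure under `sampleRange`. -/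
def rangeDensity (n : ℕ) (p : ℝ × ℝ) : ℝ :=
  if p.1 < p.2 then (n + 2) * (n + 1) * (p.2 - p.1) ^ n else 0

lemma lt_sampleRange_fst_iff {n : ℕ} {x : Fin (n + 2) → ℝ} {a : ℝ} :
    a < (sampleRange x).1 ↔ ∀ i, a < x i := by
  simp [sampleRange]

lemma sampleRange_snd_lt_iff {n : ℕ} {x : Fin (n + 2) → ℝ} {b : ℝ} :
    (sampleRange x).2 < b ↔ ∀ i, x i < b := by
  simp [sampleRange]

lemma measurable_sampleRange (n : ℕ) : Measurable (sampleRange (n := n)) := by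
  have h1 : Continuous fun x : Fin (n + 2) → ℝ => Finset.univ.inf' Finset.univ_nonempty x :=
    Continuous.finset_inf'_apply _ fun i _ => continuous_apply i
  have h2 : Continuous fun x : Fin (n + 2) → ℝ => Finset.univ.sup' Finset.univ_nonempty x :=
    Continuous.finset_sup'_apply _ fun i _ => continuous_apply i
  exact h1.measurable.prodMk h2.measurable

lemma measurable_rangeDensity (n : ℕ) : Measurable (rangeDensity n) := by
  unfold rangeDensity
  exact Measurable.ite (measurableSet_lt measurable_fst measurable_snd) (by fun_prop) (by fun_prop)

lemma rangeDensity_nonneg (n : ℕ) (p : ℝ × ℝ) : 0 ≤ rangeDensity n p := by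
  unfold rangeDensity
  split_ifs with h
  · have : 0 ≤ p.2 - p.1 := by linarith
    positivity
  · exact le_rfl

lemma lintegral_Ioo_pow_sub_left {a b : ℝ} (hab : a < b) (m : ℕ) :
    ∫⁻ x in Ioo a b, ENNReal.ofReal ((m + 1) * (x - a) ^ m) = ENNReal.ofReal ((b - a) ^ (m + 1)) := by
  have hc : Continuous fun x : ℝ => ((m : ℝ) + 1) * (x - a) ^ m := by fun_prop
  rw [← ofReal_integral_eq_lintegral_ofReal
    ((hc.integrableOn_Icc (a := a) (b := b)).mono_set Ioo_subset_Icc_self)]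
  · rw [← integral_Ioc_eq_integral_Ioo, ← intervalIntegral.integral_of_le hab.le]
    congr 1
    rw [intervalIntegral.integral_const_mul, intervalIntegral.integral_comp_sub_right
      (fun x => x ^ m) a, integral_pow]
    field_simp; simp
  · filter_upwards [ae_restrict_mem measurableSet_Ioo] with x hx
    have : 0 ≤ x - a := by linarith [hx.1]
    simp only [Pi.zero_apply]; positivity

lemma lintegral_Ioo_pow_sub_right {a b : ℝ} (hab : a < b) (m : ℕ) :
    ∫⁻ x in Ioo a b, ENNReal.ofReal ((m + 1) * (b - x) ^ m) = ENNReal.ofReal ((b - a) ^ (m + 1)) := by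
  have hc : Continuous fun x : ℝ => ((m : ℝ) + 1) * (b - x) ^ m := by fun_prop
  rw [← ofReal_integral_eq_lintegral_ofReal
    ((hc.integrableOn_Icc (a := a) (b := b)).mono_set Ioo_subset_Icc_self)]
  · rw [← integral_Ioc_eq_integral_Ioo, ← intervalIntegral.integral_of_le hab.le]
    congr 1
    rw [intervalIntegral.integral_const_mul, intervalIntegral.integral_comp_sub_left
      (fun x => x ^ m) b, integral_pow]
    field_simp; simp
  · filter_upwards [ae_restrict_mem measurableSet_Ioo] with x hx
    have : 0 ≤ b - x := by linarith [hx.2]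
    simp only [Pi.zero_apply]; positivity

/-- Two successive power integrals: first over the maximum `v` in `(u, b)`, then over the minimum
`u` in `(a, b)`. -/
lemma lintegral_rangeDensity (n : ℕ) (a b : ℝ) :
    ∫⁻ p in Ioi a ×ˢ Iio b, ENNReal.ofReal (rangeDensity n p) =
      ENNReal.ofReal (b - a) ^ (n + 2) := by
  rw [Measure.volume_eq_prod, ← Measure.prod_restrict,
    lintegral_prod _ (measurable_rangeDensity n).ennreal_ofReal.aemeasurable]
  have inner : ∀ u, ∫⁻ v in Iio b, ENNReal.ofReal (rangeDensity n (u, v)) =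
      (Iio b).indicator (fun u => ENNReal.ofReal (((n + 1 : ℕ) + 1) * (b - u) ^ (n + 1))) u := by
    intro u
    have h1 : ∀ v, ENNReal.ofReal (rangeDensity n (u, v)) = (Ioi u).indicator
        (fun v => ENNReal.ofReal (n + 2) * ENNReal.ofReal ((n + 1) * (v - u) ^ n)) v := by
      intro v
      by_cases h : u < v
      · rw [indicator_of_mem (mem_Ioi.2 h), ← ENNReal.ofReal_mul (by positivity)]
        simp [rangeDensity, h, mul_assoc]
      · rw [indicator_of_notMem (by simpa using h)]
        simp [rangeDensity, h]
    simp_rw [h1]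
    rw [lintegral_indicator measurableSet_Ioi, Measure.restrict_restrict measurableSet_Ioi,
      Ioi_inter_Iio]
    by_cases h : u < b
    · rw [indicator_of_mem (mem_Iio.2 h), lintegral_const_mul _ (by fun_prop),
        lintegral_Ioo_pow_sub_left h, ← ENNReal.ofReal_mul (by positivity)]
      push_cast; ring_nf
    · rw [indicator_of_notMem (by simpa using h), Ioo_eq_empty h]; simp
  simp_rw [inner]
  rw [lintegral_indicator measurableSet_Iio, Measure.restrict_restrict measurableSet_Iio,
    inter_comm, Ioi_inter_Iio]
  rcases lt_or_ge a b with h | h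
  · rw [lintegral_Ioo_pow_sub_right h, ENNReal.ofReal_pow (by linarith)]
  · rw [Ioo_eq_empty (by simpa using h), ENNReal.ofReal_of_nonpos (by linarith)]; simp

/-- The sets `Ioi a ×ˢ Iio b` form a generating π-system, and the preimage of such a set is the cube
`(a, b)ⁿ⁺²`, because minimum above `a` and maximum below `b` means that every entry lies in between.
It thus suffices to compare volumes. -/
theorem map_sampleRange (n : ℕ) :
    (Measure.pi fun _ : Fin (n + 2) => (volume : Measure ℝ)).map sampleRange =
      volume.withDensity fun p => ENNReal.ofReal (rangeDensity n p) := by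
  have key1 : ∀ a b : ℝ, (Measure.pi fun _ : Fin (n + 2) => (volume : Measure ℝ)).map sampleRange
      (Ioi a ×ˢ Iio b) = ENNReal.ofReal (b - a) ^ (n + 2) := by
    intro a b
    rw [Measure.map_apply (measurable_sampleRange n) (measurableSet_Ioi.prod measurableSet_Iio)]
    have : sampleRange ⁻¹' (Ioi a ×ˢ Iio b) = Set.pi univ fun _ : Fin (n + 2) => Ioo a b := by
      ext x
      simp only [mem_preimage, mem_prod, mem_Ioi, mem_Iio, lt_sampleRange_fst_iff,
        sampleRange_snd_lt_iff, Set.mem_pi, mem_univ, true_imp_iff, mem_Ioo, forall_and]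
    rw [this, Measure.pi_pi]
    simp
  have key2 : ∀ a b : ℝ, (volume.withDensity fun p => ENNReal.ofReal (rangeDensity n p))
      (Ioi a ×ˢ Iio b) = ENNReal.ofReal (b - a) ^ (n + 2) := by
    intro a b
    rw [withDensity_apply _ (measurableSet_Ioi.prod measurableSet_Iio), lintegral_rangeDensity]
  have spI : ⋃ i : ℕ, Ioi (-(i : ℝ)) = univ := by
    refine eq_univ_of_forall fun x => mem_iUnion.2 ?_
    obtain ⟨m, hm⟩ := exists_nat_gt (-x)
    exact ⟨m, mem_Ioi.2 (by linarith)⟩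
  have spJ : ⋃ i : ℕ, Iio (i : ℝ) = univ := by
    refine eq_univ_of_forall fun x => mem_iUnion.2 ?_
    obtain ⟨m, hm⟩ := exists_nat_gt x
    exact ⟨m, hm⟩
  refine Measure.ext_of_generateFrom_of_iUnion
    (image2 (· ×ˢ ·) (range (Ioi : ℝ → Set ℝ)) (range Iio))
    (fun i : ℕ => Ioi (-(i : ℝ)) ×ˢ Iio (i : ℝ)) ?_ ?_ ?_ ?_ ?_ ?_
  · rw [← generateFrom_prod_eq ⟨fun i : ℕ => Ioi (-(i : ℝ)), fun i => mem_range_self _, spI⟩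
      ⟨fun i : ℕ => Iio (i : ℝ), fun i => mem_range_self _, spJ⟩, ← borel_eq_generateFrom_Ioi,
      ← borel_eq_generateFrom_Iio, ← BorelSpace.measurable_eq]
  · exact isPiSystem_Ioi.prod isPiSystem_Iio
  · refine eq_univ_of_forall fun x => mem_iUnion.2 ?_
    obtain ⟨m, hm⟩ := exists_nat_gt (max (-x.1) x.2)
    rw [max_lt_iff] at hm
    exact ⟨m, mem_Ioi.2 (by linarith), hm.2⟩
  · exact fun i => ⟨_, ⟨_, rfl⟩, _, ⟨_, rfl⟩, rfl⟩
  · intro i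
    rw [key1]
    exact ENNReal.pow_ne_top ENNReal.ofReal_ne_top
  · rintro _ ⟨_, ⟨a, rfl⟩, _, ⟨b, rfl⟩, rfl⟩
    rw [key1, key2]

lemma integral_comp_sampleRange (n : ℕ) {f : ℝ × ℝ → ℝ} (hf : Measurable f) :
    ∫ x, f (sampleRange x) ∂(Measure.pi fun _ : Fin (n + 2) => (volume : Measure ℝ)) =
      ∫ p, rangeDensity n p * f p := by
  rw [← integral_map (measurable_sampleRange n).aemeasurable hf.aestronglyMeasurable,
    map_sampleRange, integral_withDensity_eq_integral_toReal_smul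
      (measurable_rangeDensity n).ennreal_ofReal (by simp)]
  simp [ENNReal.toReal_ofReal, rangeDensity_nonneg]

/-- The density of the rescaled gaps between the sample range and the endpoints of the support. -/
def gapDensity (n : ℕ) (p : ℝ × ℝ) : ℝ :=
  if p.1 + p.2 < n + 2 then (n + 1) / (n + 2) * (1 - (p.1 + p.2) / (n + 2)) ^ n else 0

lemma measurable_gapDensity (n : ℕ) : Measurable (gapDensity n) := by
  unfold gapDensity
  exact Measurable.ite (measurableSet_lt (by fun_prop) (by fun_prop)) (by fun_prop) (by fun_prop)

lemma gapDensity_nonneg (n : ℕ) (p : ℝ × ℝ) : 0 ≤ gapDensity n p := by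
  unfold gapDensity
  split_ifs with h
  · have : (p.1 + p.2) / (n + 2) ≤ 1 := by rw [div_le_one (by positivity)]; exact h.le
    have : 0 ≤ 1 - (p.1 + p.2) / (n + 2) := by linarith
    positivity
  · exact le_rfl

/-- From `1 - t ≤ e⁻ᵗ` the decay rate is the ratio `(n + 1) / (n + 3)`, which is at least `1 / 3`.
For `gapDensity 0` the exponent vanishes and this argument gives no decay, hence the shift of the
index. -/
lemma gapDensity_le (n : ℕ) {p : ℝ × ℝ} (h1 : 0 < p.1) (h2 : 0 < p.2) :
    gapDensity (n + 1) p ≤ Real.exp (-(1 / 3 * (p.1 + p.2))) := by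
  unfold gapDensity
  split_ifs with h
  · push_cast at h ⊢
    set y := p.1 + p.2 with hy
    have hy0 : 0 < y := by positivity
    have h3 : y / (n + 1 + 2) ≤ 1 := by rw [div_le_one (by positivity)]; exact h.le
    have h4 : (1 - y / (n + 1 + 2)) ^ (n + 1) ≤ Real.exp (-(y / (n + 1 + 2))) ^ (n + 1) :=
      pow_le_pow_left₀ (by linarith) (by linarith [Real.add_one_le_exp (-(y / (n + 1 + 2)))]) _
    rw [← Real.exp_nat_mul] at h4
    have h5 : ((n : ℝ) + 1 + 1) / (n + 1 + 2) ≤ 1 := by rw [div_le_one (by positivity)]; linarith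
    have h6 : ((n + 1 : ℕ) : ℝ) * -(y / (n + 1 + 2)) ≤ -(1 / 3 * y) := by
      push_cast
      rw [mul_neg, neg_le_neg_iff, ← mul_div_assoc, le_div_iff₀ (by positivity)]
      nlinarith [mul_nonneg (n.cast_nonneg (α := ℝ)) hy0.le]
    calc _ ≤ 1 * (1 - y / (n + 1 + 2)) ^ (n + 1) := by
          have : 0 ≤ 1 - y / (n + 1 + 2) := by linarith
          gcongr
      _ ≤ _ := by rw [one_mul]; exact h4.trans (Real.exp_le_exp.2 h6)
  · positivity

lemma tendsto_gapDensity (p : ℝ × ℝ) :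
    Tendsto (fun n => gapDensity n p) atTop (𝓝 (Real.exp (-(p.1 + p.2)))) := by
  have hN : Tendsto (fun n : ℕ => (n : ℝ) + 2) atTop atTop :=
    tendsto_atTop_add_const_right _ _ tendsto_natCast_atTop_atTop
  have t1 : Tendsto (fun n : ℕ => (1 + -(p.1 + p.2) / ((n + 2 : ℕ) : ℝ)) ^ (n + 2)) atTop
      (𝓝 (Real.exp (-(p.1 + p.2)))) :=
    (Real.tendsto_one_add_div_pow_exp (-(p.1 + p.2))).comp (tendsto_add_atTop_nat 2)
  have t0 : Tendsto (fun n : ℕ => -(p.1 + p.2) / ((n : ℝ) + 2)) atTop (𝓝 0) :=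
    tendsto_const_nhds.div_atTop hN
  have t2 : Tendsto (fun n : ℕ => (1 + -(p.1 + p.2) / ((n : ℝ) + 2)) ^ 2) atTop (𝓝 1) := by
    simpa using (t0.const_add 1).pow 2
  have t3 : Tendsto (fun n : ℕ => ((n : ℝ) + 1) / (n + 2)) atTop (𝓝 1) := by
    have : Tendsto (fun n : ℕ => 1 - 1 / ((n : ℝ) + 2)) atTop (𝓝 (1 - 0)) :=
      (tendsto_const_nhds.div_atTop hN).const_sub 1
    rw [sub_zero] at this
    refine this.congr fun n => ?_
    field_simp; ring
  have t4 := t3.mul (t1.div t2 one_ne_zero)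
  rw [one_mul, div_one] at t4
  refine t4.congr' ?_
  filter_upwards [hN.eventually_gt_atTop (p.1 + p.2)] with n hn
  rw [gapDensity, if_pos hn]
  have h0 : 0 < 1 - (p.1 + p.2) / (n + 2) := by
    rw [sub_pos, div_lt_one (by positivity)]; exact hn
  have h1 : 1 + -(p.1 + p.2) / ((n : ℝ) + 2) = 1 - (p.1 + p.2) / (n + 2) := by ring
  simp only [Pi.div_apply, Nat.cast_add, Nat.cast_ofNat, h1]
  rw [pow_add]
  field_simp

/-- Integration over the sample range inside an interval, in terms of the rescaled gaps. -/
lemma integral_rangeDensity_rescale (n : ℕ) {a b : ℝ} (hab : a < b) (f : ℝ × ℝ → ℝ)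
    (hf : ∀ p, ¬ (a < p.1 ∧ p.2 < b) → f p = 0) :
    ∫ p, rangeDensity n p * f p = ∫ p, gapDensity n p * ((b - a) ^ (n + 2) *
      f (a + (b - a) * p.1 / (n + 2), b - (b - a) * p.2 / (n + 2))) ∂quadrantMeasure := by
  set r := (b - a) / (n + 2) with hr
  have hr0 : 0 < r := div_pos (by linarith) (by positivity)
  set F : ℝ × ℝ → ℝ := fun p => rangeDensity n p * f p with hF
  have sc : ∫ p, F p = r ^ 2 * ∫ p : ℝ × ℝ, F (a + r * p.1, b - r * p.2) := by
    -- The change of variables is a reflection of the second coordinate, which preserves volume,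
    -- followed by a homothety of ratio `r` and a translation.
    have hT : MeasurePreserving ((MeasurableEquiv.refl ℝ).prodCongr (MeasurableEquiv.neg ℝ))
        (volume : Measure (ℝ × ℝ)) volume :=
      (MeasurePreserving.id volume).prod (Measure.measurePreserving_neg volume)
    have e1 : ∫ p : ℝ × ℝ, F (a + r * p.1, b - r * p.2) = ∫ q : ℝ × ℝ, F ((a, b) + r • q) := by
      rw [← hT.integral_comp' (g := fun q => F ((a, b) + r • q))]
      congr 1; ext p
      congr 1
      ext <;> simp [MeasurableEquiv.prodCongr, sub_eq_add_neg]
    rw [e1, Measure.integral_comp_smul volume (fun q => F ((a, b) + q)) r,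
      integral_add_left_eq_self]
    simp
    field_simp
  rw [sc, quadrantMeasure, Measure.prod_restrict, ← Measure.volume_eq_prod, ← integral_const_mul,
    ← setIntegral_eq_integral_of_forall_compl_eq_zero (s := Ioi (0 : ℝ) ×ˢ Ioi (0 : ℝ))]
  · refine integral_congr_ae (ae_of_all _ fun p => ?_)
    have hba : b - a = r * (n + 2) := by rw [hr]; field_simp
    have e1 : a + (b - a) * p.1 / (n + 2) = a + r * p.1 := by rw [hr]; ring
    have e2 : b - (b - a) * p.2 / (n + 2) = b - r * p.2 := by rw [hr]; ring
    simp only [e1, e2, hF]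
    have e3 : (a + r * p.1 < b - r * p.2) ↔ p.1 + p.2 < n + 2 := by
      rw [← mul_lt_mul_iff_right₀ hr0 (b := p.1 + p.2), ← hba, mul_add]
      constructor <;> intro h <;> linarith
    unfold rangeDensity gapDensity
    simp only [e3]
    split_ifs with h
    · have e4 : b - r * p.2 - (a + r * p.1) = (b - a) * (1 - (p.1 + p.2) / (n + 2)) := by
        have : (b - a) * (1 - (p.1 + p.2) / (n + 2)) = b - a - r * (p.1 + p.2) := by rw [hr]; ring
        rw [this]; ring
      rw [e4, mul_pow, ← e1, ← e2, hr, pow_add]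
      field_simp
    · simp
  · intro p hp
    simp only [hF]
    rw [hf _ fun h => hp ?_]
    · simp
    · simp only at h
      constructor
      · exact mem_Ioi.2 ((mul_pos_iff_of_pos_left hr0).1 (by linarith [h.1]))
      · exact mem_Ioi.2 ((mul_pos_iff_of_pos_left hr0).1 (by linarith [h.2]))

/-! ### Information under a bounded likelihood -/

section BoundedLikelihood

variable {T X : Type*} [MeasurableSpace T] [MeasurableSpace X]

/-- The mixture `∫ L(θ, x) h(θ) dμ(θ)` of a likelihood. -/
def mixture (μ : Measure T) (L : T × X → ℝ) (h : T → ℝ) (x : X) : ℝ :=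
  ∫ θ, L (θ, x) * h θ ∂μ

/-- A bounded nonnegative measurable function. -/
structure IsBoundedWeight {α : Type*} [MeasurableSpace α] (f : α → ℝ) (B : ℝ) : Prop where
  measurable : Measurable f
  nonneg : ∀ a, 0 ≤ f a
  le : ∀ a, f a ≤ B

variable {μ : Measure T} {ν : Measure X} [IsFiniteMeasure μ] [IsFiniteMeasure ν]
  {L : T × X → ℝ} {B : ℝ} {g : T → ℝ} {C : ℝ}

lemma isBoundedWeight_one {α : Type*} [MeasurableSpace α] :
    IsBoundedWeight (fun _ : α => (1 : ℝ)) 1 :=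
  ⟨measurable_const, fun _ => zero_le_one, fun _ => le_rfl⟩

lemma exists_abs_negMulLog_le (M : ℝ) :
    ∃ K, 0 ≤ K ∧ ∀ t, 0 ≤ t → t ≤ M → |Real.negMulLog t| ≤ K := by
  obtain ⟨K, hK⟩ := (isCompact_Icc (a := (0 : ℝ)) (b := M)).exists_bound_of_continuousOn
    Real.continuous_negMulLog.continuousOn
  exact ⟨max K 0, le_max_right _ _, fun t h0 h1 => (hK t ⟨h0, h1⟩).trans (le_max_left _ _)⟩

lemma IsBoundedWeight.bound_nonneg {α : Type*} [MeasurableSpace α] [Nonempty α] {f : α → ℝ}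
    (hf : IsBoundedWeight f B) : 0 ≤ B :=
  (hf.nonneg (Classical.arbitrary α)).trans (hf.le _)

lemma IsBoundedWeight.mul_fst (hL : IsBoundedWeight L B) (hg : IsBoundedWeight g C) :
    IsBoundedWeight (fun z : T × X => L z * g z.1) (B * C) where
  measurable := hL.measurable.mul (hg.measurable.comp measurable_fst)
  nonneg z := mul_nonneg (hL.nonneg z) (hg.nonneg z.1)
  le z := mul_le_mul (hL.le z) (hg.le z.1) (hg.nonneg z.1) ((hL.nonneg z).trans (hL.le z))

lemma IsBoundedWeight.integrable {α : Type*} [MeasurableSpace α] {f : α → ℝ} {ρ : Measure α}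
    [IsFiniteMeasure ρ] (hf : IsBoundedWeight f B) : Integrable f ρ :=
  (integrable_const B).mono' hf.measurable.aestronglyMeasurable
    (ae_of_all _ fun a => by rw [Real.norm_eq_abs, abs_of_nonneg (hf.nonneg a)]; exact hf.le a)

lemma IsBoundedWeight.integrable_section (hL : IsBoundedWeight L B) (hg : IsBoundedWeight g C)
    (x : X) : Integrable (fun θ => L (θ, x) * g θ) μ :=
  IsBoundedWeight.integrable (B := B * C)
    ⟨(hL.mul_fst hg).measurable.comp measurable_prodMk_right, fun θ => (hL.mul_fst hg).nonneg (θ, x),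
      fun θ => (hL.mul_fst hg).le (θ, x)⟩

lemma IsBoundedWeight.mixture (hL : IsBoundedWeight L B) (hg : IsBoundedWeight g C) :
    IsBoundedWeight (mixture μ L g) (B * C * μ.real univ) where
  measurable := by
    have : StronglyMeasurable (Function.uncurry fun θ x => L (θ, x) * g θ) :=
      (hL.mul_fst hg).measurable.stronglyMeasurable
    exact this.integral_prod_left.measurable
  nonneg x := integral_nonneg fun θ => (hL.mul_fst hg).nonneg (θ, x)
  le x := by
    refine (integral_mono (hL.integrable_section hg x) (integrable_const (B * C))
      fun θ => (hL.mul_fst hg).le (θ, x)).trans ?_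
    simp [mul_comm]

/-- Integrating the absolute value over `θ` first gives `|m log m|` for the mixture `m`. This is
bounded because `m` is, although `log m` itself is not. -/
lemma integrable_mul_log_mixture (hL : IsBoundedWeight L B) (hg : IsBoundedWeight g C) :
    Integrable (fun z : T × X => L z * g z.1 * Real.log (mixture μ L g z.2)) (μ.prod ν) := by
  have hm := hL.mixture (μ := μ) hg
  have hmeas : Measurable fun z : T × X => L z * g z.1 * Real.log (mixture μ L g z.2) :=
    (hL.mul_fst hg).measurable.mul (Real.measurable_log.comp (hm.measurable.comp measurable_snd))
  rw [integrable_prod_iff' hmeas.aestronglyMeasurable]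
  refine ⟨ae_of_all _ fun x => (hL.integrable_section hg x).mul_const (Real.log (mixture μ L g x)), ?_⟩
  obtain ⟨K, hK0, hK⟩ := exists_abs_negMulLog_le (B * C * μ.real univ)
  have e : ∀ x, ∫ θ, ‖L (θ, x) * g θ * Real.log (mixture μ L g x)‖ ∂μ =
      |Real.negMulLog (mixture μ L g x)| := by
    intro x
    have : ∀ θ, ‖L (θ, x) * g θ * Real.log (mixture μ L g x)‖ =
        L (θ, x) * g θ * |Real.log (mixture μ L g x)| := fun θ => by
      rw [norm_mul, Real.norm_eq_abs, Real.norm_eq_abs, abs_of_nonneg ((hL.mul_fst hg).nonneg (θ, x))]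
    simp_rw [this]
    rw [integral_mul_const, Real.negMulLog, abs_mul, abs_neg, abs_of_nonneg (hm.nonneg x)]
    rfl
  simp_rw [e]
  refine (integrable_const K).mono' ?_ (ae_of_all _ fun x => ?_)
  · exact (Real.continuous_negMulLog.measurable.comp hm.measurable).abs.aestronglyMeasurable
  · simpa using hK _ (hm.nonneg x) (hm.le x)

/-- By Fubini the weight `L g` has total mass zero on the set of `x` where the mixture vanishes. -/
lemma ae_mixture_ne_zero (hL : IsBoundedWeight L B) (hg : IsBoundedWeight g C) :
    ∀ᵐ z ∂(μ.prod ν), L z * g z.1 ≠ 0 → mixture μ L g z.2 ≠ 0 := by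
  have hm := hL.mixture (μ := μ) hg
  set s : Set X := {x | mixture μ L g x = 0} with hs
  have hsm : MeasurableSet s := hm.measurable (measurableSet_singleton 0)
  have hw : IsBoundedWeight (fun z : T × X => L z * g z.1 * s.indicator 1 z.2) (B * C) := by
    refine ⟨(hL.mul_fst hg).measurable.mul ((measurable_one.indicator hsm).comp measurable_snd),
      fun z => mul_nonneg ((hL.mul_fst hg).nonneg z) (indicator_nonneg (by simp) _), fun z => ?_⟩
    refine le_trans ?_ ((hL.mul_fst hg).le z)
    refine mul_le_of_le_one_right ((hL.mul_fst hg).nonneg z) ?_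
    exact indicator_le_self' (by simp) _
  have h0 : ∫ z, L z * g z.1 * s.indicator 1 z.2 ∂(μ.prod ν) = 0 := by
    rw [integral_prod_symm _ hw.integrable]
    have : ∀ x, ∫ θ, L (θ, x) * g θ * s.indicator 1 x ∂μ = 0 := by
      intro x
      rw [integral_mul_const]
      by_cases hx : x ∈ s
      · have : ∫ θ, L (θ, x) * g θ ∂μ = 0 := hx
        rw [this, zero_mul]
      · simp [hx]
    simp [this]
  rw [integral_eq_zero_iff_of_nonneg hw.nonneg hw.integrable] at h0
  filter_upwards [h0] with z hz hne hmz
  have : z.2 ∈ s := hmz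
  simp [this] at hz
  exact hne (by simpa using hz)

lemma mixture_le_mul_mixture (hL : IsBoundedWeight L B) (hg : IsBoundedWeight g C) (x : X) :
    mixture μ L g x ≤ C * mixture μ L (fun _ => 1) x := by
  rw [mixture, mixture, ← integral_const_mul]
  refine integral_mono (hL.integrable_section hg x)
    ((hL.integrable_section isBoundedWeight_one x).const_mul C) fun θ => ?_
  simp only [mul_one]
  rw [mul_comm C]
  exact mul_le_mul_of_nonneg_left (hg.le θ) (hL.nonneg _)

/-- The quotient is the posterior mean of `g` under the flat weight, with value `0` by convention
where the flat mixture vanishes. Its boundedness makes the entropy term bounded without any lower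
bound on `g`. -/
lemma mixture_div_mixture_mem (hL : IsBoundedWeight L B) (hg : IsBoundedWeight g C) (hC : 0 ≤ C)
    (x : X) : mixture μ L g x / mixture μ L (fun _ => 1) x ∈ Icc 0 C :=
  ⟨div_nonneg ((hL.mixture hg).nonneg x) ((hL.mixture isBoundedWeight_one).nonneg x),
    div_le_of_le_mul₀ ((hL.mixture isBoundedWeight_one).nonneg x) hC (mixture_le_mul_mixture hL hg x)⟩

/-- The integrand of the expected information is integrable. -/
lemma integrable_mul_log_div_mixture (hL : IsBoundedWeight L B) (hg : IsBoundedWeight g C) :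
    Integrable (fun z : T × X => L z * g z.1 * Real.log (L z / mixture μ L g z.2)) (μ.prod ν) ∧
    (fun z : T × X => L z * g z.1 * Real.log (L z / mixture μ L g z.2)) =ᵐ[μ.prod ν]
      (fun z => g z.1 * (-Real.negMulLog (L z)) - L z * g z.1 * Real.log (mixture μ L g z.2)) ∧
    Integrable (fun z : T × X => g z.1 * (-Real.negMulLog (L z))) (μ.prod ν) := by
  have hae : (fun z : T × X => L z * g z.1 * Real.log (L z / mixture μ L g z.2)) =ᵐ[μ.prod ν]
      (fun z => g z.1 * (-Real.negMulLog (L z)) -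
        L z * g z.1 * Real.log (mixture μ L g z.2)) := by
    filter_upwards [ae_mixture_ne_zero (ν := ν) hL hg] with z hz
    rw [Real.negMulLog]
    by_cases h : L z * g z.1 = 0
    · rcases mul_eq_zero.1 h with h | h <;> simp [h]
    · rw [Real.log_div (left_ne_zero_of_mul h) (hz h)]; ring
  have hi : Integrable (fun z : T × X => g z.1 * (-Real.negMulLog (L z))) (μ.prod ν) := by
    obtain ⟨K, hK0, hK⟩ := exists_abs_negMulLog_le B
    refine (integrable_const (C * K)).mono' ?_ (ae_of_all _ fun z => ?_)
    · exact ((hg.measurable.comp measurable_fst).mul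
        (Real.continuous_negMulLog.measurable.comp hL.measurable).neg).aestronglyMeasurable
    · rw [norm_mul, norm_neg, Real.norm_eq_abs, Real.norm_eq_abs, abs_of_nonneg (hg.nonneg _)]
      exact mul_le_mul (hg.le _) (hK _ (hL.nonneg _) (hL.le _)) (abs_nonneg _)
        ((hg.nonneg _).trans (hg.le z.1))
  exact ⟨(hi.sub (integrable_mul_log_mixture hL hg)).congr hae.symm, hae, hi⟩

/-- The expected information relative to the posterior of a reference weight and the entropy defect
of the posterior mean. -/
theorem integral_mul_log_div_mixture (hL : IsBoundedWeight L B) (hg : IsBoundedWeight g C)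
    (hC : 0 ≤ C) :
    Integrable (fun z : T × X => L z * g z.1 * Real.log (L z / mixture μ L (fun _ => 1) z.2) +
      L z * Real.negMulLog (mixture μ L g z.2 / mixture μ L (fun _ => 1) z.2)) (μ.prod ν) ∧
    ∫ z, L z * g z.1 * Real.log (L z / mixture μ L g z.2) ∂(μ.prod ν) =
      ∫ z, (L z * g z.1 * Real.log (L z / mixture μ L (fun _ => 1) z.2) +
        L z * Real.negMulLog (mixture μ L g z.2 / mixture μ L (fun _ => 1) z.2)) ∂(μ.prod ν) := by
  obtain ⟨i1, ae1, i0⟩ := integrable_mul_log_div_mixture (μ := μ) (ν := ν) hL hg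
  have i2 := integrable_mul_log_mixture (μ := μ) (ν := ν) hL hg
  have h1 : IsBoundedWeight (fun _ : T => (1 : ℝ)) 1 := isBoundedWeight_one
  set Z := mixture μ L (fun _ => 1) with hZ
  set m := mixture μ L g with hm
  have hZw : IsBoundedWeight Z (B * 1 * μ.real univ) := hL.mixture h1
  have hmw : IsBoundedWeight m (B * C * μ.real univ) := hL.mixture hg
  -- Since `g ≤ C`, this is dominated by the same integrand for the flat weight.
  have i3 : Integrable (fun z : T × X => L z * g z.1 * Real.log (Z z.2)) (μ.prod ν) := by
    have := integrable_mul_log_mixture (μ := μ) (ν := ν) hL h1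
    refine (this.norm.const_mul C).mono' ?_ (ae_of_all _ fun z => ?_)
    · exact ((hL.mul_fst hg).measurable.mul
        (Real.measurable_log.comp (hZw.measurable.comp measurable_snd))).aestronglyMeasurable
    · rw [norm_mul, norm_mul, norm_mul, norm_mul, Real.norm_of_nonneg (hg.nonneg z.1)]
      simp only [norm_one, mul_one]
      rw [mul_comm ‖L z‖, mul_assoc]
      exact mul_le_mul_of_nonneg_right (hg.le _) (by positivity)
  have hV := fun x => mixture_div_mixture_mem (μ := μ) hL hg hC x
  obtain ⟨K, hK0, hK⟩ := exists_abs_negMulLog_le C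
  have i4 : Integrable (fun z : T × X => L z * Real.negMulLog (m z.2 / Z z.2)) (μ.prod ν) := by
    refine (integrable_const (B * K)).mono' ?_ (ae_of_all _ fun z => ?_)
    · exact (hL.measurable.mul (Real.continuous_negMulLog.measurable.comp
        ((hmw.measurable.div hZw.measurable).comp measurable_snd))).aestronglyMeasurable
    · rw [norm_mul, Real.norm_of_nonneg (hL.nonneg _)]
      exact mul_le_mul (hL.le _) (hK _ (hV z.2).1 (hV z.2).2) (norm_nonneg _)
        ((hL.nonneg z).trans (hL.le z))
  have ae2 : (fun z : T × X => L z * g z.1 * Real.log (L z / Z z.2) +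
      L z * Real.negMulLog (m z.2 / Z z.2)) =ᵐ[μ.prod ν]
      (fun z => g z.1 * (-Real.negMulLog (L z)) - L z * g z.1 * Real.log (Z z.2) +
        L z * Real.negMulLog (m z.2 / Z z.2)) := by
    filter_upwards [ae_mixture_ne_zero (ν := ν) hL h1] with z hz
    congr 1
    rw [Real.negMulLog]
    by_cases h : L z = 0
    · simp [h]
    · rw [Real.log_div h (hz (by simpa using h))]; ring
  refine ⟨((i0.sub i3).add i4).congr ae2.symm, ?_⟩
  rw [integral_congr_ae ae1, integral_congr_ae ae2, integral_sub i0 i2,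
    integral_add (i0.sub' i3) i4, integral_sub i0 i3]
  have e2 : ∫ z, L z * g z.1 * Real.log (m z.2) ∂(μ.prod ν) = ∫ x, m x * Real.log (m x) ∂ν := by
    rw [integral_prod_symm _ i2]; simp_rw [integral_mul_const]; rfl
  have e3 : ∫ z, L z * g z.1 * Real.log (Z z.2) ∂(μ.prod ν) = ∫ x, m x * Real.log (Z x) ∂ν := by
    rw [integral_prod_symm _ i3]; simp_rw [integral_mul_const]; rfl
  have e4 : ∫ z, L z * Real.negMulLog (m z.2 / Z z.2) ∂(μ.prod ν) =
      ∫ x, Z x * Real.negMulLog (m x / Z x) ∂ν := by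
    rw [integral_prod_symm _ i4]; simp_rw [integral_mul_const]
    simp [hZ, mixture]
  have j2 : Integrable (fun x => m x * Real.log (m x)) ν := by
    have := i2.integral_prod_right
    simp_rw [integral_mul_const] at this; exact this
  have j3 : Integrable (fun x => m x * Real.log (Z x)) ν := by
    have := i3.integral_prod_right
    simp_rw [integral_mul_const] at this; exact this
  -- This is where the entropy defect arises: with `V = m / Z`, the identity `-Z V log V = m log Z -
  -- m log m` replaces `log m` by `log Z` plus a bounded term.
  have e5 : ∫ x, Z x * Real.negMulLog (m x / Z x) ∂ν =
      ∫ x, m x * Real.log (Z x) ∂ν - ∫ x, m x * Real.log (m x) ∂ν := by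
    rw [← integral_sub j3 j2]
    congr 1; ext x
    by_cases hz : Z x = 0
    · have : m x = 0 := le_antisymm (by
        have := mixture_le_mul_mixture (μ := μ) hL hg x
        rw [← hZ, hz, mul_zero] at this; exact this) (hmw.nonneg x)
      simp [hz, this]
    · by_cases h : m x = 0
      · simp [h]
      · rw [Real.negMulLog, Real.log_div h hz]; field_simp; ring
  rw [e2, e3, e4, e5]
  ring

end BoundedLikelihood

/-! ### Local asymptotics of the likelihood of a uniform sample -/

/-- Bilipschitz increasing endpoints of an interval of increasing length, on `[α, β]`. -/
structure EndpointPair (A₁ A₂ : ℝ → ℝ) (α β c C : ℝ) : Prop where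
  cont₁ : Continuous A₁
  cont₂ : Continuous A₂
  c_pos : 0 < c
  lower₁ : ∀ θ ∈ Icc α β, ∀ τ ∈ Icc α β, θ ≤ τ → c * (τ - θ) ≤ A₁ τ - A₁ θ
  lower₂ : ∀ θ ∈ Icc α β, ∀ τ ∈ Icc α β, θ ≤ τ → c * (τ - θ) ≤ A₂ τ - A₂ θ
  upper₁ : ∀ θ ∈ Icc α β, ∀ τ ∈ Icc α β, θ ≤ τ → A₁ τ - A₁ θ ≤ C * (τ - θ)
  upper₂ : ∀ θ ∈ Icc α β, ∀ τ ∈ Icc α β, θ ≤ τ → A₂ τ - A₂ θ ≤ C * (τ - θ)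
  gap_mono : ∀ θ ∈ Icc α β, ∀ τ ∈ Icc α β, θ ≤ τ → A₂ θ - A₁ θ ≤ A₂ τ - A₁ τ
  le_gap : ∀ θ, c ≤ A₂ θ - A₁ θ
  gap_le : ∀ θ ∈ Icc α β, A₂ θ - A₁ θ ≤ C

/-- The likelihood ratio at `τ`, relative to `θ`, of a sample of size `n + 2` whose rescaled gaps to
the endpoints of the support at `θ` are `p`, restricted to `[α, β]`. -/
def likelihoodKernel (A₁ A₂ : ℝ → ℝ) (α β : ℝ) (n : ℕ) (θ : ℝ) (p : ℝ × ℝ) (τ : ℝ) : ℝ :=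
  {τ | τ ∈ Icc α β ∧ A₁ τ < A₁ θ + (A₂ θ - A₁ θ) * p.1 / (n + 2) ∧
    A₂ θ - (A₂ θ - A₁ θ) * p.2 / (n + 2) < A₂ τ}.indicator
    (fun τ => ((A₂ θ - A₁ θ) / (A₂ τ - A₁ τ)) ^ (n + 2)) τ

lemma likelihoodKernel_of_mem {A₁ A₂ : ℝ → ℝ} {α β : ℝ} {n : ℕ} {θ : ℝ} {p : ℝ × ℝ} {τ : ℝ}
    (hI : τ ∈ Icc α β) (hu : A₁ τ < A₁ θ + (A₂ θ - A₁ θ) * p.1 / (n + 2))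
    (hv : A₂ θ - (A₂ θ - A₁ θ) * p.2 / (n + 2) < A₂ τ) :
    likelihoodKernel A₁ A₂ α β n θ p τ = ((A₂ θ - A₁ θ) / (A₂ τ - A₁ τ)) ^ (n + 2) :=
  indicator_of_mem (s := {τ | τ ∈ Icc α β ∧ A₁ τ < A₁ θ + (A₂ θ - A₁ θ) * p.1 / (n + 2) ∧
    A₂ θ - (A₂ θ - A₁ θ) * p.2 / (n + 2) < A₂ τ}) ⟨hI, hu, hv⟩ _

namespace EndpointPair

variable {A₁ A₂ : ℝ → ℝ} {α β c C : ℝ}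

lemma gap_pos (h : EndpointPair A₁ A₂ α β c C) (θ : ℝ) : 0 < A₂ θ - A₁ θ :=
  h.c_pos.trans_le (h.le_gap θ)

lemma C_pos (h : EndpointPair A₁ A₂ α β c C) {θ : ℝ} (hθ : θ ∈ Icc α β) : 0 < C :=
  (h.gap_pos θ).trans_le (h.gap_le θ hθ)

lemma measurable_kernel (h : EndpointPair A₁ A₂ α β c C) (n : ℕ) (θ : ℝ) (p : ℝ × ℝ) :
    Measurable (likelihoodKernel A₁ A₂ α β n θ p) := by
  have := h.cont₁.measurable
  have := h.cont₂.measurable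
  unfold likelihoodKernel
  refine Measurable.indicator (by fun_prop) ?_
  have m1 : MeasurableSet {τ | A₁ τ < A₁ θ + (A₂ θ - A₁ θ) * p.1 / (n + 2)} :=
    measurableSet_lt h.cont₁.measurable measurable_const
  have m2 : MeasurableSet {τ | A₂ θ - (A₂ θ - A₁ θ) * p.2 / (n + 2) < A₂ τ} :=
    measurableSet_lt measurable_const h.cont₂.measurable
  exact measurableSet_Icc.inter (m1.inter m2)

lemma kernel_nonneg (h : EndpointPair A₁ A₂ α β c C) (n : ℕ) (θ : ℝ) (p : ℝ × ℝ) (τ : ℝ) :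
    0 ≤ likelihoodKernel A₁ A₂ α β n θ p τ :=
  indicator_nonneg (fun τ _ => pow_nonneg (div_nonneg (h.gap_pos θ).le (h.gap_pos τ).le) _) _

/-- To the right of `θ` the ratio is at most one, as the interval lengthens. To the left the length
drops by at most `C |τ - θ|` while staying above `c`. -/
lemma gap_ratio_le (h : EndpointPair A₁ A₂ α β c C) {θ τ : ℝ} (hθ : θ ∈ Icc α β)
    (hτ : τ ∈ Icc α β) : (A₂ θ - A₁ θ) / (A₂ τ - A₁ τ) ≤ Real.exp (C / c * |τ - θ|) := by
  have hC := h.C_pos hθ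
  have hc := h.c_pos
  have hDτ := h.gap_pos τ
  rcases le_total θ τ with hle | hle
  · have := h.gap_mono θ hθ τ hτ hle
    calc _ ≤ (1 : ℝ) := (div_le_one hDτ).2 this
      _ ≤ _ := Real.one_le_exp (by positivity)
  · have h1 := h.upper₂ τ hτ θ hθ hle
    have h2 := h.lower₁ τ hτ θ hθ hle
    have h4 : 0 ≤ c * (θ - τ) := mul_nonneg hc.le (by linarith)
    have h3 : (A₂ θ - A₁ θ) / (A₂ τ - A₁ τ) ≤ 1 + C / c * |τ - θ| := by
      rw [div_le_iff₀ hDτ, abs_sub_comm, abs_of_nonneg (by linarith : 0 ≤ θ - τ)]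
      have h5 : C * (θ - τ) ≤ C / c * (θ - τ) * (A₂ τ - A₁ τ) := by
        have : C / c * (θ - τ) * (A₂ τ - A₁ τ) = C * (θ - τ) * ((A₂ τ - A₁ τ) / c) := by ring
        rw [this]
        refine le_mul_of_one_le_right (mul_nonneg hC.le (by linarith)) ?_
        rw [le_div_iff₀ hc, one_mul]; exact h.le_gap τ
      linarith
    linarith [Real.add_one_le_exp (C / c * |τ - θ|)]

lemma le_gap_ratio (h : EndpointPair A₁ A₂ α β c C) {θ τ : ℝ} (hθ : θ ∈ Icc α β)
    (hτ : τ ∈ Icc α β) : Real.exp (-(C / c * |τ - θ|)) ≤ (A₂ θ - A₁ θ) / (A₂ τ - A₁ τ) := by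
  have := h.gap_ratio_le hτ hθ
  rw [abs_sub_comm] at this
  rw [Real.exp_neg, ← inv_div (A₂ τ - A₁ τ)]
  exact inv_anti₀ (div_pos (h.gap_pos _) (h.gap_pos _)) this

/-- A parameter too far to the right is excluded because its lower endpoint passes the sample
minimum; one too far to the left because its upper endpoint falls below the maximum. The lower
bounds on the slopes turn this into a window of width of order `1 / (n + 2)`. -/
lemma dist_le_of_kernel_ne_zero (h : EndpointPair A₁ A₂ α β c C) {n : ℕ} {θ τ : ℝ} {p : ℝ × ℝ}
    (hθ : θ ∈ Icc α β) (h1 : 0 < p.1) (h2 : 0 < p.2)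
    (hτ : likelihoodKernel A₁ A₂ α β n θ p τ ≠ 0) :
    τ ∈ Icc α β ∧ |τ - θ| ≤ C / c * (p.1 + p.2) / (n + 2) := by
  have hm := mem_of_indicator_ne_zero hτ
  obtain ⟨hI, hu, hv⟩ := hm
  refine ⟨hI, ?_⟩
  have hc := h.c_pos
  have hD := h.gap_le θ hθ
  have hC := h.C_pos hθ
  have hn : (0 : ℝ) < n + 2 := by positivity
  have e : C / c * (p.1 + p.2) / (n + 2) = (C * p.1 / (n + 2) + C * p.2 / (n + 2)) / c := by
    field_simp
  rw [e, le_div_iff₀ hc]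
  have b1 : (A₂ θ - A₁ θ) * p.1 / (n + 2) ≤ C * p.1 / (n + 2) := by gcongr
  have b2 : (A₂ θ - A₁ θ) * p.2 / (n + 2) ≤ C * p.2 / (n + 2) := by gcongr
  have p1 : 0 < C * p.1 / (n + 2) := by positivity
  have p2 : 0 < C * p.2 / (n + 2) := by positivity
  rcases le_total θ τ with hle | hle
  · have := h.lower₁ θ hθ τ hI hle
    rw [abs_of_nonneg (by linarith)]; linarith
  · have := h.lower₂ τ hI θ hθ hle
    rw [abs_sub_comm, abs_of_nonneg (by linarith)]; linarith

/-- On a window of width of order `1 / (n + 2)`, the `(n + 2)`-th power of the length ratio stays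
bounded in `n`. -/
lemma kernel_le (h : EndpointPair A₁ A₂ α β c C) {n : ℕ} {θ : ℝ} {p : ℝ × ℝ}
    (hθ : θ ∈ Icc α β) (h1 : 0 < p.1) (h2 : 0 < p.2) (τ : ℝ) :
    likelihoodKernel A₁ A₂ α β n θ p τ ≤
      (Metric.closedBall θ (C / c * (p.1 + p.2) / (n + 2))).indicator
        (fun _ => Real.exp ((C / c) ^ 2 * (p.1 + p.2))) τ := by
  by_cases hτ : likelihoodKernel A₁ A₂ α β n θ p τ = 0
  · rw [hτ]; exact indicator_nonneg (fun _ _ => (Real.exp_pos _).le) _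
  · obtain ⟨hI, hd⟩ := h.dist_le_of_kernel_ne_zero hθ h1 h2 hτ
    rw [indicator_of_mem (by rwa [Metric.mem_closedBall, Real.dist_eq]), likelihoodKernel,
      indicator_of_mem (mem_of_indicator_ne_zero hτ)]
    have hn : (0 : ℝ) < n + 2 := by positivity
    have hC := h.C_pos hθ
    have hc := h.c_pos
    refine (pow_le_pow_left₀ (div_nonneg (h.gap_pos _).le (h.gap_pos _).le)
      (h.gap_ratio_le hθ hI) _).trans ?_
    rw [← Real.exp_nat_mul, Real.exp_le_exp]
    rw [le_div_iff₀ hn] at hd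
    push_cast
    have : C / c * (|τ - θ| * (n + 2)) ≤ C / c * (C / c * (p.1 + p.2)) := by gcongr
    nlinarith

lemma integrable_kernel_mul (h : EndpointPair A₁ A₂ α β c C) {n : ℕ} {θ : ℝ} {p : ℝ × ℝ}
    (hθ : θ ∈ Icc α β) (h1 : 0 < p.1) (h2 : 0 < p.2) {g : ℝ → ℝ} (hg : LocallyIntegrable g) :
    Integrable fun τ => likelihoodKernel A₁ A₂ α β n θ p τ * g τ := by
  have hb := (hg.integrableOn_isCompact (isCompact_closedBall θ (C / c * (p.1 + p.2) / (n + 2))))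
  rw [← integrable_indicator_iff measurableSet_closedBall] at hb
  refine (hb.norm.const_mul (Real.exp ((C / c) ^ 2 * (p.1 + p.2)))).mono'
    ((h.measurable_kernel n θ p).aestronglyMeasurable.mul hg.aestronglyMeasurable)
    (ae_of_all _ fun τ => ?_)
  rw [norm_mul, Real.norm_of_nonneg (h.kernel_nonneg n θ p τ)]
  refine (mul_le_mul_of_nonneg_right (h.kernel_le hθ h1 h2 τ) (norm_nonneg _)).trans (le_of_eq ?_)
  by_cases ht : τ ∈ Metric.closedBall θ (C / c * (p.1 + p.2) / (n + 2)) <;> simp [ht]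

lemma integrable_kernel (h : EndpointPair A₁ A₂ α β c C) {n : ℕ} {θ : ℝ} {p : ℝ × ℝ}
    (hθ : θ ∈ Icc α β) (h1 : 0 < p.1) (h2 : 0 < p.2) :
    Integrable (likelihoodKernel A₁ A₂ α β n θ p) := by
  simpa using h.integrable_kernel_mul (n := n) (g := fun _ => 1) hθ h1 h2
    (locallyIntegrable_const (1 : ℝ))

lemma integral_kernel_le (h : EndpointPair A₁ A₂ α β c C) {n : ℕ} {θ : ℝ} {p : ℝ × ℝ}
    (hθ : θ ∈ Icc α β) (h1 : 0 < p.1) (h2 : 0 < p.2) :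
    (n + 2) * ∫ τ, likelihoodKernel A₁ A₂ α β n θ p τ ≤
      2 * (C / c) * (p.1 + p.2) * Real.exp ((C / c) ^ 2 * (p.1 + p.2)) := by
  have hC := h.C_pos hθ
  have hc := h.c_pos
  have hn : (0 : ℝ) < n + 2 := by positivity
  have hle : ∫ τ, likelihoodKernel A₁ A₂ α β n θ p τ ≤ _ :=
    integral_mono (h.integrable_kernel hθ h1 h2) ?_ (h.kernel_le hθ h1 h2)
  · rw [integral_indicator measurableSet_closedBall, setIntegral_const, smul_eq_mul, measureReal_def,
      Real.volume_closedBall, ENNReal.toReal_ofReal (by positivity)] at hle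
    refine (mul_le_mul_of_nonneg_left hle hn.le).trans (le_of_eq ?_)
    field_simp
  · rw [integrable_indicator_iff measurableSet_closedBall]
    exact integrableOn_const measure_closedBall_lt_top.ne

/-- Only parameters just to the right of `θ` are used. There the constraint from the maximum holds
automatically, so the bound involves `p.1` alone. The room `δ` keeps these parameters inside `[α,
β]`. -/
lemma le_integral_kernel (h : EndpointPair A₁ A₂ α β c C) {n : ℕ} {θ δ : ℝ} {p : ℝ × ℝ}
    (hδ : 0 < δ) (hθ : θ ∈ Icc α (β - δ)) (h1 : 0 < p.1) (h2 : 0 < p.2) :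
    min (c * p.1 / C) δ * Real.exp (-(C / c * δ)) ≤
      (n + 2) * ∫ τ, likelihoodKernel A₁ A₂ α β n θ p τ := by
  have hθ' : θ ∈ Icc α β := ⟨hθ.1, hθ.2.trans (by linarith)⟩
  have hC := h.C_pos hθ'
  have hc := h.c_pos
  have hn : (0 : ℝ) < n + 2 := by positivity
  -- The first entry keeps the lower endpoint below the sample minimum; the second keeps `τ ≤ β` and
  -- bounds the loss in the likelihood ratio.
  set ρ := min (c * p.1 / C) δ with hρ
  have hρ0 : 0 < ρ := lt_min (by positivity) hδ
  have hρn : ρ / (n + 2) ≤ δ := by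
    rw [div_le_iff₀ hn]
    calc ρ ≤ δ := min_le_right _ _
      _ ≤ δ * (n + 2) := le_mul_of_one_le_right hδ.le (by linarith [n.cast_nonneg (α := ℝ)])
  have hlow : ∀ τ, (Ioo θ (θ + ρ / (n + 2))).indicator (fun _ => Real.exp (-(C / c * δ))) τ ≤
      likelihoodKernel A₁ A₂ α β n θ p τ := by
    intro τ
    by_cases hτ : τ ∈ Ioo θ (θ + ρ / (n + 2))
    swap
    · rw [indicator_of_notMem hτ]; exact h.kernel_nonneg n θ p τ
    have hI : τ ∈ Icc α β := ⟨by linarith [hθ.1, hτ.1], by linarith [hθ.2, hτ.2]⟩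
    have hD := h.le_gap θ
    have hgt : τ - θ < ρ / (n + 2) := by linarith [hτ.2]
    have m1 : A₁ τ < A₁ θ + (A₂ θ - A₁ θ) * p.1 / (n + 2) := by
      have e1 := h.upper₁ θ hθ' τ hI hτ.1.le
      have e2 : C * (τ - θ) < C * (ρ / (n + 2)) := by gcongr
      have e3 : C * (ρ / (n + 2)) ≤ C * ((c * p.1 / C) / (n + 2)) := by
        gcongr; exact min_le_left _ _
      have e4 : C * ((c * p.1 / C) / (n + 2)) = c * p.1 / (n + 2) := by field_simp
      have e5 : c * p.1 / (n + 2) ≤ (A₂ θ - A₁ θ) * p.1 / (n + 2) := by gcongr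
      linarith
    have m2 : A₂ θ - (A₂ θ - A₁ θ) * p.2 / (n + 2) < A₂ τ := by
      have e1 := h.lower₂ θ hθ' τ hI hτ.1.le
      have e2 : 0 ≤ c * (τ - θ) := mul_nonneg hc.le (by linarith [hτ.1])
      have e3 : 0 < (A₂ θ - A₁ θ) * p.2 / (n + 2) := by have := h.gap_pos θ; positivity
      linarith
    rw [indicator_of_mem hτ, likelihoodKernel_of_mem hI m1 m2]
    refine le_trans ?_ (pow_le_pow_left₀ (Real.exp_pos _).le (h.le_gap_ratio hθ' hI) _)
    rw [← Real.exp_nat_mul, Real.exp_le_exp, abs_of_pos (by linarith [hτ.1])]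
    rw [lt_div_iff₀ hn] at hgt
    have : C / c * ((τ - θ) * (n + 2)) ≤ C / c * δ := by
      gcongr; exact hgt.le.trans (min_le_right _ _)
    push_cast
    linarith
  have hle := integral_mono (μ := volume) ?_ (h.integrable_kernel hθ' h1 h2) hlow
  · rw [integral_indicator measurableSet_Ioo, setIntegral_const, smul_eq_mul, measureReal_def,
      Real.volume_Ioo, ENNReal.toReal_ofReal (by rw [add_sub_cancel_left]; positivity),
      add_sub_cancel_left] at hle
    refine le_trans (le_of_eq ?_) (mul_le_mul_of_nonneg_left hle hn.le)
    field_simp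
  · rw [integrable_indicator_iff measurableSet_Ioo]
    exact integrableOn_const measure_Ioo_lt_top.ne

/-- A bound, uniform in the sample size and in the parameter, on the logarithm of the normalized
likelihood. -/
lemma exists_abs_log_integral_kernel_le (h : EndpointPair A₁ A₂ α β c C) {δ : ℝ} (hδ : 0 < δ)
    (hαβ : α ≤ β) :
    ∃ A B : ℝ, 0 ≤ A ∧ 0 ≤ B ∧ ∀ (n : ℕ), ∀ θ ∈ Icc α (β - δ), ∀ p : ℝ × ℝ, 0 < p.1 → 0 < p.2 →
      |Real.log ((n + 2) * ∫ τ, likelihoodKernel A₁ A₂ α β n θ p τ)| ≤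
        A * (1 + p.1 + p.2) + B * p.1 ^ (-(1 / 2) : ℝ) := by
  have hC := h.C_pos (left_mem_Icc.2 hαβ)
  have hc := h.c_pos
  set R := C / c with hR
  have hR0 : 0 < R := by positivity
  refine ⟨2 * R + R ^ 2 + R * δ + 2 * δ ^ (-(1 / 2) : ℝ), 2 * (c / C) ^ (-(1 / 2) : ℝ),
    by positivity, by positivity, fun n θ hθ p h1 h2 => ?_⟩
  have hθ' : θ ∈ Icc α β := ⟨hθ.1, hθ.2.trans (by linarith)⟩
  have hup := h.integral_kernel_le (n := n) hθ' h1 h2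
  have hlo := h.le_integral_kernel (n := n) hδ hθ h1 h2
  set N := (n + 2) * ∫ τ, likelihoodKernel A₁ A₂ α β n θ p τ with hN
  set ρ := min (c * p.1 / C) δ with hρ
  have hρ0 : 0 < ρ := lt_min (by positivity) hδ
  have hN0 : 0 < N := lt_of_lt_of_le (by positivity) hlo
  -- The exponential growth of the kernel bound in `p` may defeat the decay of the gap density, but
  -- its logarithm grows only linearly.
  have u1 : Real.log N ≤ 2 * R * (p.1 + p.2) + R ^ 2 * (p.1 + p.2) := by
    have := Real.log_le_log hN0 hup
    rw [Real.log_mul (by positivity) (Real.exp_pos _).ne', Real.log_exp] at this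
    have := Real.log_le_sub_one_of_pos (show 0 < 2 * R * (p.1 + p.2) by positivity)
    linarith
  have l1 : -Real.log N ≤ R * δ + (2 * (c / C) ^ (-(1 / 2) : ℝ) * p.1 ^ (-(1 / 2) : ℝ) +
      2 * δ ^ (-(1 / 2) : ℝ)) := by
    have e1 := Real.log_le_log (by positivity) hlo
    rw [Real.log_mul hρ0.ne' (Real.exp_pos _).ne', Real.log_exp] at e1
    have e2 : -Real.log ρ ≤ ρ ^ (-(1 / 2) : ℝ) / (1 / 2) := by
      have := Real.log_le_rpow_div (x := ρ⁻¹) (by positivity) (show (0 : ℝ) < 1 / 2 by norm_num)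
      rwa [Real.log_inv, Real.inv_rpow hρ0.le, ← Real.rpow_neg hρ0.le] at this
    have e3 : ρ ^ (-(1 / 2) : ℝ) ≤ (c * p.1 / C) ^ (-(1 / 2) : ℝ) + δ ^ (-(1 / 2) : ℝ) := by
      rcases min_choice (c * p.1 / C) δ with hm | hm
      · rw [hρ, hm]
        exact le_add_of_nonneg_right (by positivity)
      · rw [hρ, hm]
        exact le_add_of_nonneg_left (by positivity)
    have e4 : (c * p.1 / C) ^ (-(1 / 2) : ℝ) = (c / C) ^ (-(1 / 2) : ℝ) * p.1 ^ (-(1 / 2) : ℝ) := by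
      rw [← Real.mul_rpow (by positivity) h1.le]; congr 1; ring
    rw [e4] at e3
    linarith
  have q1 : 0 ≤ (c / C) ^ (-(1 / 2) : ℝ) * p.1 ^ (-(1 / 2) : ℝ) := by positivity
  have q2 : 0 ≤ δ ^ (-(1 / 2) : ℝ) := by positivity
  have q3 : 0 ≤ R * δ := by positivity
  have q4 : 0 ≤ 2 * R + R ^ 2 := by positivity
  have q5 : 0 ≤ R * δ * (p.1 + p.2) := by positivity
  have q6 : 0 ≤ δ ^ (-(1 / 2) : ℝ) * (p.1 + p.2) := by positivity
  have q7 : 0 ≤ (2 * R + R ^ 2) * (p.1 + p.2) := by positivity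
  rw [abs_le]
  constructor <;> nlinarith

end EndpointPair

lemma tendsto_natCast_add_two : Tendsto (fun n : ℕ => (n : ℝ) + 2) atTop atTop :=
  tendsto_atTop_add_const_right _ _ tendsto_natCast_atTop_atTop

lemma HasDerivAt.tendsto_natCast_mul_sub {f : ℝ → ℝ} {d θ : ℝ} (hf : HasDerivAt f d θ) (σ : ℝ) :
    Tendsto (fun n : ℕ => ((n : ℝ) + 2) * (f (θ + σ / (n + 2)) - f θ)) atTop (𝓝 (d * σ)) := by
  have h1 : HasDerivAt (fun h : ℝ => f (θ + σ * h)) (d * σ) 0 := by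
    have h2 : HasDerivAt (fun h : ℝ => θ + σ * h) σ 0 := by
      simpa using ((hasDerivAt_id (0 : ℝ)).const_mul σ).const_add θ
    have h3 : HasDerivAt f d (θ + σ * 0) := by simpa using hf
    exact h3.comp (0 : ℝ) h2
  rw [hasDerivAt_iff_tendsto_slope_zero] at h1
  have h4 : Tendsto (fun n : ℕ => ((n : ℝ) + 2)⁻¹) atTop (𝓝[≠] 0) := by
    refine tendsto_nhdsWithin_iff.2 ⟨tendsto_natCast_add_two.inv_tendsto_atTop,
      Eventually.of_forall fun n => ?_⟩
    have : (n : ℝ) + 2 ≠ 0 := by positivity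
    simpa using this
  refine (h1.comp h4).congr fun n => ?_
  simp [div_eq_mul_inv]

/-- The limit of the normalized likelihood. -/
def limitMass (D d₁ d₂ : ℝ) (p : ℝ × ℝ) : ℝ :=
  (Real.exp ((d₂ - d₁) / d₂ * p.2) - Real.exp (-((d₂ - d₁) / d₁ * p.1))) / ((d₂ - d₁) / D)

lemma limitMass_pos {D d₁ d₂ : ℝ} (hD : 0 < D) (hd₁ : 0 < d₁) (hd : d₁ < d₂) {p : ℝ × ℝ}
    (h1 : 0 < p.1) (h2 : 0 < p.2) : 0 < limitMass D d₁ d₂ p := by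
  have hd₂ : 0 < d₂ := hd₁.trans hd
  have hdd : 0 < d₂ - d₁ := by linarith
  refine div_pos (sub_pos.2 (Real.exp_lt_exp.2 ?_)) (div_pos hdd hD)
  have : 0 < (d₂ - d₁) / d₁ * p.1 := by positivity
  have : 0 < (d₂ - d₁) / d₂ * p.2 := by positivity
  linarith

namespace EndpointPair

variable {A₁ A₂ : ℝ → ℝ} {α β c C : ℝ}

lemma integral_limit_kernel {D d₁ d₂ : ℝ} (hD : 0 < D) (hd₁ : 0 < d₁) (hd : d₁ < d₂) {p : ℝ × ℝ}
    (h1 : 0 < p.1) (h2 : 0 < p.2) :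
    ∫ σ, {σ : ℝ | d₁ * σ < D * p.1 ∧ -(D * p.2) < d₂ * σ}.indicator
      (fun σ => Real.exp (-((d₂ - d₁) / D * σ))) σ = limitMass D d₁ d₂ p := by
  have hd₂ : 0 < d₂ := hd₁.trans hd
  have hl : 0 < (d₂ - d₁) / D := div_pos (by linarith) hD
  have hset : {σ : ℝ | d₁ * σ < D * p.1 ∧ -(D * p.2) < d₂ * σ} =
      Ioo (-(D * p.2) / d₂) (D * p.1 / d₁) := by
    ext σ
    rw [mem_Ioo, mem_ofPred_eq, lt_div_iff₀ hd₁, div_lt_iff₀ hd₂, mul_comm σ, mul_comm σ, and_comm]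
  have hle : -(D * p.2) / d₂ ≤ D * p.1 / d₁ := by
    have : 0 < D * p.2 / d₂ := by positivity
    have : 0 < D * p.1 / d₁ := by positivity
    rw [neg_div]; linarith
  rw [hset, integral_indicator measurableSet_Ioo, ← integral_Ioc_eq_integral_Ioo,
    ← intervalIntegral.integral_of_le hle]
  have hF : ∀ x ∈ uIcc (-(D * p.2) / d₂) (D * p.1 / d₁),
      HasDerivAt (fun σ => -(Real.exp (-((d₂ - d₁) / D * σ)) / ((d₂ - d₁) / D)))
        (Real.exp (-((d₂ - d₁) / D * x))) x := by
    intro x _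
    have := ((((hasDerivAt_id x).const_mul ((d₂ - d₁) / D)).neg.exp).div_const
      ((d₂ - d₁) / D)).neg
    refine HasDerivAt.congr_deriv this ?_
    simp only [Pi.neg_apply, id, mul_one, mul_neg, neg_div, neg_neg]
    rw [mul_div_cancel_right₀ _ hl.ne']
  rw [intervalIntegral.integral_eq_sub_of_hasDerivAt hF
    (Continuous.intervalIntegrable (by fun_prop) _ _), limitMass]
  have e1 : (d₂ - d₁) / D * (D * p.1 / d₁) = (d₂ - d₁) / d₁ * p.1 := by field_simp
  have e2 : -((d₂ - d₁) / D * (-(D * p.2) / d₂)) = (d₂ - d₁) / d₂ * p.2 := by field_simp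
  rw [e1, e2]
  ring

/-- Substitute `τ = θ + σ / (n + 2)` and use dominated convergence on a fixed ball.
Differentiability of the endpoints gives the limiting window, and the derivative of the log-length
gives the exponential rate. -/
lemma tendsto_integral_kernel (h : EndpointPair A₁ A₂ α β c C) {θ d₁ d₂ : ℝ} (hθ : θ ∈ Ioo α β)
    (hA₁ : HasDerivAt A₁ d₁ θ) (hA₂ : HasDerivAt A₂ d₂ θ) (hd₁ : 0 < d₁) (hd : d₁ < d₂)
    {p : ℝ × ℝ} (h1 : 0 < p.1) (h2 : 0 < p.2) :
    Tendsto (fun n : ℕ => (n + 2) * ∫ τ, likelihoodKernel A₁ A₂ α β n θ p τ) atTop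
      (𝓝 (limitMass (A₂ θ - A₁ θ) d₁ d₂ p)) := by
  have hd₂ : 0 < d₂ := hd₁.trans hd
  have hθ' : θ ∈ Icc α β := Ioo_subset_Icc_self hθ
  have hD := h.gap_pos θ
  have hsub : ∀ n : ℕ, (n + 2) * ∫ τ, likelihoodKernel A₁ A₂ α β n θ p τ =
      ∫ σ, likelihoodKernel A₁ A₂ α β n θ p (θ + σ / (n + 2)) := by
    intro n
    have hn : (0 : ℝ) < n + 2 := by positivity
    rw [Measure.integral_comp_div (fun x => likelihoodKernel A₁ A₂ α β n θ p (θ + x)) ((n : ℝ) + 2),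
      integral_add_left_eq_self, abs_of_pos hn, smul_eq_mul]
  simp_rw [hsub]
  rw [← integral_limit_kernel hD hd₁ hd h1 h2]
  refine tendsto_integral_of_dominated_convergence
    ((Metric.closedBall (0 : ℝ) (C / c * (p.1 + p.2))).indicator
      fun _ => Real.exp ((C / c) ^ 2 * (p.1 + p.2))) ?_ ?_ ?_ ?_
  · intro n
    exact ((h.measurable_kernel n θ p).comp (by fun_prop)).aestronglyMeasurable
  · rw [integrable_indicator_iff measurableSet_closedBall]
    exact integrableOn_const measure_closedBall_lt_top.ne
  · intro n
    refine ae_of_all _ fun σ => ?_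
    have hn : (0 : ℝ) < n + 2 := by positivity
    rw [Real.norm_of_nonneg (h.kernel_nonneg _ _ _ _)]
    refine (h.kernel_le hθ' h1 h2 _).trans (le_of_eq ?_)
    have : θ + σ / (n + 2) ∈ Metric.closedBall θ (C / c * (p.1 + p.2) / (n + 2)) ↔
        σ ∈ Metric.closedBall (0 : ℝ) (C / c * (p.1 + p.2)) := by
      rw [Metric.mem_closedBall, Metric.mem_closedBall, Real.dist_eq, Real.dist_eq,
        add_sub_cancel_left, abs_div, abs_of_pos hn, sub_zero, div_le_div_iff_of_pos_right hn]
    by_cases hσ : σ ∈ Metric.closedBall (0 : ℝ) (C / c * (p.1 + p.2))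
    · rw [indicator_of_mem hσ, indicator_of_mem (this.2 hσ)]
    · rw [indicator_of_notMem hσ, indicator_of_notMem (this.not.2 hσ)]
  -- At the two ends of the limiting window first-order information does not decide membership.
  · have hne : ∀ᵐ σ : ℝ, σ ∉ ({(A₂ θ - A₁ θ) * p.1 / d₁, -((A₂ θ - A₁ θ) * p.2) / d₂} : Set ℝ) :=
      (Set.toFinite _).measure_zero volume |> measure_eq_zero_iff_ae_notMem.1
    filter_upwards [hne] with σ hσ
    simp only [mem_insert_iff, mem_singleton_iff, not_or] at hσ
    have hσ1 : d₁ * σ ≠ (A₂ θ - A₁ θ) * p.1 := fun e => hσ.1 (by rw [← e]; field_simp)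
    have hσ2 : d₂ * σ ≠ -((A₂ θ - A₁ θ) * p.2) := fun e => hσ.2 (by rw [← e]; field_simp)
    have t1 := hA₁.tendsto_natCast_mul_sub σ
    have t2 := hA₂.tendsto_natCast_mul_sub σ
    have tθ : Tendsto (fun n : ℕ => θ + σ / (n + 2)) atTop (𝓝 θ) := by
      simpa using (tendsto_const_nhds (x := σ)).div_atTop tendsto_natCast_add_two |>.const_add θ
    have hI : ∀ᶠ n : ℕ in atTop, θ + σ / (n + 2) ∈ Icc α β :=
      tθ.eventually (Icc_mem_nhds hθ.1 hθ.2)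
    have c1 : ∀ n : ℕ, A₁ (θ + σ / (n + 2)) < A₁ θ + (A₂ θ - A₁ θ) * p.1 / (n + 2) ↔
        ((n : ℝ) + 2) * (A₁ (θ + σ / (n + 2)) - A₁ θ) < (A₂ θ - A₁ θ) * p.1 := by
      intro n
      have hn : (0 : ℝ) < n + 2 := by positivity
      rw [← sub_lt_iff_lt_add', lt_div_iff₀ hn, mul_comm]
    have c2 : ∀ n : ℕ, A₂ θ - (A₂ θ - A₁ θ) * p.2 / (n + 2) < A₂ (θ + σ / (n + 2)) ↔
        -((A₂ θ - A₁ θ) * p.2) < ((n : ℝ) + 2) * (A₂ (θ + σ / (n + 2)) - A₂ θ) := by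
      intro n
      have hn : (0 : ℝ) < n + 2 := by positivity
      rw [mul_comm ((n : ℝ) + 2), ← div_lt_iff₀ hn, neg_div]
      constructor <;> intro H <;> linarith
    by_cases hs : d₁ * σ < (A₂ θ - A₁ θ) * p.1 ∧ -((A₂ θ - A₁ θ) * p.2) < d₂ * σ
    · rw [indicator_of_mem (by exact hs)]
      have hlog : HasDerivAt (fun x => -Real.log (A₂ x - A₁ x)) (-((d₂ - d₁) / (A₂ θ - A₁ θ))) θ :=
        ((hA₂.sub hA₁).log hD.ne').neg
      have t3 := (hlog.tendsto_natCast_mul_sub σ)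
      rw [neg_mul] at t3
      refine ((Real.continuous_exp.tendsto _).comp t3).congr' ?_
      filter_upwards [hI, t1.eventually_lt_const hs.1, t2.eventually_const_lt hs.2] with n m0 m1 m2
      rw [likelihoodKernel_of_mem m0 ((c1 n).2 m1) ((c2 n).2 m2), Function.comp,
        ← Real.exp_log (div_pos hD (h.gap_pos _)), ← Real.exp_nat_mul,
        Real.log_div hD.ne' (h.gap_pos _).ne']
      push_cast
      ring_nf
    · rw [indicator_of_notMem (by exact hs)]
      refine tendsto_const_nhds.congr' ?_
      rw [not_and_or, not_lt, not_lt] at hs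
      rcases hs with hs | hs
      · filter_upwards [t1.eventually_const_lt (lt_of_le_of_ne hs hσ1.symm)] with n m1
        rw [likelihoodKernel, indicator_of_notMem]
        exact fun hm => absurd ((c1 n).1 hm.2.1) m1.le.not_gt
      · filter_upwards [t2.eventually_lt_const (lt_of_le_of_ne hs hσ2)] with n m1
        rw [likelihoodKernel, indicator_of_notMem]
        exact fun hm => absurd ((c2 n).1 hm.2.2) m1.le.not_gt

/-- The normalized kernel is an approximate identity: it lives on a ball of radius of order `1 / (n
+ 2)` about `θ`, has bounded height, and its mass times `n + 2` has a positive limit. Lebesgue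
points suffice, so no continuity of `g` is required; a prior cut off to an arbitrary compact set may
be discontinuous. The exceptional null set does not depend on `p`. -/
lemma ae_tendsto_kernel_mean (h : EndpointPair A₁ A₂ α β c C) {g : ℝ → ℝ}
    (hg : LocallyIntegrable g) : ∀ᵐ θ : ℝ, ∀ d₁ d₂ : ℝ, θ ∈ Ioo α β → HasDerivAt A₁ d₁ θ →
      HasDerivAt A₂ d₂ θ → 0 < d₁ → d₁ < d₂ → ∀ p : ℝ × ℝ, 0 < p.1 → 0 < p.2 →
        Tendsto (fun n : ℕ => (∫ τ, likelihoodKernel A₁ A₂ α β n θ p τ * g τ) /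
          ∫ τ, likelihoodKernel A₁ A₂ α β n θ p τ) atTop (𝓝 (g θ)) := by
  filter_upwards [IsUnifLocDoublingMeasure.ae_tendsto_average_norm_sub volume hg 1] with θ hleb
    d₁ d₂ hθ hA₁ hA₂ hd₁ hd p h1 h2
  have hθ' : θ ∈ Icc α β := Ioo_subset_Icc_self hθ
  have hC := h.C_pos hθ'
  have hc := h.c_pos
  set r := C / c * (p.1 + p.2) with hr
  have hr0 : 0 < r := by positivity
  have hN := h.tendsto_integral_kernel hθ hA₁ hA₂ hd₁ hd h1 h2
  have hN0 := limitMass_pos (h.gap_pos θ) hd₁ hd h1 h2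
  have hball : Tendsto (fun n : ℕ => ((n : ℝ) + 2) *
      ∫ τ in Metric.closedBall θ (r / (n + 2)), ‖g τ - g θ‖) atTop (𝓝 0) := by
    have t0 : Tendsto (fun n : ℕ => r / ((n : ℝ) + 2)) atTop (𝓝[>] 0) :=
      tendsto_nhdsWithin_iff.2 ⟨tendsto_const_nhds.div_atTop tendsto_natCast_add_two,
        Eventually.of_forall fun n => mem_Ioi.2 (by positivity)⟩
    -- The factor `2 * r` is `n + 2` times the length of the ball, which turns the average into the
    -- rescaled integral.
    have t1 := (hleb (fun _ => θ) _ t0 (Eventually.of_forall fun n => by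
      rw [one_mul]; exact Metric.mem_closedBall_self (by positivity))).const_mul (2 * r)
    rw [mul_zero] at t1
    refine t1.congr fun n => ?_
    have hn : (0 : ℝ) < n + 2 := by positivity
    rw [setAverage_eq, measureReal_def, Real.volume_closedBall, ENNReal.toReal_ofReal (by positivity),
      smul_eq_mul]
    field_simp
  have hdiff : Tendsto (fun n : ℕ => (∫ τ, likelihoodKernel A₁ A₂ α β n θ p τ * g τ) /
      (∫ τ, likelihoodKernel A₁ A₂ α β n θ p τ) - g θ) atTop (𝓝 0) := by
    have lim := (hball.const_mul (Real.exp ((C / c) ^ 2 * (p.1 + p.2)))).div hN hN0.ne'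
    rw [mul_zero, zero_div] at lim
    refine squeeze_zero_norm' ?_ lim
    filter_upwards [hN.eventually_const_lt hN0] with n hn0
    have hn : (0 : ℝ) < n + 2 := by positivity
    have hI0 : 0 < ∫ τ, likelihoodKernel A₁ A₂ α β n θ p τ := (pos_iff_pos_of_mul_pos hn0).1 hn
    have hkg := h.integrable_kernel_mul (n := n) hθ' h1 h2 hg
    have hk := h.integrable_kernel (n := n) hθ' h1 h2
    have e1 : (∫ τ, likelihoodKernel A₁ A₂ α β n θ p τ * g τ) /
        (∫ τ, likelihoodKernel A₁ A₂ α β n θ p τ) - g θ =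
        (∫ τ, likelihoodKernel A₁ A₂ α β n θ p τ * (g τ - g θ)) /
          ∫ τ, likelihoodKernel A₁ A₂ α β n θ p τ := by
      have : ∫ τ, likelihoodKernel A₁ A₂ α β n θ p τ * (g τ - g θ) =
          (∫ τ, likelihoodKernel A₁ A₂ α β n θ p τ * g τ) -
            (∫ τ, likelihoodKernel A₁ A₂ α β n θ p τ) * g θ := by
        rw [← integral_mul_const, ← integral_sub hkg (hk.mul_const _)]
        simp_rw [mul_sub]
      rw [this, sub_div, mul_div_cancel_left₀ _ hI0.ne']
    have hgl : LocallyIntegrable fun τ => g τ - g θ := hg.sub (locallyIntegrable_const _)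
    have e2 : ‖∫ τ, likelihoodKernel A₁ A₂ α β n θ p τ * (g τ - g θ)‖ ≤
        Real.exp ((C / c) ^ 2 * (p.1 + p.2)) *
          ∫ τ in Metric.closedBall θ (r / (n + 2)), ‖g τ - g θ‖ := by
      rw [← integral_indicator measurableSet_closedBall, ← integral_const_mul]
      refine (norm_integral_le_integral_norm _).trans
        (integral_mono (h.integrable_kernel_mul hθ' h1 h2 hgl).norm ?_ fun τ => ?_)
      · refine Integrable.const_mul ?_ _
        rw [integrable_indicator_iff measurableSet_closedBall]
        exact (hgl.integrableOn_isCompact (isCompact_closedBall _ _)).norm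
      · rw [norm_mul, Real.norm_of_nonneg (h.kernel_nonneg n θ p τ)]
        refine (mul_le_mul_of_nonneg_right (h.kernel_le hθ' h1 h2 τ) (norm_nonneg _)).trans
          (le_of_eq ?_)
        rw [← hr]
        by_cases ht : τ ∈ Metric.closedBall θ (r / (n + 2)) <;> simp [ht]
    rw [e1, norm_div, Real.norm_of_nonneg hI0.le]
    calc _ ≤ (Real.exp ((C / c) ^ 2 * (p.1 + p.2)) *
          ∫ τ in Metric.closedBall θ (r / (n + 2)), ‖g τ - g θ‖) /
            ∫ τ, likelihoodKernel A₁ A₂ α β n θ p τ := by gcongr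
      _ = _ := by simp only [Pi.div_apply]; field_simp
  simpa using hdiff.add_const (g θ)

end EndpointPair

/-- Factoring the larger exponential out of the difference leaves `1 - exp` of a negative
combination of the two gaps, whose logarithm is the digamma-producing term. -/
lemma neg_log_limitMass {D d₁ d₂ : ℝ} (hD : 0 < D) (hd₁ : 0 < d₁) (hd : d₁ < d₂) {p : ℝ × ℝ}
    (h1 : 0 < p.1) (h2 : 0 < p.2) :
    -Real.log (limitMass D d₁ d₂ p) = Real.log ((d₂ - d₁) / D) - p.2 / (d₁ / (d₂ - d₁) + 1) +
      logGap (d₁ / (d₂ - d₁)) p := by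
  have hd₂ : 0 < d₂ := hd₁.trans hd
  have hdd : 0 < d₂ - d₁ := by linarith
  have hl : 0 < (d₂ - d₁) / D := div_pos hdd hD
  have hz1 : d₁ / (d₂ - d₁) + 1 = d₂ / (d₂ - d₁) := by field_simp; ring
  have e1 : p.2 / (d₁ / (d₂ - d₁) + 1) = (d₂ - d₁) / d₂ * p.2 := by rw [hz1]; field_simp
  have e2 : p.1 / (d₁ / (d₂ - d₁)) = (d₂ - d₁) / d₁ * p.1 := by field_simp
  have hlt : Real.exp (-((d₂ - d₁) / d₁ * p.1 + (d₂ - d₁) / d₂ * p.2)) < 1 := by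
    rw [Real.exp_lt_one_iff, neg_lt_zero]; positivity
  have e3 : Real.exp ((d₂ - d₁) / d₂ * p.2) - Real.exp (-((d₂ - d₁) / d₁ * p.1)) =
      Real.exp ((d₂ - d₁) / d₂ * p.2) *
        (1 - Real.exp (-((d₂ - d₁) / d₁ * p.1 + (d₂ - d₁) / d₂ * p.2))) := by
    rw [mul_sub, mul_one, ← Real.exp_add]; ring_nf
  rw [logGap, e1, e2, limitMass, e3, Real.log_div (mul_ne_zero (Real.exp_pos _).ne'
    (by linarith)) hl.ne', Real.log_mul (Real.exp_pos _).ne' (by linarith), Real.log_exp]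
  ring

lemma integral_exp_neg_quadrant :
    Integrable (fun p : ℝ × ℝ => Real.exp (-(p.1 + p.2))) quadrantMeasure ∧
      ∫ p : ℝ × ℝ, Real.exp (-(p.1 + p.2)) ∂quadrantMeasure = 1 := by
  have hexp : ∀ p : ℝ × ℝ, Real.exp (-(p.1 + p.2)) = Real.exp (-1 * p.1) * Real.exp (-1 * p.2) :=
    fun p => by rw [← Real.exp_add]; ring_nf
  simp_rw [hexp]
  refine ⟨integrable_exp_mul_quadrant one_pos one_pos, ?_⟩
  rw [integral_exp_mul_quadrant one_pos one_pos]
  norm_num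

lemma integral_neg_log_limitMass {D d₁ d₂ : ℝ} (hD : 0 < D) (hd₁ : 0 < d₁) (hd : d₁ < d₂) :
    Integrable (fun p : ℝ × ℝ => Real.exp (-(p.1 + p.2)) * -Real.log (limitMass D d₁ d₂ p))
      quadrantMeasure ∧
    ∫ p : ℝ × ℝ, Real.exp (-(p.1 + p.2)) * -Real.log (limitMass D d₁ d₂ p) ∂quadrantMeasure =
      Real.log ((d₂ - d₁) / D) - 1 / (d₁ / (d₂ - d₁) + 1) +
        expectedLogGap (d₁ / (d₂ - d₁)) := by
  have hz : 0 < d₁ / (d₂ - d₁) := div_pos hd₁ (by linarith)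
  set z := d₁ / (d₂ - d₁) with hzdef
  have hexp : ∀ p : ℝ × ℝ, Real.exp (-(p.1 + p.2)) = Real.exp (-p.1) * Real.exp (-p.2) := fun p => by
    rw [← Real.exp_add]; ring_nf
  have i0 : IntegrableOn (fun x : ℝ => Real.exp (-x)) (Ioi 0) := integrableOn_exp_neg_Ioi 0
  have i1 : IntegrableOn (fun x : ℝ => Real.exp (-x) * x) (Ioi 0) := by
    have := Real.GammaIntegral_convergent (s := 2) (by norm_num)
    refine this.congr_fun (fun x hx => ?_) measurableSet_Ioi
    norm_num
  have v0 : ∫ x in Ioi (0 : ℝ), Real.exp (-x) = 1 := integral_exp_neg_Ioi_zero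
  have v1 : ∫ x in Ioi (0 : ℝ), Real.exp (-x) * x = 1 := by
    have := Real.Gamma_eq_integral (s := 2) (by norm_num)
    rw [Real.Gamma_two] at this
    rw [this]
    refine setIntegral_congr_fun measurableSet_Ioi fun x hx => ?_
    norm_num
  obtain ⟨j0, w0⟩ := integral_exp_neg_quadrant
  have j1 : Integrable (fun p : ℝ × ℝ => Real.exp (-(p.1 + p.2)) * p.2) quadrantMeasure := by
    simp_rw [hexp, mul_assoc]; exact Integrable.mul_prod i0 i1
  have w1 : ∫ p : ℝ × ℝ, Real.exp (-(p.1 + p.2)) * p.2 ∂quadrantMeasure = 1 := by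
    simp_rw [hexp, mul_assoc]
    rw [quadrantMeasure, integral_prod_mul (fun x => Real.exp (-x)) (fun x => Real.exp (-x) * x), v0,
      v1, one_mul]
  have e : (fun p : ℝ × ℝ => Real.exp (-(p.1 + p.2)) * -Real.log (limitMass D d₁ d₂ p))
      =ᵐ[quadrantMeasure] fun p => Real.exp (-(p.1 + p.2)) * Real.log ((d₂ - d₁) / D) -
        Real.exp (-(p.1 + p.2)) * p.2 * (1 / (z + 1)) +
        Real.exp (-(p.1 + p.2)) * logGap z p := by
    filter_upwards [ae_quadrantMeasure] with p hp
    rw [neg_log_limitMass hD hd₁ hd hp.1 hp.2]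
    ring
  refine ⟨(((j0.mul_const _).sub' (j1.mul_const _)).add (integrable_logGap hz)).congr e.symm, ?_⟩
  rw [integral_congr_ae e, integral_add ((j0.mul_const _).sub' (j1.mul_const _)) (integrable_logGap hz),
    integral_sub (j0.mul_const _) (j1.mul_const _), integral_mul_const, integral_mul_const, w0, w1]
  simp [expectedLogGap]

/-! ### Asymptotics of the expected information of uniform samples -/

/-- The likelihood of a sample from the uniform distribution on `(A₁ θ, A₂ θ)`. -/
def uniformLikelihood (A₁ A₂ : ℝ → ℝ) (k : ℕ) (z : ℝ × (Fin k → ℝ)) : ℝ :=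
  ∏ i, (Ioo (A₁ z.1) (A₂ z.1)).indicator (fun _ => 1 / (A₂ z.1 - A₁ z.1)) (z.2 i)

/-- The likelihood of a uniform sample of size `k` as a function of its range. -/
def rangeLikelihood (A₁ A₂ : ℝ → ℝ) (k : ℕ) (z : ℝ × (ℝ × ℝ)) : ℝ :=
  {z : ℝ × (ℝ × ℝ) | A₁ z.1 < z.2.1 ∧ z.2.2 < A₂ z.1}.indicator
    (fun z => (1 / (A₂ z.1 - A₁ z.1)) ^ k) z

lemma rangeLikelihood_of_mem {A₁ A₂ : ℝ → ℝ} {k : ℕ} {θ : ℝ} {q : ℝ × ℝ}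
    (hq : A₁ θ < q.1 ∧ q.2 < A₂ θ) :
    rangeLikelihood A₁ A₂ k (θ, q) = (1 / (A₂ θ - A₁ θ)) ^ k :=
  indicator_of_mem (s := {z : ℝ × (ℝ × ℝ) | A₁ z.1 < z.2.1 ∧ z.2.2 < A₂ z.1}) (a := (θ, q)) hq _

lemma rangeLikelihood_of_notMem {A₁ A₂ : ℝ → ℝ} {k : ℕ} {θ : ℝ} {q : ℝ × ℝ}
    (hq : ¬ (A₁ θ < q.1 ∧ q.2 < A₂ θ)) : rangeLikelihood A₁ A₂ k (θ, q) = 0 :=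
  indicator_of_notMem (s := {z : ℝ × (ℝ × ℝ) | A₁ z.1 < z.2.1 ∧ z.2.2 < A₂ z.1}) (a := (θ, q)) hq _

lemma uniformLikelihood_eq_rangeLikelihood (A₁ A₂ : ℝ → ℝ) (n : ℕ) (θ : ℝ) (x : Fin (n + 2) → ℝ) :
    uniformLikelihood A₁ A₂ (n + 2) (θ, x) = rangeLikelihood A₁ A₂ (n + 2) (θ, sampleRange x) := by
  unfold uniformLikelihood rangeLikelihood
  by_cases hx : ∀ i, x i ∈ Ioo (A₁ θ) (A₂ θ)
  · rw [indicator_of_mem, Finset.prod_congr rfl fun i _ => indicator_of_mem (hx i) _]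
    · simp
    · exact ⟨lt_sampleRange_fst_iff.2 fun i => (hx i).1, sampleRange_snd_lt_iff.2 fun i => (hx i).2⟩
  · rw [indicator_of_notMem]
    · push Not at hx
      obtain ⟨i, hi⟩ := hx
      exact Finset.prod_eq_zero (Finset.mem_univ i) (indicator_of_notMem hi _)
    · exact fun hm => hx fun i => ⟨lt_sampleRange_fst_iff.1 hm.1 i, sampleRange_snd_lt_iff.1 hm.2 i⟩

/-- Lebesgue measure on the samples with values in `(a, b)`. -/
abbrev boxMeasure (a b : ℝ) (k : ℕ) : Measure (Fin k → ℝ) :=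
  (Measure.pi fun _ => volume).restrict (univ.pi fun _ => Ioo a b)

instance (a b : ℝ) (k : ℕ) : IsFiniteMeasure (boxMeasure a b k) := by
  refine ⟨?_⟩
  rw [Measure.restrict_apply_univ, Measure.pi_pi]
  simp

namespace EndpointPair

variable {A₁ A₂ : ℝ → ℝ} {α β c C : ℝ}

lemma isBoundedWeight_uniformLikelihood (h : EndpointPair A₁ A₂ α β c C) (k : ℕ) :
    IsBoundedWeight (uniformLikelihood A₁ A₂ k) ((1 / c) ^ k) := by
  have hc := h.c_pos
  have hm1 := h.cont₁.measurable
  have hm2 := h.cont₂.measurable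
  have e : ∀ z : ℝ × (Fin k → ℝ), ∀ i, (Ioo (A₁ z.1) (A₂ z.1)).indicator
      (fun _ => 1 / (A₂ z.1 - A₁ z.1)) (z.2 i) =
      {z : ℝ × (Fin k → ℝ) | A₁ z.1 < z.2 i ∧ z.2 i < A₂ z.1}.indicator
        (fun z => 1 / (A₂ z.1 - A₁ z.1)) z := fun z i => rfl
  have h0 : ∀ z : ℝ × (Fin k → ℝ), ∀ i, 0 ≤ (Ioo (A₁ z.1) (A₂ z.1)).indicator
      (fun _ => 1 / (A₂ z.1 - A₁ z.1)) (z.2 i) := fun z i =>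
    indicator_nonneg (fun _ _ => one_div_nonneg.2 (h.gap_pos _).le) _
  refine ⟨?_, fun z => Finset.prod_nonneg fun i _ => h0 z i, fun z => ?_⟩
  · unfold uniformLikelihood
    refine Finset.measurable_fun_prod _ fun i _ => ?_
    simp_rw [e]
    refine Measurable.indicator (by fun_prop) ?_
    have m1 : MeasurableSet {z : ℝ × (Fin k → ℝ) | A₁ z.1 < z.2 i} :=
      measurableSet_lt (by fun_prop) (by fun_prop)
    have m2 : MeasurableSet {z : ℝ × (Fin k → ℝ) | z.2 i < A₂ z.1} :=
      measurableSet_lt (by fun_prop) (by fun_prop)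
    exact m1.inter m2
  · refine (Finset.prod_le_prod (fun i _ => h0 z i) fun i _ => ?_).trans (le_of_eq
      (by rw [Finset.prod_const, Finset.card_univ, Fintype.card_fin]))
    exact indicator_le' (fun _ _ => one_div_le_one_div_of_le hc (h.le_gap _))
      (fun _ _ => by positivity) _

lemma isBoundedWeight_rangeLikelihood (h : EndpointPair A₁ A₂ α β c C) (k : ℕ) :
    IsBoundedWeight (rangeLikelihood A₁ A₂ k) ((1 / c) ^ k) := by
  have hc := h.c_pos
  have hm1 := h.cont₁.measurable
  have hm2 := h.cont₂.measurable
  refine ⟨?_, fun z => indicator_nonneg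
    (fun z _ => pow_nonneg (one_div_nonneg.2 (h.gap_pos _).le) _) _, fun z => ?_⟩
  · refine Measurable.indicator (by fun_prop) ?_
    have m1 : MeasurableSet {z : ℝ × (ℝ × ℝ) | A₁ z.1 < z.2.1} :=
      measurableSet_lt (by fun_prop) (by fun_prop)
    have m2 : MeasurableSet {z : ℝ × (ℝ × ℝ) | z.2.2 < A₂ z.1} :=
      measurableSet_lt (by fun_prop) (by fun_prop)
    exact m1.inter m2
  · exact indicator_le' (fun z _ => pow_le_pow_left₀ (one_div_nonneg.2 (h.gap_pos _).le)
      (one_div_le_one_div_of_le hc (h.le_gap _)) _) (fun _ _ => by positivity) _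

lemma mixture_uniformLikelihood (n : ℕ) (g : ℝ → ℝ) (μ : Measure ℝ) (x : Fin (n + 2) → ℝ) :
    mixture μ (uniformLikelihood A₁ A₂ (n + 2)) g x =
      mixture μ (rangeLikelihood A₁ A₂ (n + 2)) g (sampleRange x) := by
  unfold mixture
  simp_rw [uniformLikelihood_eq_rangeLikelihood]

lemma uniformLikelihood_eq_zero (h : EndpointPair A₁ A₂ α β c C) (k : ℕ) {θ : ℝ}
    (hθ : θ ∈ Icc α β) {x : Fin k → ℝ} (hx : x ∉ univ.pi fun _ => Ioo (A₁ α) (A₂ β)) :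
    uniformLikelihood A₁ A₂ k (θ, x) = 0 := by
  simp only [Set.mem_pi, mem_univ, true_imp_iff, not_forall] at hx
  obtain ⟨i, hi⟩ := hx
  refine Finset.prod_eq_zero (Finset.mem_univ i) (indicator_of_notMem (fun hm => hi ?_) _)
  have hαβ : α ≤ β := hθ.1.trans hθ.2
  have e1 := h.lower₁ α (left_mem_Icc.2 hαβ) θ hθ hθ.1
  have e2 := h.lower₂ θ hθ β (right_mem_Icc.2 hαβ) hθ.2
  have hc := h.c_pos
  have e3 : 0 ≤ c * (θ - α) := mul_nonneg hc.le (by linarith [hθ.1])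
  have e4 : 0 ≤ c * (β - θ) := mul_nonneg hc.le (by linarith [hθ.2])
  exact ⟨by linarith [hm.1], by linarith [hm.2]⟩

lemma integral_uniformLikelihood (h : EndpointPair A₁ A₂ α β c C) (k : ℕ) {θ : ℝ}
    (hθ : θ ∈ Icc α β) :
    ∫ x, uniformLikelihood A₁ A₂ k (θ, x) ∂boxMeasure (A₁ α) (A₂ β) k = 1 := by
  rw [setIntegral_eq_integral_of_forall_compl_eq_zero fun x hx => h.uniformLikelihood_eq_zero k hθ hx]
  unfold uniformLikelihood
  simp only
  rw [integral_fintype_prod_eq_prod (fun (_ : Fin k) (y : ℝ) =>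
    (Ioo (A₁ θ) (A₂ θ)).indicator (fun _ => 1 / (A₂ θ - A₁ θ)) y)]
  refine Finset.prod_eq_one fun i _ => ?_
  have := h.gap_pos θ
  rw [integral_indicator measurableSet_Ioo]
  simp [this.le, this.ne']

/-- The likelihood kernel is a likelihood ratio. -/
lemma likelihoodKernel_eq (n : ℕ) (θ : ℝ) (p : ℝ × ℝ) (τ : ℝ) :
    likelihoodKernel A₁ A₂ α β n θ p τ = (Icc α β).indicator (fun τ => (A₂ θ - A₁ θ) ^ (n + 2) *
      rangeLikelihood A₁ A₂ (n + 2) (τ, (A₁ θ + (A₂ θ - A₁ θ) * p.1 / (n + 2),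
        A₂ θ - (A₂ θ - A₁ θ) * p.2 / (n + 2)))) τ := by
  by_cases h1 : τ ∈ Icc α β
  · rw [indicator_of_mem h1]
    by_cases h2 : A₁ τ < A₁ θ + (A₂ θ - A₁ θ) * p.1 / (n + 2) ∧
        A₂ θ - (A₂ θ - A₁ θ) * p.2 / (n + 2) < A₂ τ
    · rw [likelihoodKernel_of_mem h1 h2.1 h2.2, rangeLikelihood_of_mem h2, ← mul_pow, mul_one_div]
    · rw [rangeLikelihood_of_notMem h2, mul_zero, likelihoodKernel,
        indicator_of_notMem (fun hm => h2 hm.2)]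
  · rw [indicator_of_notMem h1, likelihoodKernel, indicator_of_notMem (fun hm => h1 hm.1)]

lemma integral_kernel_mul_eq (n : ℕ) (θ : ℝ) (p : ℝ × ℝ)
    (g : ℝ → ℝ) : ∫ τ, likelihoodKernel A₁ A₂ α β n θ p τ * g τ = (A₂ θ - A₁ θ) ^ (n + 2) *
      mixture (volume.restrict (Icc α β)) (rangeLikelihood A₁ A₂ (n + 2)) g
        (A₁ θ + (A₂ θ - A₁ θ) * p.1 / (n + 2), A₂ θ - (A₂ θ - A₁ θ) * p.2 / (n + 2)) := by
  simp_rw [likelihoodKernel_eq, ← indicator_mul_left]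
  rw [integral_indicator measurableSet_Icc, mixture, ← integral_const_mul]
  simp_rw [mul_assoc]

lemma measurable_integral_kernel_mul (h : EndpointPair A₁ A₂ α β c C) (n : ℕ) (θ : ℝ)
    {g : ℝ → ℝ} {G : ℝ} (hg : IsBoundedWeight g G) :
    Measurable fun p => ∫ τ, likelihoodKernel A₁ A₂ α β n θ p τ * g τ := by
  simp_rw [integral_kernel_mul_eq]
  exact (((h.isBoundedWeight_rangeLikelihood (n + 2)).mixture hg).measurable.comp
    (by fun_prop)).const_mul _

/-- The conditional expected information at `θ`, in terms of the rescaled gaps. -/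
lemma integral_uniformLikelihood_mul (h : EndpointPair A₁ A₂ α β c C) (n : ℕ) {g : ℝ → ℝ} {G : ℝ}
    (hg : IsBoundedWeight g G) {θ δ : ℝ} (hδ : 0 < δ) (hθ : θ ∈ Icc α β)
    (hgδ : g θ ≠ 0 → θ ≤ β - δ) :
    ∫ x, (uniformLikelihood A₁ A₂ (n + 2) (θ, x) * g θ * Real.log
        (uniformLikelihood A₁ A₂ (n + 2) (θ, x) / mixture (volume.restrict (Icc α β))
          (uniformLikelihood A₁ A₂ (n + 2)) (fun _ => 1) x) +
      uniformLikelihood A₁ A₂ (n + 2) (θ, x) * Real.negMulLog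
        (mixture (volume.restrict (Icc α β)) (uniformLikelihood A₁ A₂ (n + 2)) g x /
          mixture (volume.restrict (Icc α β)) (uniformLikelihood A₁ A₂ (n + 2)) (fun _ => 1) x) -
      uniformLikelihood A₁ A₂ (n + 2) (θ, x) * g θ * Real.log (n + 2))
        ∂boxMeasure (A₁ α) (A₂ β) (n + 2) =
    ∫ p, gapDensity n p *
      (g θ * -Real.log ((n + 2) * ∫ τ, likelihoodKernel A₁ A₂ α β n θ p τ) + Real.negMulLog
        ((∫ τ, likelihoodKernel A₁ A₂ α β n θ p τ * g τ) /
          ∫ τ, likelihoodKernel A₁ A₂ α β n θ p τ)) ∂quadrantMeasure := by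
  have hD := h.gap_pos θ
  set L := rangeLikelihood A₁ A₂ (n + 2) with hL
  set μ := (volume : Measure ℝ).restrict (Icc α β) with hμ
  have hLw := h.isBoundedWeight_rangeLikelihood (n + 2)
  set f : ℝ × ℝ → ℝ := fun q => L (θ, q) * g θ * Real.log (L (θ, q) / mixture μ L (fun _ => 1) q) +
    L (θ, q) * Real.negMulLog (mixture μ L g q / mixture μ L (fun _ => 1) q) -
      L (θ, q) * g θ * Real.log (n + 2) with hf
  have hfm : Measurable f := by
    have m1 : Measurable fun q => L (θ, q) := hLw.measurable.comp measurable_prodMk_left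
    have m2 : Measurable (mixture μ L g) := (hLw.mixture hg).measurable
    have m3 : Measurable (mixture μ L fun _ => 1) := (hLw.mixture isBoundedWeight_one).measurable
    have m4 := Real.continuous_negMulLog.measurable.comp (m2.div m3)
    exact (((m1.mul_const _).mul (Real.measurable_log.comp (m1.div m3))).add (m1.mul m4)).sub
      ((m1.mul_const _).mul_const _)
  rw [setIntegral_eq_integral_of_forall_compl_eq_zero fun x hx => by
    simp [h.uniformLikelihood_eq_zero (n + 2) hθ hx]]
  simp_rw [mixture_uniformLikelihood, uniformLikelihood_eq_rangeLikelihood]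
  rw [integral_comp_sampleRange n hfm, integral_rangeDensity_rescale n (sub_pos.1 hD) f]
  · refine integral_congr_ae ?_
    filter_upwards [ae_quadrantMeasure] with p hp
    congr 1
    set q := (A₁ θ + (A₂ θ - A₁ θ) * p.1 / (n + 2), A₂ θ - (A₂ θ - A₁ θ) * p.2 / (n + 2)) with hq
    have hLq : L (θ, q) = (1 / (A₂ θ - A₁ θ)) ^ (n + 2) := by
      have p1 := hp.1
      have p2 := hp.2
      have b1 : 0 < (A₂ θ - A₁ θ) * p.1 / (n + 2) := by positivity
      have b2 : 0 < (A₂ θ - A₁ θ) * p.2 / (n + 2) := by positivity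
      exact rangeLikelihood_of_mem ⟨by simp only [hq]; linarith, by simp only [hq]; linarith⟩
    -- The Jacobian power left by the rescaling cancels the likelihood at the true parameter
    -- exactly.
    have hDL : (A₂ θ - A₁ θ) ^ (n + 2) * L (θ, q) = 1 := by
      rw [hLq, ← mul_pow, mul_one_div_cancel hD.ne', one_pow]
    have k1 := integral_kernel_mul_eq (A₁ := A₁) (A₂ := A₂) (α := α) (β := β) n θ p (fun _ => 1)
    have kg := integral_kernel_mul_eq (A₁ := A₁) (A₂ := A₂) (α := α) (β := β) n θ p g
    simp only [mul_one, ← hμ, ← hL, ← hq] at k1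
    simp only [← hμ, ← hL, ← hq] at kg
    have hDp : (A₂ θ - A₁ θ) ^ (n + 2) ≠ 0 := (pow_pos hD _).ne'
    have hV : mixture μ L g q / mixture μ L (fun _ => 1) q =
        (∫ τ, likelihoodKernel A₁ A₂ α β n θ p τ * g τ) /
          ∫ τ, likelihoodKernel A₁ A₂ α β n θ p τ := by
      rw [k1, kg, mul_div_mul_left _ _ hDp]
    -- Positivity of the kernel mass is guaranteed only with room `δ` to the right of `θ`; where
    -- that may fail, `g θ = 0` removes the term.
    have hlog : g θ * Real.log (L (θ, q) / mixture μ L (fun _ => 1) q) - g θ * Real.log (n + 2) =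
        g θ * -Real.log ((n + 2) * ∫ τ, likelihoodKernel A₁ A₂ α β n θ p τ) := by
      by_cases hgθ : g θ = 0
      · simp [hgθ]
      have hlow := h.le_integral_kernel (n := n) hδ ⟨hθ.1, hgδ hgθ⟩ hp.1 hp.2
      have hC := h.C_pos hθ
      have hc := h.c_pos
      have p1 := hp.1
      have hn : (0 : ℝ) < n + 2 := by positivity
      have hpos : 0 < (n + 2) * ∫ τ, likelihoodKernel A₁ A₂ α β n θ p τ := lt_of_lt_of_le (by positivity) hlow
      have hI : 0 < ∫ τ, likelihoodKernel A₁ A₂ α β n θ p τ := (pos_iff_pos_of_mul_pos hpos).1 hn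
      have e1 : L (θ, q) / mixture μ L (fun _ => 1) q =
          (∫ τ, likelihoodKernel A₁ A₂ α β n θ p τ)⁻¹ := by
        rw [k1, mul_inv, ← eq_inv_of_mul_eq_one_right hDL, div_eq_mul_inv]
      rw [e1, Real.log_inv, Real.log_mul hn.ne' hI.ne']
      ring
    rw [← hV, ← hlog]
    simp only [hf]
    linear_combination (g θ * Real.log (L (θ, q) / mixture μ L (fun _ => 1) q) +
      Real.negMulLog (mixture μ L g q / mixture μ L (fun _ => 1) q) - g θ * Real.log (n + 2)) * hDL
  · intro q hq
    have : L (θ, q) = 0 := rangeLikelihood_of_notMem hq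
    simp [hf, this]

/-- The pointwise limit of the expected information, up to the logarithm of the sample size. -/
def localInfo (D d₁ d₂ : ℝ) : ℝ :=
  Real.log ((d₂ - d₁) / D) - 1 / (d₁ / (d₂ - d₁) + 1) + expectedLogGap (d₁ / (d₂ - d₁))

/-- Two nested dominated convergences, over the parameter and over the rescaled gaps. Expressing the
information through the flat weight separates a logarithm of kernel mass, which does not see `g`,
from a bounded function of the kernel mean of `g`. -/
theorem tendsto_expectedInfo (h : EndpointPair A₁ A₂ α β c C) {g : ℝ → ℝ} {G : ℝ}
    (hg : IsBoundedWeight g G) {δ : ℝ} (hδ : 0 < δ) (hαβ : α ≤ β) (hgδ : ∀ θ, g θ ≠ 0 → θ ≤ β - δ)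
    (hg1 : ∫ θ in Icc α β, g θ = 1) {d₁ d₂ : ℝ → ℝ}
    (hA₁ : ∀ θ ∈ Ioo α β, HasDerivAt A₁ (d₁ θ) θ) (hA₂ : ∀ θ ∈ Ioo α β, HasDerivAt A₂ (d₂ θ) θ)
    (hd₁ : ∀ θ ∈ Ioo α β, 0 < d₁ θ) (hd : ∀ θ ∈ Ioo α β, d₁ θ < d₂ θ) :
    Tendsto (fun n : ℕ => (∫ z, uniformLikelihood A₁ A₂ (n + 2) z * g z.1 * Real.log
        (uniformLikelihood A₁ A₂ (n + 2) z / mixture (volume.restrict (Icc α β))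
          (uniformLikelihood A₁ A₂ (n + 2)) g z.2)
        ∂((volume.restrict (Icc α β)).prod (boxMeasure (A₁ α) (A₂ β) (n + 2)))) -
          Real.log (n + 2)) atTop
      (𝓝 (∫ θ in Icc α β, (g θ * localInfo (A₂ θ - A₁ θ) (d₁ θ) (d₂ θ) +
        Real.negMulLog (g θ)))) := by
  have hG : 0 ≤ G := hg.bound_nonneg
  set μ := (volume : Measure ℝ).restrict (Icc α β) with hμ
  set Ψ : ℕ → ℝ → ℝ × ℝ → ℝ := fun n θ p =>
    g θ * -Real.log ((n + 2) * ∫ τ, likelihoodKernel A₁ A₂ α β n θ p τ) + Real.negMulLog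
        ((∫ τ, likelihoodKernel A₁ A₂ α β n θ p τ * g τ) /
          ∫ τ, likelihoodKernel A₁ A₂ α β n θ p τ) with hΨ
  set Φ : ℕ → ℝ → ℝ := fun n θ =>
    ∫ x, (uniformLikelihood A₁ A₂ (n + 2) (θ, x) * g θ * Real.log
        (uniformLikelihood A₁ A₂ (n + 2) (θ, x) / mixture μ
          (uniformLikelihood A₁ A₂ (n + 2)) (fun _ => 1) x) +
      uniformLikelihood A₁ A₂ (n + 2) (θ, x) * Real.negMulLog
        (mixture μ (uniformLikelihood A₁ A₂ (n + 2)) g x /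
          mixture μ (uniformLikelihood A₁ A₂ (n + 2)) (fun _ => 1) x) -
      uniformLikelihood A₁ A₂ (n + 2) (θ, x) * g θ * Real.log (n + 2))
        ∂boxMeasure (A₁ α) (A₂ β) (n + 2) with hΦ
  have hΦΨ : ∀ n, ∀ θ ∈ Icc α β, Φ n θ = ∫ p, gapDensity n p * Ψ n θ p ∂quadrantMeasure :=
    fun n θ hθ => h.integral_uniformLikelihood_mul n hg hδ hθ (hgδ θ)
  have hred : ∀ n : ℕ, AEStronglyMeasurable (Φ n) μ ∧
      (∫ z, uniformLikelihood A₁ A₂ (n + 2) z * g z.1 * Real.log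
        (uniformLikelihood A₁ A₂ (n + 2) z / mixture μ
          (uniformLikelihood A₁ A₂ (n + 2)) g z.2)
        ∂(μ.prod (boxMeasure (A₁ α) (A₂ β) (n + 2)))) - Real.log (n + 2) = ∫ θ, Φ n θ ∂μ := by
    intro n
    have hL := h.isBoundedWeight_uniformLikelihood (n + 2)
    obtain ⟨hi, he⟩ := integral_mul_log_div_mixture (μ := μ)
      (ν := boxMeasure (A₁ α) (A₂ β) (n + 2)) hL hg hG
    have hi2 : Integrable (fun z : ℝ × (Fin (n + 2) → ℝ) =>
        uniformLikelihood A₁ A₂ (n + 2) z * g z.1 * Real.log (n + 2))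
        (μ.prod (boxMeasure (A₁ α) (A₂ β) (n + 2))) := ((hL.mul_fst hg).integrable).mul_const _
    have hone : ∫ z, uniformLikelihood A₁ A₂ (n + 2) z * g z.1 * Real.log (n + 2)
        ∂(μ.prod (boxMeasure (A₁ α) (A₂ β) (n + 2))) = Real.log (n + 2) := by
      rw [integral_mul_const, integral_prod _ (hL.mul_fst hg).integrable]
      have : ∫ θ, ∫ x, uniformLikelihood A₁ A₂ (n + 2) (θ, x) * g θ
          ∂boxMeasure (A₁ α) (A₂ β) (n + 2) ∂μ = ∫ θ, g θ ∂μ := by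
        refine setIntegral_congr_fun measurableSet_Icc fun θ hθ => ?_
        rw [integral_mul_const, h.integral_uniformLikelihood _ hθ, one_mul]
      rw [this, hg1, one_mul]
    refine ⟨(hi.sub hi2).integral_prod_left.aestronglyMeasurable, ?_⟩
    rw [he]
    conv_lhs => rw [← hone]
    rw [← integral_sub hi hi2, integral_prod _ (hi.sub' hi2)]
  simp_rw [(hred _).2]
  obtain ⟨A, B, hA0, hB0, hAB⟩ := h.exists_abs_log_integral_kernel_le hδ hαβ
  obtain ⟨K, hK0, hK⟩ := exists_abs_negMulLog_le G
  -- The exponential dominates the gap density, the bracket the integrand. It is free of both `n`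
  -- and `θ`, so its integral also dominates in the outer limit.
  set dom : ℝ × ℝ → ℝ := fun p => Real.exp (-(1 / 3 * (p.1 + p.2))) *
      ((G * A + K) * (1 + p.1 + p.2) + G * B * p.1 ^ (-(1 / 2) : ℝ)) with hdom
  have hdomi : Integrable dom quadrantMeasure := integrable_logDominating _ (by norm_num) _ _
  have hbound : ∀ n, ∀ θ ∈ Icc α β, ∀ᵐ p ∂quadrantMeasure,
      ‖gapDensity (n + 1) p * Ψ (n + 1) θ p‖ ≤ dom p := by
    intro n θ hθ
    filter_upwards [ae_quadrantMeasure] with p hp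
    have p1 := hp.1
    have p2 := hp.2
    have q1 : 0 ≤ A * (1 + p.1 + p.2) + B * p.1 ^ (-(1 / 2) : ℝ) := by positivity
    rw [norm_mul, Real.norm_of_nonneg (gapDensity_nonneg _ _)]
    refine mul_le_mul (gapDensity_le n p1 p2) ?_ (norm_nonneg _) (Real.exp_pos _).le
    have b1 : ‖g θ * -Real.log ((((n + 1 : ℕ) : ℝ) + 2) * ∫ τ,
        likelihoodKernel A₁ A₂ α β (n + 1) θ p τ)‖ ≤
        G * (A * (1 + p.1 + p.2) + B * p.1 ^ (-(1 / 2) : ℝ)) := by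
      by_cases hgθ : g θ = 0
      · rw [hgθ, zero_mul, norm_zero]; positivity
      · rw [norm_mul, norm_neg, Real.norm_of_nonneg (hg.nonneg _)]
        exact mul_le_mul (hg.le _) (hAB (n + 1) θ ⟨hθ.1, hgδ θ hgθ⟩ p p1 p2) (norm_nonneg _) hG
    have b2 : ‖Real.negMulLog ((∫ τ, likelihoodKernel A₁ A₂ α β (n + 1) θ p τ * g τ) /
          ∫ τ, likelihoodKernel A₁ A₂ α β (n + 1) θ p τ)‖ ≤ K := by
      have hk := h.integrable_kernel (n := n + 1) hθ p1 p2
      have k0 : 0 ≤ ∫ τ, likelihoodKernel A₁ A₂ α β (n + 1) θ p τ :=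
        integral_nonneg fun τ => h.kernel_nonneg _ _ _ _
      refine hK _ (div_nonneg (integral_nonneg fun τ => mul_nonneg (h.kernel_nonneg _ _ _ _)
        (hg.nonneg _)) k0) (div_le_of_le_mul₀ k0 hG ?_)
      rw [← integral_const_mul]
      refine integral_mono_of_nonneg (ae_of_all _ fun τ => mul_nonneg (h.kernel_nonneg _ _ _ _)
        (hg.nonneg _)) (hk.const_mul G) (ae_of_all _ fun τ => ?_)
      simp only
      rw [mul_comm G]
      exact mul_le_mul_of_nonneg_left (hg.le τ) (h.kernel_nonneg _ _ _ _)
    refine (norm_add_le _ _).trans ((add_le_add b1 b2).trans ?_)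
    have : 0 ≤ K * (p.1 + p.2) := by positivity
    linarith
  have hgl : LocallyIntegrable g := (locallyIntegrable_const G).mono
    hg.measurable.aestronglyMeasurable (ae_of_all _ fun θ => by
      rw [Real.norm_of_nonneg (hg.nonneg θ), Real.norm_of_nonneg hG]; exact hg.le θ)
  -- The exponential bound on the gap density is stated from index one on.
  rw [← tendsto_add_atTop_iff_nat 1]
  refine tendsto_integral_of_dominated_convergence (fun _ => ∫ p, dom p ∂quadrantMeasure)
    (fun n => (hred (n + 1)).1) (integrable_const _) ?_ ?_
  · intro n
    filter_upwards [ae_restrict_mem measurableSet_Icc] with θ hθ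
    rw [hΦΨ _ θ hθ]
    exact norm_integral_le_of_norm_le hdomi (hbound n θ hθ)
  · have hIoo : ∀ᵐ θ ∂μ, θ ∈ Ioo α β := by
      rw [hμ, ← restrict_Ioo_eq_restrict_Icc]
      exact ae_restrict_mem measurableSet_Ioo
    filter_upwards [hIoo, ae_restrict_of_ae (h.ae_tendsto_kernel_mean hgl)] with θ hθ hmean
    have hθ' : θ ∈ Icc α β := Ioo_subset_Icc_self hθ
    simp_rw [hΦΨ _ θ hθ']
    have hval : g θ * localInfo (A₂ θ - A₁ θ) (d₁ θ) (d₂ θ) + Real.negMulLog (g θ) =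
        ∫ p : ℝ × ℝ, Real.exp (-(p.1 + p.2)) *
          (g θ * -Real.log (limitMass (A₂ θ - A₁ θ) (d₁ θ) (d₂ θ) p) + Real.negMulLog (g θ))
            ∂quadrantMeasure := by
      obtain ⟨i1, v1⟩ := integral_neg_log_limitMass (h.gap_pos θ) (hd₁ θ hθ) (hd θ hθ)
      obtain ⟨i0, v0⟩ := integral_exp_neg_quadrant
      have e : ∀ p : ℝ × ℝ, Real.exp (-(p.1 + p.2)) *
          (g θ * -Real.log (limitMass (A₂ θ - A₁ θ) (d₁ θ) (d₂ θ) p) + Real.negMulLog (g θ)) =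
          g θ * (Real.exp (-(p.1 + p.2)) * -Real.log (limitMass (A₂ θ - A₁ θ) (d₁ θ) (d₂ θ) p)) +
            Real.exp (-(p.1 + p.2)) * Real.negMulLog (g θ) := fun p => by ring
      simp_rw [e]
      rw [integral_add (i1.const_mul _) (i0.mul_const _), integral_const_mul, integral_mul_const,
        v1, v0, one_mul, localInfo]
    rw [hval]
    refine tendsto_integral_of_dominated_convergence dom ?_ hdomi (fun n => hbound n θ hθ') ?_
    · intro n
      have m1 := h.measurable_integral_kernel_mul (n + 1) θ hg
      have m2 := h.measurable_integral_kernel_mul (n + 1) θ isBoundedWeight_one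
      simp only [mul_one] at m2
      exact ((measurable_gapDensity _).mul ((((Real.measurable_log.comp (m2.const_mul _)).neg).const_mul
        _).add (Real.continuous_negMulLog.measurable.comp (m1.div m2)))).aestronglyMeasurable
    · filter_upwards [ae_quadrantMeasure] with p hp
      have l1 := h.tendsto_integral_kernel hθ (hA₁ θ hθ) (hA₂ θ hθ) (hd₁ θ hθ) (hd θ hθ) hp.1 hp.2
      have l0 := limitMass_pos (h.gap_pos θ) (hd₁ θ hθ) (hd θ hθ) hp.1 hp.2
      have l2 := hmean (d₁ θ) (d₂ θ) hθ (hA₁ θ hθ) (hA₂ θ hθ) (hd₁ θ hθ) (hd θ hθ) p hp.1 hp.2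
      have l3 := (tendsto_gapDensity p).mul ((((l1.log l0.ne').neg).const_mul (g θ)).add
        ((Real.continuous_negMulLog.tendsto _).comp l2))
      exact (tendsto_add_atTop_iff_nat 1).2 l3

end EndpointPair

/-! ### The uniform model on a compact subset of the parameter space -/

/-- Continuously differentiable increasing endpoints of an interval of increasing length. -/
structure SmoothEndpoints (θ₀ : ℝ) (a₁ a₂ : ℝ → ℝ) : Prop where
  contDiffOn₁ : ContDiffOn ℝ 1 a₁ (Ioi θ₀)
  contDiffOn₂ : ContDiffOn ℝ 1 a₂ (Ioi θ₀)
  lt : ∀ θ ∈ Ioi θ₀, a₁ θ < a₂ θ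
  deriv_pos : ∀ θ ∈ Ioi θ₀, 0 < deriv a₁ θ
  deriv_lt : ∀ θ ∈ Ioi θ₀, deriv a₁ θ < deriv a₂ θ

namespace SmoothEndpoints

variable {θ₀ : ℝ} {a₁ a₂ : ℝ → ℝ}

lemma hasDerivAt₁ (h : SmoothEndpoints θ₀ a₁ a₂) {θ : ℝ} (hθ : θ ∈ Ioi θ₀) :
    HasDerivAt a₁ (deriv a₁ θ) θ :=
  ((h.contDiffOn₁.contDiffAt (Ioi_mem_nhds hθ)).differentiableAt one_ne_zero).hasDerivAt

lemma hasDerivAt₂ (h : SmoothEndpoints θ₀ a₁ a₂) {θ : ℝ} (hθ : θ ∈ Ioi θ₀) :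
    HasDerivAt a₂ (deriv a₂ θ) θ :=
  ((h.contDiffOn₂.contDiffAt (Ioi_mem_nhds hθ)).differentiableAt one_ne_zero).hasDerivAt

lemma continuousOn_deriv₁ (h : SmoothEndpoints θ₀ a₁ a₂) : ContinuousOn (deriv a₁) (Ioi θ₀) :=
  h.contDiffOn₁.continuousOn_deriv_of_isOpen isOpen_Ioi le_rfl

lemma continuousOn_deriv₂ (h : SmoothEndpoints θ₀ a₁ a₂) : ContinuousOn (deriv a₂) (Ioi θ₀) :=
  h.contDiffOn₂.continuousOn_deriv_of_isOpen isOpen_Ioi le_rfl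

/-- Freezing the endpoints outside `[α, β]` makes them continuous on the whole line. The constants
are extrema over the compact interval of the derivatives and of the length, combined with the mean
value inequality. -/
lemma exists_endpointPair (h : SmoothEndpoints θ₀ a₁ a₂) {α β : ℝ} (hα : θ₀ < α) (hαβ : α ≤ β) :
    ∃ c C, EndpointPair (fun θ => a₁ (projIcc α β hαβ θ)) (fun θ => a₂ (projIcc α β hαβ θ))
      α β c C := by
  have hsub : Icc α β ⊆ Ioi θ₀ := fun θ hθ => lt_of_lt_of_le hα hθ.1
  have hne : (Icc α β).Nonempty := nonempty_Icc.2 hαβ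
  have hc1 : ContinuousOn a₁ (Icc α β) := h.contDiffOn₁.continuousOn.mono hsub
  have hc2 : ContinuousOn a₂ (Icc α β) := h.contDiffOn₂.continuousOn.mono hsub
  obtain ⟨x, hx, hxmin⟩ := isCompact_Icc.exists_isMinOn hne (h.continuousOn_deriv₁.mono hsub)
  obtain ⟨y, hy, hymin⟩ := isCompact_Icc.exists_isMinOn hne (hc2.sub hc1)
  obtain ⟨u, hu, humax⟩ := isCompact_Icc.exists_isMaxOn hne (h.continuousOn_deriv₂.mono hsub)
  obtain ⟨v, hv, hvmax⟩ := isCompact_Icc.exists_isMaxOn hne (hc2.sub hc1)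
  rw [isMinOn_iff] at hxmin hymin
  rw [isMaxOn_iff] at humax hvmax
  simp only [Pi.sub_apply] at hymin hvmax
  set c := min (deriv a₁ x) (a₂ y - a₁ y) with hc
  set C := max (deriv a₂ u) (a₂ v - a₁ v) with hC
  have hint : ∀ θ ∈ interior (Icc α β), θ ∈ Icc α β := fun θ hθ => interior_subset hθ
  have hd1 : DifferentiableOn ℝ a₁ (interior (Icc α β)) := fun θ hθ =>
    (h.hasDerivAt₁ (hsub (hint θ hθ))).differentiableAt.differentiableWithinAt
  have hd2 : DifferentiableOn ℝ a₂ (interior (Icc α β)) := fun θ hθ =>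
    (h.hasDerivAt₂ (hsub (hint θ hθ))).differentiableAt.differentiableWithinAt
  have proj : ∀ θ ∈ Icc α β, (projIcc α β hαβ θ : ℝ) = θ := fun θ hθ => by
    rw [projIcc_of_mem hαβ hθ]
  have cle : ∀ θ ∈ Icc α β, c ≤ deriv a₁ θ := fun θ hθ => (min_le_left _ _).trans (hxmin θ hθ)
  have leC : ∀ θ ∈ Icc α β, deriv a₂ θ ≤ C := fun θ hθ => (humax θ hθ).trans (le_max_left _ _)
  have hcv : Convex ℝ (Icc α β) := convex_Icc α β
  refine ⟨c, C, ⟨?_, ?_, ?_, ?_, ?_, ?_, ?_, ?_, ?_, ?_⟩⟩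
  · exact (continuousOn_iff_continuous_domRestrict.1 hc1).comp continuous_projIcc
  · exact (continuousOn_iff_continuous_domRestrict.1 hc2).comp continuous_projIcc
  · exact lt_min (h.deriv_pos x (hsub hx)) (sub_pos.2 (h.lt y (hsub hy)))
  · intro θ hθ τ hτ hle
    simp only [proj θ hθ, proj τ hτ]
    exact hcv.mul_sub_le_image_sub_of_le_deriv hc1 hd1 (fun z hz => cle z (hint z hz)) θ hθ τ hτ hle
  · intro θ hθ τ hτ hle
    simp only [proj θ hθ, proj τ hτ]
    exact hcv.mul_sub_le_image_sub_of_le_deriv hc2 hd2 (fun z hz =>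
      (cle z (hint z hz)).trans (h.deriv_lt z (hsub (hint z hz))).le) θ hθ τ hτ hle
  · intro θ hθ τ hτ hle
    simp only [proj θ hθ, proj τ hτ]
    exact hcv.image_sub_le_mul_sub_of_deriv_le hc1 hd1 (fun z hz =>
      (h.deriv_lt z (hsub (hint z hz))).le.trans (leC z (hint z hz))) θ hθ τ hτ hle
  · intro θ hθ τ hτ hle
    simp only [proj θ hθ, proj τ hτ]
    exact hcv.image_sub_le_mul_sub_of_deriv_le hc2 hd2 (fun z hz => leC z (hint z hz)) θ hθ τ hτ hle
  · intro θ hθ τ hτ hle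
    simp only [proj θ hθ, proj τ hτ]
    have := hcv.mul_sub_le_image_sub_of_le_deriv (hc2.sub hc1) (hd2.sub hd1) (C := 0)
      (fun z hz => by
        have hz' := hsub (hint z hz)
        rw [((h.hasDerivAt₂ hz').sub (h.hasDerivAt₁ hz')).deriv]
        exact (sub_pos.2 (h.deriv_lt z hz')).le) θ hθ τ hτ hle
    simp only [Pi.sub_apply] at this
    linarith
  · intro θ
    exact (min_le_right _ _).trans (hymin _ (projIcc α β hαβ θ).2)
  · intro θ hθ
    exact (hvmax _ (projIcc α β hαβ θ).2).trans (le_max_right _ _)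

/-- The expected information of a prior supported in `[α, β]`. -/
lemma expectedInfo_eq (h : SmoothEndpoints θ₀ a₁ a₂) {α β : ℝ} (hα : θ₀ < α) (hαβ : α ≤ β) {c C : ℝ}
    (hE : EndpointPair (fun θ => a₁ (projIcc α β hαβ θ)) (fun θ => a₂ (projIcc α β hαβ θ)) α β c C)
    {g : ℝ → ℝ} {G : ℝ} (hg : IsBoundedWeight g G) (hgs : ∀ θ, θ ∉ Icc α β → g θ = 0) (k : ℕ)
    {L : ℝ × (Fin k → ℝ) → ℝ} (hL : L = uniformLikelihood (fun θ => a₁ (projIcc α β hαβ θ))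
      (fun θ => a₂ (projIcc α β hαβ θ)) k) :
    ((uniformModel θ₀ a₁ a₂ h.lt).replicate k).ExpectedInfoFinite g ∧
    ((uniformModel θ₀ a₁ a₂ h.lt).replicate k).expectedInfo g =
      ∫ z, L z * g z.1 * Real.log (L z / mixture (volume.restrict (Icc α β)) L g z.2)
        ∂((volume.restrict (Icc α β)).prod (boxMeasure (a₁ α) (a₂ β) k)) := by
  set M := (uniformModel θ₀ a₁ a₂ h.lt).replicate k with hM
  have hsub : Icc α β ⊆ Ioi θ₀ := fun θ hθ => lt_of_lt_of_le hα hθ.1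
  have hLd : ∀ θ ∈ Icc α β, ∀ x, M.density x θ = L (θ, x) := by
    intro θ hθ x
    rw [hL]
    simp only [hM, ParametricModel.replicate, uniformModel, uniformLikelihood,
      projIcc_of_mem hαβ hθ]
  have hmarg : ∀ x, M.marginal g x = mixture (volume.restrict (Icc α β)) L g x := by
    intro x
    have hp : M.param = Ioi θ₀ := rfl
    rw [ParametricModel.marginal, mixture, hp]
    rw [setIntegral_eq_of_subset_of_forall_sdiff_eq_zero measurableSet_Ioi hsub fun θ hθ => by
      rw [hgs θ hθ.2, mul_zero]]
    exact setIntegral_congr_fun measurableSet_Icc fun θ hθ => by simp only [hLd θ hθ x]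
  set F : ℝ × (Fin k → ℝ) → ℝ := fun z => L z * g z.1 *
    Real.log (L z / mixture (volume.restrict (Icc α β)) L g z.2) with hF
  set E : ℝ × (Fin k → ℝ) → ℝ := fun z => M.density z.2 z.1 * g z.1 *
    Real.log (M.posterior g z.2 z.1 / g z.1) with hEdef
  set S : Set (ℝ × (Fin k → ℝ)) := Icc α β ×ˢ univ.pi fun _ => Ioo (a₁ α) (a₂ β) with hS
  have hSm : MeasurableSet S :=
    measurableSet_Icc.prod (MeasurableSet.univ_pi fun _ => measurableSet_Ioo)
  have hEF : ∀ z, z.1 ∈ Icc α β → E z = F z := by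
    intro z hz
    simp only [hEdef, hF, ParametricModel.posterior, hmarg, hLd z.1 hz]
    by_cases hgz : g z.1 = 0
    · simp [hgz]
    · congr 2
      field_simp
  -- Monotone endpoints confine every sample with positive likelihood to `(a₁ α, a₂ β)ᵏ`, so the
  -- sample space may be cut to a set of finite measure.
  have hE0 : ∀ z, z ∉ S → E z = 0 := by
    intro z hz
    by_cases hz1 : z.1 ∈ Icc α β
    · have hx : z.2 ∉ univ.pi fun _ => Ioo (a₁ α) (a₂ β) := fun hx => hz ⟨hz1, hx⟩
      have := hE.uniformLikelihood_eq_zero k hz1 (x := z.2) (by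
        simpa only [projIcc_left, projIcc_right] using hx)
      rw [hEF z hz1]
      simp only [hF]
      rw [show L z = 0 by rw [hL]; exact this]
      simp
    · simp [hEdef, hgs z.1 hz1]
  have hmeas : (volume.restrict (Icc α β)).prod (boxMeasure (a₁ α) (a₂ β) k) =
      ((volume.restrict M.param).prod M.base).restrict S := by
    have h1 : M.param = Ioi θ₀ := rfl
    have h2 : M.base = Measure.pi fun _ => volume := rfl
    rw [h1, h2, hS, ← Measure.prod_restrict, Measure.restrict_restrict measurableSet_Icc,
      inter_eq_left.2 hsub]
  have hEFS : EqOn F E S := fun z hz => (hEF z hz.1).symm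
  have hint : Integrable F ((volume.restrict (Icc α β)).prod (boxMeasure (a₁ α) (a₂ β) k)) := by
    have := hE.isBoundedWeight_uniformLikelihood k
    rw [← hL] at this
    exact (integrable_mul_log_div_mixture this hg).1
  rw [hmeas] at hint ⊢
  constructor
  · have : IntegrableOn E S ((volume.restrict M.param).prod M.base) :=
      IntegrableOn.congr_fun hint hEFS hSm
    exact (integrableOn_iff_integrable_of_support_subset
      (fun z hz => by_contra fun hn => hz (hE0 z hn))).1 this
  · rw [setIntegral_congr_fun hSm hEFS, setIntegral_eq_integral_of_forall_compl_eq_zero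
      fun z hz => hE0 z hz]
    rfl

end SmoothEndpoints

lemma isBoundedWeight_restrictPrior {q : ℝ → ℝ} {K : Set ℝ} (hK : IsCompact K)
    (hq : ContinuousOn q K) (hq0 : ∀ θ ∈ K, 0 < q θ) :
    ∃ G, IsBoundedWeight (restrictPrior q K) G := by
  have hI : 0 ≤ ∫ τ in K, q τ := setIntegral_nonneg hK.measurableSet fun θ hθ => (hq0 θ hθ).le
  obtain ⟨B, hB⟩ := hK.exists_bound_of_continuousOn (hq.div_const (∫ τ in K, q τ))
  refine ⟨max B 0, ?_, ?_, ?_⟩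
  · classical
    rw [restrictPrior, ← piecewise_eq_indicator]
    exact ContinuousOn.measurable_piecewise (hq.div_const _) continuousOn_const hK.measurableSet
  · exact indicator_nonneg fun θ hθ => div_nonneg (hq0 θ hθ).le hI
  · exact fun θ => indicator_le' (fun θ hθ => (le_abs_self _).trans ((hB θ hθ).trans
      (le_max_left _ _))) (fun _ _ => le_max_right _ _) θ

lemma integral_pos_of_continuousOn {q : ℝ → ℝ} {K : Set ℝ} (hK : IsCompact K)
    (hvol : 0 < volume K) (hq : ContinuousOn q K) (hq0 : ∀ θ ∈ K, 0 < q θ) :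
    0 < ∫ τ in K, q τ := by
  rw [setIntegral_pos_iff_support_of_nonneg_ae]
  · refine hvol.trans_le (measure_mono fun θ hθ => ⟨(hq0 θ hθ).ne', hθ⟩)
  · filter_upwards [ae_restrict_mem hK.measurableSet] with θ hθ
    exact (hq0 θ hθ).le
  · exact hq.integrableOn_compact hK

namespace SmoothEndpoints

variable {θ₀ : ℝ} {a₁ a₂ : ℝ → ℝ}

theorem tendsto_expectedInfo_restrictPrior (h : SmoothEndpoints θ₀ a₁ a₂) {K : Set ℝ}
    (hK : IsCompact K) (hKs : K ⊆ Ioi θ₀) (hvol : 0 < volume K) {q : ℝ → ℝ}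
    (hq : ContinuousOn q (Ioi θ₀)) (hq0 : ∀ θ ∈ Ioi θ₀, 0 < q θ) :
    (∀ k, ((uniformModel θ₀ a₁ a₂ h.lt).replicate k).ExpectedInfoFinite (restrictPrior q K)) ∧
    Tendsto (fun k : ℕ => ((uniformModel θ₀ a₁ a₂ h.lt).replicate k).expectedInfo
      (restrictPrior q K) - Real.log k) atTop
      (𝓝 (∫ θ in K, (restrictPrior q K θ *
        EndpointPair.localInfo (a₂ θ - a₁ θ) (deriv a₁ θ) (deriv a₂ θ) +
          Real.negMulLog (restrictPrior q K θ)))) := by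
  have hne : K.Nonempty := by
    by_contra hn
    rw [not_nonempty_iff_eq_empty.1 hn, measure_empty] at hvol
    exact lt_irrefl _ hvol
  obtain ⟨m, hm, hmle⟩ := hK.exists_isLeast hne
  obtain ⟨m', hm', hlem'⟩ := hK.exists_isGreatest hne
  have hmθ : θ₀ < m := hKs hm
  -- Any point of the parameter space not exceeding `min K` would do here; the right end needs the
  -- extra unit `δ = 1` beyond `max K` for the lower bound on the kernel mass.
  set α := (θ₀ + m) / 2 with hα
  set β := m' + 1 with hβ
  have hα0 : θ₀ < α := by rw [hα]; linarith
  have hαβ : α ≤ β := by have := hmle hm'; rw [hα, hβ]; linarith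
  have hKI : K ⊆ Icc α β := fun θ hθ => by
    have h1 := hmle hθ
    have h2 := hlem' hθ
    exact ⟨by rw [hα]; linarith, by rw [hβ]; linarith⟩
  have hsub : Icc α β ⊆ Ioi θ₀ := fun θ hθ => lt_of_lt_of_le hα0 hθ.1
  obtain ⟨c, C, hE⟩ := h.exists_endpointPair hα0 hαβ
  obtain ⟨G, hg⟩ := isBoundedWeight_restrictPrior hK (hq.mono hKs) fun θ hθ => hq0 θ (hKs hθ)
  set g := restrictPrior q K with hgdef
  have hg0 : ∀ θ, θ ∉ K → g θ = 0 := fun θ hθ => indicator_of_notMem hθ _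
  have hg1 : ∫ θ in Icc α β, g θ = 1 := by
    have hpos := integral_pos_of_continuousOn hK hvol (hq.mono hKs) fun θ hθ => hq0 θ (hKs hθ)
    rw [setIntegral_eq_of_subset_of_forall_sdiff_eq_zero measurableSet_Icc hKI fun θ hθ => hg0 θ hθ.2]
    rw [hgdef]
    unfold restrictPrior
    rw [setIntegral_indicator hK.measurableSet, inter_self, integral_div, div_self hpos.ne']
  have hinfo := fun k => h.expectedInfo_eq hα0 hαβ hE hg (fun θ hθ => hg0 θ fun hk => hθ (hKI hk)) k rfl
  refine ⟨fun k => (hinfo k).1, ?_⟩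
  have proj : ∀ θ ∈ Icc α β, (projIcc α β hαβ θ : ℝ) = θ := fun θ hθ => by
    rw [projIcc_of_mem hαβ hθ]
  have heq : ∀ θ ∈ Ioo α β, ∀ f : ℝ → ℝ, (fun θ => f (projIcc α β hαβ θ)) =ᶠ[𝓝 θ] f := by
    intro θ hθ f
    filter_upwards [Ioo_mem_nhds hθ.1 hθ.2] with τ hτ
    rw [proj τ (Ioo_subset_Icc_self hτ)]
  have key := hE.tendsto_expectedInfo hg one_pos hαβ
    (fun θ hθ => by
      have : θ ∈ K := by_contra fun hn => hθ (hg0 θ hn)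
      have := hlem' this
      rw [hβ]; linarith) hg1
    (d₁ := deriv a₁) (d₂ := deriv a₂)
    (fun θ hθ => (h.hasDerivAt₁ (hsub (Ioo_subset_Icc_self hθ))).congr_of_eventuallyEq (heq θ hθ a₁))
    (fun θ hθ => (h.hasDerivAt₂ (hsub (Ioo_subset_Icc_self hθ))).congr_of_eventuallyEq (heq θ hθ a₂))
    (fun θ hθ => h.deriv_pos θ (hsub (Ioo_subset_Icc_self hθ)))
    (fun θ hθ => h.deriv_lt θ (hsub (Ioo_subset_Icc_self hθ)))
  -- The analysis through the joint density of minimum and maximum concerns samples of size `n + 2`.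
  rw [← tendsto_add_atTop_iff_nat 2]
  have hval : ∫ θ in K, (g θ * EndpointPair.localInfo (a₂ θ - a₁ θ) (deriv a₁ θ) (deriv a₂ θ) +
          Real.negMulLog (g θ)) = ∫ θ in Icc α β, (g θ * EndpointPair.localInfo
            (a₂ (projIcc α β hαβ θ) - a₁ (projIcc α β hαβ θ)) (deriv a₁ θ) (deriv a₂ θ) +
              Real.negMulLog (g θ)) := by
    rw [setIntegral_eq_of_subset_of_forall_sdiff_eq_zero measurableSet_Icc hKI fun θ hθ => by
      simp [hg0 θ hθ.2]]
    exact setIntegral_congr_fun hK.measurableSet fun θ hθ => by simp only [proj θ (hKI hθ)]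
  rw [hval]
  refine key.congr fun n => ?_
  rw [(hinfo (n + 2)).2]
  simp only [projIcc_left, projIcc_right]
  push_cast
  rfl

end SmoothEndpoints

/-! ### The reference prior -/

/-- The reference prior function of the uniform model on `(a₁ θ, a₂ θ)`, in simplified form. -/
def uniformReference (a₁ a₂ : ℝ → ℝ) (θ : ℝ) : ℝ :=
  (deriv a₂ θ - deriv a₁ θ) / (a₂ θ - a₁ θ) *
    Real.exp (realDigamma (deriv a₁ θ / (deriv a₂ θ - deriv a₁ θ) + 1) - 1)

/-- With `b₁ = 1 / z` and `b₂ = 1 / (z + 1)`, the bracket divided by `b₁ - b₂` is `(z + 1) ψ(z) - z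
ψ(z + 1) = ψ(z) - 1`, and adding `1 / z` shifts the argument to `z + 1`. -/
lemma digamma_exponent_eq {d₁ d₂ b₁ b₂ : ℝ} (hd₁ : 0 < d₁) (hd : d₁ < d₂)
    (hb₁ : b₁ = (d₂ - d₁) / d₁) (hb₂ : b₂ = (d₂ - d₁) / d₂) :
    b₁ + 1 / (b₁ - b₂) * (b₁ * realDigamma (1 / b₁) - b₂ * realDigamma (1 / b₂)) =
      realDigamma (d₁ / (d₂ - d₁) + 1) - 1 := by
  have hd₂ : 0 < d₂ := hd₁.trans hd
  have hdd : 0 < d₂ - d₁ := by linarith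
  have hz : 0 < d₁ / (d₂ - d₁) := div_pos hd₁ hdd
  set z := d₁ / (d₂ - d₁) with hzdef
  have e1 : b₁ = 1 / z := by rw [hb₁, hzdef]; field_simp
  have e2 : b₂ = 1 / (z + 1) := by
    have : z + 1 = d₂ / (d₂ - d₁) := by rw [hzdef]; field_simp; ring
    rw [hb₂, this]; field_simp
  have hz1 : 0 < z + 1 := by linarith
  rw [e1, e2, one_div_one_div, one_div_one_div, realDigamma_add_one hz]
  have e3 : 1 / z - 1 / (z + 1) = 1 / (z * (z + 1)) := by field_simp; ring
  rw [e3]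
  field_simp
  ring

namespace SmoothEndpoints

variable {θ₀ : ℝ} {a₁ a₂ : ℝ → ℝ}

lemma uniformReference_pos (h : SmoothEndpoints θ₀ a₁ a₂) {θ : ℝ} (hθ : θ ∈ Ioi θ₀) :
    0 < uniformReference a₁ a₂ θ :=
  mul_pos (div_pos (sub_pos.2 (h.deriv_lt θ hθ)) (sub_pos.2 (h.lt θ hθ))) (Real.exp_pos _)

lemma continuousOn_uniformReference (h : SmoothEndpoints θ₀ a₁ a₂) :
    ContinuousOn (uniformReference a₁ a₂) (Ioi θ₀) := by
  have c1 := h.continuousOn_deriv₁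
  have c2 := h.continuousOn_deriv₂
  have cz : ContinuousOn (fun θ => deriv a₁ θ / (deriv a₂ θ - deriv a₁ θ) + 1) (Ioi θ₀) :=
    (c1.div (c2.sub c1) fun θ hθ => (sub_pos.2 (h.deriv_lt θ hθ)).ne').add continuousOn_const
  have cψ := continuousOn_realDigamma.comp cz fun θ hθ => by
    have := div_pos (h.deriv_pos θ hθ) (sub_pos.2 (h.deriv_lt θ hθ))
    exact mem_Ioi.2 (by linarith)
  exact ((c2.sub c1).div (h.contDiffOn₂.continuousOn.sub h.contDiffOn₁.continuousOn)
    fun θ hθ => (sub_pos.2 (h.lt θ hθ)).ne').mul (cψ.sub continuousOn_const).rexp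

/-- From `ψ ≤ log` the exponential factor is at most `z + 1 = a₂' / (a₂' - a₁')`. This bound is the
only feature of the prior, besides continuity and positivity, that permissibility uses. -/
lemma uniformReference_le (h : SmoothEndpoints θ₀ a₁ a₂) {θ : ℝ} (hθ : θ ∈ Ioi θ₀) :
    uniformReference a₁ a₂ θ ≤ deriv a₂ θ / (a₂ θ - a₁ θ) := by
  have hd := sub_pos.2 (h.deriv_lt θ hθ)
  have hD := sub_pos.2 (h.lt θ hθ)
  have hd1 := h.deriv_pos θ hθ
  have hz : 0 < deriv a₁ θ / (deriv a₂ θ - deriv a₁ θ) + 1 := by positivity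
  have e : Real.exp (realDigamma (deriv a₁ θ / (deriv a₂ θ - deriv a₁ θ) + 1) - 1) ≤
      deriv a₁ θ / (deriv a₂ θ - deriv a₁ θ) + 1 := by
    have := realDigamma_le_log hz
    calc _ ≤ Real.exp (Real.log (deriv a₁ θ / (deriv a₂ θ - deriv a₁ θ) + 1)) :=
          Real.exp_le_exp.2 (by linarith)
      _ = _ := Real.exp_log hz
  calc uniformReference a₁ a₂ θ ≤ (deriv a₂ θ - deriv a₁ θ) / (a₂ θ - a₁ θ) *
        (deriv a₁ θ / (deriv a₂ θ - deriv a₁ θ) + 1) :=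
        mul_le_mul_of_nonneg_left e (div_pos hd hD).le
    _ = _ := by field_simp; ring

/-- The term `-1 / (z + 1)` turns `ψ(z + 2)` into `ψ(z + 1)`; everything else is a constant
independent of `θ`. -/
lemma localInfo_eq (h : SmoothEndpoints θ₀ a₁ a₂) {θ : ℝ} (hθ : θ ∈ Ioi θ₀) :
    EndpointPair.localInfo (a₂ θ - a₁ θ) (deriv a₁ θ) (deriv a₂ θ) =
      Real.log (uniformReference a₁ a₂ θ) + (1 + expectedLogGap 1 - realDigamma (1 + 2)) := by
  have hd := sub_pos.2 (h.deriv_lt θ hθ)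
  have hD := sub_pos.2 (h.lt θ hθ)
  have hz := div_pos (h.deriv_pos θ hθ) hd
  have e1 := expectedLogGap_sub_realDigamma hz
  have e2 := realDigamma_add_one (x := deriv a₁ θ / (deriv a₂ θ - deriv a₁ θ) + 1) (by linarith)
  rw [show deriv a₁ θ / (deriv a₂ θ - deriv a₁ θ) + 1 + 1 =
    deriv a₁ θ / (deriv a₂ θ - deriv a₁ θ) + 2 by ring] at e2
  rw [EndpointPair.localInfo, uniformReference, Real.log_mul (div_pos hd hD).ne' (Real.exp_pos _).ne',
    Real.log_exp]
  linarith

open InformationTheory in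
/-- The missing information of two priors differs by their relative entropy. -/
theorem tendsto_expectedInfo_sub (h : SmoothEndpoints θ₀ a₁ a₂) {K : Set ℝ}
    (hK : IsCompact K) (hKs : K ⊆ Ioi θ₀) (hvol : 0 < volume K) {π p : ℝ → ℝ}
    (hπ : ∀ θ ∈ Ioi θ₀, π θ = uniformReference a₁ a₂ θ)
    (hp : ContinuousOn p (Ioi θ₀)) (hp0 : ∀ θ ∈ Ioi θ₀, 0 < p θ) :
    Tendsto (fun k : ℕ =>
      ((uniformModel θ₀ a₁ a₂ h.lt).replicate k).expectedInfo (restrictPrior π K) -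
      ((uniformModel θ₀ a₁ a₂ h.lt).replicate k).expectedInfo (restrictPrior p K)) atTop
      (𝓝 (∫ θ in K, π θ / (∫ τ in K, π τ) *
        klFun ((p θ / ∫ τ in K, p τ) / (π θ / ∫ τ in K, π τ)))) := by
  have hπc : ContinuousOn π (Ioi θ₀) := h.continuousOn_uniformReference.congr hπ
  have hπ0 : ∀ θ ∈ Ioi θ₀, 0 < π θ := fun θ hθ => by rw [hπ θ hθ]; exact h.uniformReference_pos hθ
  obtain ⟨-, t1⟩ := h.tendsto_expectedInfo_restrictPrior hK hKs hvol hπc hπ0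
  obtain ⟨-, t2⟩ := h.tendsto_expectedInfo_restrictPrior hK hKs hvol hp hp0
  have ci := integral_pos_of_continuousOn hK hvol (hπc.mono hKs) fun θ hθ => hπ0 θ (hKs hθ)
  have di := integral_pos_of_continuousOn hK hvol (hp.mono hKs) fun θ hθ => hp0 θ (hKs hθ)
  set c := ∫ τ in K, π τ with hc
  set d := ∫ τ in K, p τ with hd
  set κ := 1 + expectedLogGap 1 - realDigamma (1 + 2) with hκ
  have t := t1.sub t2
  simp only [sub_sub_sub_cancel_right] at t
  convert t using 2
  have hP : ContinuousOn (fun θ => π θ / c) K := (hπc.mono hKs).div_const c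
  have hQ : ContinuousOn (fun θ => p θ / d) K := (hp.mono hKs).div_const d
  have hlog : ContinuousOn (fun θ => Real.log (π θ) + κ) K :=
    ((hπc.mono hKs).log fun θ hθ => (hπ0 θ (hKs hθ)).ne').add continuousOn_const
  have hη := Real.continuous_negMulLog
  have hP1 : ∫ θ in K, π θ / c = 1 := by rw [integral_div, ← hc, div_self ci.ne']
  have hQ1 : ∫ θ in K, p θ / d = 1 := by rw [integral_div, ← hd, div_self di.ne']
  have r : ∀ (q : ℝ → ℝ) (e : ℝ), e = ∫ τ in K, q τ → ∫ θ in K, (restrictPrior q K θ *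
        EndpointPair.localInfo (a₂ θ - a₁ θ) (deriv a₁ θ) (deriv a₂ θ) +
          Real.negMulLog (restrictPrior q K θ)) = ∫ θ in K, (q θ / e * (Real.log (π θ) + κ) +
            Real.negMulLog (q θ / e)) := by
    intro q e he
    refine setIntegral_congr_fun hK.measurableSet fun θ hθ => ?_
    simp only [restrictPrior, indicator_of_mem hθ, h.localInfo_eq (hKs hθ), ← hπ θ (hKs hθ), he]
    rfl
  rw [r π c hc, r p d hd]
  have i1 : IntegrableOn (fun θ => π θ / c * (Real.log (π θ) + κ) + Real.negMulLog (π θ / c)) K :=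
    ((hP.mul hlog).add (hη.comp_continuousOn hP)).integrableOn_compact hK
  have i2 : IntegrableOn (fun θ => p θ / d * (Real.log (π θ) + κ) + Real.negMulLog (p θ / d)) K :=
    ((hQ.mul hlog).add (hη.comp_continuousOn hQ)).integrableOn_compact hK
  have iP := hP.integrableOn_compact hK (μ := volume)
  have iQ := hQ.integrableOn_compact hK (μ := volume)
  have hkl : ContinuousOn (fun θ => π θ / c * klFun ((p θ / d) / (π θ / c))) K :=
    hP.mul (continuous_klFun.comp_continuousOn (hQ.div hP fun θ hθ =>
      (div_pos (hπ0 θ (hKs hθ)) ci).ne'))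
  have ikl := hkl.integrableOn_compact hK (μ := volume)
  rw [← integral_sub i1 i2]
  -- The added multiple of a difference of two probability densities integrates to zero. It makes
  -- the identity hold pointwise.
  have e : ∫ θ in K, (π θ / c * klFun ((p θ / d) / (π θ / c)) +
      (Real.log c + κ - 1) * (π θ / c - p θ / d)) =
        ∫ θ in K, π θ / c * klFun ((p θ / d) / (π θ / c)) := by
    rw [integral_add ikl ((Integrable.sub' iP iQ).const_mul _), integral_const_mul, integral_sub iP iQ, hP1, hQ1]
    ring
  rw [← e]
  refine setIntegral_congr_fun hK.measurableSet fun θ hθ => ?_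
  have a0 := hπ0 θ (hKs hθ)
  have b0 := hp0 θ (hKs hθ)
  simp only [klFun, Real.negMulLog]
  rw [Real.log_div (div_pos b0 di).ne' (div_pos a0 ci).ne', Real.log_div a0.ne' ci.ne']
  field_simp
  ring

open InformationTheory in
theorem hasMMI (h : SmoothEndpoints θ₀ a₁ a₂) {π : ℝ → ℝ}
    (hπ : ∀ θ ∈ Ioi θ₀, π θ = uniformReference a₁ a₂ θ) :
    (uniformModel θ₀ a₁ a₂ h.lt).HasMMI (uniformModel θ₀ a₁ a₂ h.lt).standardPriors π := by
  intro K hK hKs hvol p hp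
  have hπc : ContinuousOn π (Ioi θ₀) := h.continuousOn_uniformReference.congr hπ
  have hπ0 : ∀ θ ∈ Ioi θ₀, 0 < π θ := fun θ hθ => by rw [hπ θ hθ]; exact h.uniformReference_pos hθ
  refine ⟨(h.tendsto_expectedInfo_restrictPrior hK hKs hvol hπc hπ0).1,
    (h.tendsto_expectedInfo_restrictPrior hK hKs hvol hp.1 hp.2.1).1, _, ?_,
    h.tendsto_expectedInfo_sub hK hKs hvol hπ hp.1 hp.2.1⟩
  refine setIntegral_nonneg hK.measurableSet fun θ hθ => ?_
  have c0 : 0 ≤ ∫ τ in K, π τ := setIntegral_nonneg hK.measurableSet fun τ hτ => (hπ0 τ (hKs hτ)).le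
  have d0 : 0 ≤ ∫ τ in K, p τ := setIntegral_nonneg hK.measurableSet fun τ hτ => (hp.2.1 τ (hKs hτ)).le
  have a0 := (hπ0 θ (hKs hθ)).le
  have b0 := (hp.2.1 θ (hKs hθ)).le
  exact mul_nonneg (div_nonneg a0 c0) (klFun_nonneg (by positivity))

-- The rival is tested against `π` itself. Its limit must be nonnegative, yet equals minus a
-- relative entropy, so the relative entropy vanishes. Strictness of `klFun` gives equality of the
-- normalized densities almost everywhere, and continuity gives it everywhere.
open InformationTheory in
theorem eq_const_mul_of_hasMMI (h : SmoothEndpoints θ₀ a₁ a₂) {π π' : ℝ → ℝ}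
    (hπ : ∀ θ ∈ Ioi θ₀, π θ = uniformReference a₁ a₂ θ)
    (hπs : π ∈ (uniformModel θ₀ a₁ a₂ h.lt).standardPriors)
    (hc : ContinuousOn π' (Ioi θ₀)) (hpos : ∀ θ ∈ Ioi θ₀, 0 < π' θ)
    (hmmi : (uniformModel θ₀ a₁ a₂ h.lt).HasMMI (uniformModel θ₀ a₁ a₂ h.lt).standardPriors π') :
    ∃ c : ℝ, 0 < c ∧ ∀ θ ∈ Ioi θ₀, π' θ = c * π θ := by
  have hπc : ContinuousOn π (Ioi θ₀) := hπs.1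
  have hπ0 : ∀ θ ∈ Ioi θ₀, 0 < π θ := hπs.2.1
  have prop : ∀ a b, θ₀ < a → a < b → ∃ k, ∀ θ ∈ Icc a b, π' θ = k * π θ := by
    intro a b ha hab
    have hKs : Icc a b ⊆ Ioi θ₀ := fun θ hθ => lt_of_lt_of_le ha hθ.1
    have hvol : 0 < volume (Icc a b) := by simpa using hab
    have hK : IsCompact (Icc a b) := isCompact_Icc
    obtain ⟨-, -, L, hL0, hL⟩ := hmmi (Icc a b) hK hKs hvol π hπs
    have t := (h.tendsto_expectedInfo_sub hK hKs hvol hπ hc hpos).neg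
    simp only [neg_sub] at t
    have hlim := tendsto_nhds_unique hL t
    have ci := integral_pos_of_continuousOn hK hvol (hπc.mono hKs) fun θ hθ => hπ0 θ (hKs hθ)
    have di := integral_pos_of_continuousOn hK hvol (hc.mono hKs) fun θ hθ => hpos θ (hKs hθ)
    set c := ∫ τ in Icc a b, π τ with hcdef
    set d := ∫ τ in Icc a b, π' τ with hddef
    have hP : ContinuousOn (fun θ => π θ / c) (Icc a b) := (hπc.mono hKs).div_const c
    have hQ : ContinuousOn (fun θ => π' θ / d) (Icc a b) := (hc.mono hKs).div_const d
    have hkl : ContinuousOn (fun θ => π θ / c * klFun ((π' θ / d) / (π θ / c))) (Icc a b) :=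
      hP.mul (continuous_klFun.comp_continuousOn (hQ.div hP fun θ hθ =>
        (div_pos (hπ0 θ (hKs hθ)) ci).ne'))
    have hnn : ∀ θ ∈ Icc a b, 0 ≤ π θ / c * klFun ((π' θ / d) / (π θ / c)) := fun θ hθ => by
      have a0 := hπ0 θ (hKs hθ)
      have b0 := hpos θ (hKs hθ)
      exact mul_nonneg (by positivity) (klFun_nonneg (by positivity))
    have hzero : ∫ θ in Icc a b, π θ / c * klFun ((π' θ / d) / (π θ / c)) = 0 :=
      le_antisymm (by linarith) (setIntegral_nonneg measurableSet_Icc hnn)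
    rw [setIntegral_eq_zero_iff_of_nonneg_ae ((ae_restrict_iff' measurableSet_Icc).2
      (ae_of_all _ hnn)) (hkl.integrableOn_compact hK)] at hzero
    have hall := Measure.eqOn_Icc_of_ae_eq volume hab.ne hzero hkl continuousOn_const
    refine ⟨d / c, fun θ hθ => ?_⟩
    have a0 := hπ0 θ (hKs hθ)
    have b0 := hpos θ (hKs hθ)
    have h1 : π θ / c * klFun ((π' θ / d) / (π θ / c)) = 0 := hall hθ
    rcases mul_eq_zero.1 h1 with h2 | h2
    · exact absurd h2 (div_pos a0 ci).ne'
    · rw [klFun_eq_zero_iff (by positivity), div_eq_one_iff_eq (div_pos a0 ci).ne'] at h2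
      field_simp at h2 ⊢
      linarith
  -- A fixed base point determines the factor, so the local constants agree.
  have hθ1 : θ₀ + 1 ∈ Ioi θ₀ := mem_Ioi.2 (by linarith)
  refine ⟨π' (θ₀ + 1) / π (θ₀ + 1), div_pos (hpos _ hθ1) (hπ0 _ hθ1), fun θ hθ => ?_⟩
  have hθ' : θ₀ < θ := hθ
  obtain ⟨k, hk⟩ := prop (min θ (θ₀ + 1)) (max θ (θ₀ + 1) + 1) (lt_min hθ' (by linarith))
    (by have := min_le_max (a := θ) (b := θ₀ + 1); linarith)
  rw [hk θ ⟨min_le_left _ _, by linarith [le_max_left θ (θ₀ + 1)]⟩,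
    hk (θ₀ + 1) ⟨min_le_right _ _, by linarith [le_max_right θ (θ₀ + 1)]⟩,
    mul_div_cancel_right₀ _ (hπ0 _ hθ1).ne']

end SmoothEndpoints

/-! ### Permissibility -/

/-- Here `s`, `t`, `u` stand for the marginal masses to the left of, inside and to the right of `[α,
β]`. The simpler bound by `s + u` would not do: the available bound on `s` is `1 / (x - a₁ α)`,
which is not integrable at `a₁ α`, whereas its square root is. It follows from `1 + s / t ≤ (1 + √(s
/ t))²`. -/
lemma mul_log_add_div_le {s t u : ℝ} (hs : 0 ≤ s) (ht : 0 ≤ t) (hu : 0 ≤ u) :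
    t * Real.log ((s + t + u) / t) ≤ 2 * √(t * s) + u := by
  rcases ht.eq_or_lt with rfl | ht
  · simpa using hu
  have h1 : (s + t + u) / t ≤ (1 + √(s / t)) ^ 2 * (1 + u / t) := by
    have e1 : 1 + s / t ≤ (1 + √(s / t)) ^ 2 := by
      have := Real.sq_sqrt (show 0 ≤ s / t by positivity)
      nlinarith [Real.sqrt_nonneg (s / t)]
    have e2 : (s + t + u) / t ≤ (1 + s / t) * (1 + u / t) := by
      have : (1 + s / t) * (1 + u / t) = (s + t + u) / t + s / t * (u / t) := by field_simp; ring
      rw [this]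
      exact le_add_of_nonneg_right (by positivity)
    exact e2.trans (mul_le_mul_of_nonneg_right e1 (by positivity))
  have h2 := Real.log_le_log (by positivity) h1
  rw [Real.log_mul (by positivity) (by positivity), Real.log_pow] at h2
  have h3 := Real.log_le_sub_one_of_pos (show 0 < 1 + √(s / t) by positivity)
  have h4 := Real.log_le_sub_one_of_pos (show 0 < 1 + u / t by positivity)
  have h5 : Real.log ((s + t + u) / t) ≤ 2 * √(s / t) + u / t := by
    push_cast at h2; linarith
  have h6 : t * √(s / t) = √(t * s) := by
    rw [show t * s = t ^ 2 * (s / t) by field_simp, Real.sqrt_mul (by positivity),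
      Real.sqrt_sq ht.le]
  calc _ ≤ t * (2 * √(s / t) + u / t) := mul_le_mul_of_nonneg_left h5 ht.le
    _ = _ := by rw [← h6]; field_simp

lemma mul_log_div_le_sub {t m : ℝ} (ht : 0 ≤ t) (hm : t ≤ m) : t * Real.log (m / t) ≤ m - t := by
  have := mul_log_add_div_le (s := 0) (u := m - t) le_rfl ht (by linarith)
  simpa using this

lemma mul_log_div_nonneg {t m : ℝ} (ht : 0 ≤ t) (hm : t ≤ m) : 0 ≤ t * Real.log (m / t) := by
  rcases ht.eq_or_lt with rfl | ht
  · simp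
  · exact mul_nonneg ht.le (Real.log_nonneg ((one_le_div ht).2 hm))

lemma integral_Ioi_inv_sq {p r : ℝ} (hpr : r < p) :
    IntegrableOn (fun y : ℝ => 1 / (y - r) ^ 2) (Ioi p) ∧
      ∫ y in Ioi p, 1 / (y - r) ^ 2 = 1 / (p - r) := by
  have hd : ∀ y ∈ Ici p, HasDerivAt (fun y : ℝ => -(y - r)⁻¹) (1 / (y - r) ^ 2) y := by
    intro y hy
    have hne : y - r ≠ 0 := (sub_pos.2 (hpr.trans_le hy)).ne'
    have := (((hasDerivAt_id y).sub_const r).inv hne).neg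
    refine HasDerivAt.congr_deriv this ?_
    simp only [id]; ring
  have hl : Tendsto (fun y : ℝ => -(y - r)⁻¹) atTop (𝓝 0) := by
    have := (tendsto_atTop_add_const_right atTop (-r) tendsto_id).inv_tendsto_atTop.neg
    simpa [sub_eq_add_neg] using this
  have hn : ∀ y ∈ Ioi p, (0 : ℝ) ≤ 1 / (y - r) ^ 2 := fun y _ => by positivity
  refine ⟨integrableOn_Ioi_deriv_of_nonneg' hd hn hl, ?_⟩
  rw [integral_Ioi_of_hasDerivAt_of_nonneg' hd hn hl]
  simp

lemma integral_Ioo_rpow_neg_half {p q : ℝ} (hpq : p < q) :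
    IntegrableOn (fun x : ℝ => (x - p) ^ (-(1 / 2) : ℝ)) (Ioo p q) ∧
      ∫ x in Ioo p q, (x - p) ^ (-(1 / 2) : ℝ) = 2 * (q - p) ^ (1 / 2 : ℝ) := by
  have hi : IntervalIntegrable (fun x : ℝ => (x - p) ^ (-(1 / 2) : ℝ)) volume p q := by
    have := (intervalIntegral.intervalIntegrable_rpow' (a := 0) (b := q - p)
      (show (-1 : ℝ) < -(1 / 2) by norm_num)).comp_sub_right p
    simpa using this
  constructor
  · exact ((intervalIntegrable_iff_integrableOn_Ioc_of_le hpq.le).1 hi).mono_set Ioo_subset_Ioc_self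
  · rw [← integral_Ioc_eq_integral_Ioo, ← intervalIntegral.integral_of_le hpq.le,
      intervalIntegral.integral_comp_sub_right (fun x => x ^ (-(1 / 2) : ℝ)) p,
      integral_rpow (Or.inl (by norm_num))]
    norm_num
    ring

/-- The joint density `p(x | θ) π(θ)` of the uniform model, extended by zero. -/
def jointDensity (θ₀ : ℝ) (a₁ a₂ π : ℝ → ℝ) : ℝ × ℝ → ℝ :=
  {z : ℝ × ℝ | z.2 ∈ Ioi θ₀ ∧ a₁ z.2 < z.1 ∧ z.1 < a₂ z.2}.indicator
    fun z => π z.2 / (a₂ z.2 - a₁ z.2)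

namespace SmoothEndpoints

variable {θ₀ : ℝ} {a₁ a₂ : ℝ → ℝ}

lemma strictMonoOn₁ (h : SmoothEndpoints θ₀ a₁ a₂) : StrictMonoOn a₁ (Ioi θ₀) :=
  strictMonoOn_of_deriv_pos (convex_Ioi θ₀) h.contDiffOn₁.continuousOn fun x hx =>
    h.deriv_pos x (interior_subset hx)

lemma strictMonoOn₂ (h : SmoothEndpoints θ₀ a₁ a₂) : StrictMonoOn a₂ (Ioi θ₀) :=
  strictMonoOn_of_deriv_pos (convex_Ioi θ₀) h.contDiffOn₂.continuousOn fun x hx =>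
    (h.deriv_pos x (interior_subset hx)).trans (h.deriv_lt x (interior_subset hx))

lemma monotoneOn_gap (h : SmoothEndpoints θ₀ a₁ a₂) :
    MonotoneOn (fun θ => a₂ θ - a₁ θ) (Ioi θ₀) :=
  (strictMonoOn_of_deriv_pos (convex_Ioi θ₀)
    (h.contDiffOn₂.continuousOn.sub h.contDiffOn₁.continuousOn) fun x hx => by
      have hx' := interior_subset hx
      rw [((h.hasDerivAt₂ hx').sub (h.hasDerivAt₁ hx')).deriv]
      exact sub_pos.2 (h.deriv_lt x hx')).monotoneOn

/-- Integration of `a₂' / (a₂ - r)²` over a set on which `a₂` exceeds `p > r`. -/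
lemma integral_deriv_div_sq_le (h : SmoothEndpoints θ₀ a₁ a₂) {S : Set ℝ} (hS : MeasurableSet S)
    (hSs : S ⊆ Ioi θ₀) {p r : ℝ} (hpr : r < p) (hp : ∀ θ ∈ S, p < a₂ θ) :
    IntegrableOn (fun θ => deriv a₂ θ * (1 / (a₂ θ - r) ^ 2)) S ∧
      ∫ θ in S, deriv a₂ θ * (1 / (a₂ θ - r) ^ 2) ≤ 1 / (p - r) := by
  have hd : ∀ θ ∈ S, HasDerivWithinAt a₂ (deriv a₂ θ) S θ := fun θ hθ =>
    (h.hasDerivAt₂ (hSs hθ)).hasDerivWithinAt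
  have hinj : InjOn a₂ S := (h.strictMonoOn₂.injOn).mono hSs
  have himg : a₂ '' S ⊆ Ioi p := by
    rintro _ ⟨θ, hθ, rfl⟩
    exact hp θ hθ
  obtain ⟨hi, hv⟩ := integral_Ioi_inv_sq hpr
  have habs : EqOn (fun θ => |deriv a₂ θ| • (1 / (a₂ θ - r) ^ 2))
      (fun θ => deriv a₂ θ * (1 / (a₂ θ - r) ^ 2)) S := by
    intro θ hθ
    have : 0 < deriv a₂ θ := (h.deriv_pos θ (hSs hθ)).trans (h.deriv_lt θ (hSs hθ))
    simp only [abs_of_pos this, smul_eq_mul]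
  have h1 := (integrableOn_image_iff_integrableOn_abs_deriv_smul hS hd hinj
    (fun y => 1 / (y - r) ^ 2)).1 (hi.mono_set himg)
  have h2 := integral_image_eq_integral_abs_deriv_smul hS hd hinj (fun y => 1 / (y - r) ^ 2)
  refine ⟨h1.congr_fun habs hS, ?_⟩
  rw [← setIntegral_congr_fun hS habs, ← h2, ← hv]
  exact setIntegral_mono_set hi (ae_of_all _ fun y => by simp only [Pi.zero_apply]; positivity)
    himg.eventuallyLE

section Joint

variable {π : ℝ → ℝ}

lemma measurable_jointDensity (h : SmoothEndpoints θ₀ a₁ a₂) (hπ : ContinuousOn π (Ioi θ₀)) :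
    Measurable (jointDensity θ₀ a₁ a₂ π) := by
  have c1 : ContinuousOn (fun z : ℝ × ℝ => a₁ z.2) {z | z.2 ∈ Ioi θ₀} :=
    h.contDiffOn₁.continuousOn.comp continuousOn_snd fun z hz => hz
  have c2 : ContinuousOn (fun z : ℝ × ℝ => a₂ z.2) {z | z.2 ∈ Ioi θ₀} :=
    h.contDiffOn₂.continuousOn.comp continuousOn_snd fun z hz => hz
  have cπ : ContinuousOn (fun z : ℝ × ℝ => π z.2) {z | z.2 ∈ Ioi θ₀} :=
    hπ.comp continuousOn_snd fun z hz => hz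
  have ho : IsOpen {z : ℝ × ℝ | z.2 ∈ Ioi θ₀} := isOpen_Ioi.preimage continuous_snd
  have o1 : IsOpen ({z : ℝ × ℝ | z.2 ∈ Ioi θ₀} ∩ (fun z : ℝ × ℝ => z.1 - a₁ z.2) ⁻¹' Ioi 0) :=
    (continuousOn_fst.sub c1).isOpen_inter_preimage ho isOpen_Ioi
  have o2 : IsOpen ({z : ℝ × ℝ | z.2 ∈ Ioi θ₀} ∩ (fun z : ℝ × ℝ => a₂ z.2 - z.1) ⁻¹' Ioi 0) :=
    (c2.sub continuousOn_fst).isOpen_inter_preimage ho isOpen_Ioi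
  have hW : MeasurableSet {z : ℝ × ℝ | z.2 ∈ Ioi θ₀ ∧ a₁ z.2 < z.1 ∧ z.1 < a₂ z.2} := by
    convert (o1.inter o2).measurableSet using 1
    ext z
    simp only [mem_ofPred_eq, mem_inter_iff, mem_preimage, mem_Ioi, sub_pos]
    tauto
  classical
  rw [jointDensity, ← piecewise_eq_indicator]
  refine ContinuousOn.measurable_piecewise ?_ continuousOn_const hW
  exact (cπ.div (c2.sub c1) fun z hz => (sub_pos.2 (h.lt z.2 hz)).ne').mono fun z hz => hz.1

lemma density_mul_eq_jointDensity (h : SmoothEndpoints θ₀ a₁ a₂) {θ : ℝ} (hθ : θ ∈ Ioi θ₀) (x : ℝ) :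
    (uniformModel θ₀ a₁ a₂ h.lt).density x θ * π θ = jointDensity θ₀ a₁ a₂ π (x, θ) := by
  simp only [uniformModel, jointDensity]
  by_cases hx : x ∈ Ioo (a₁ θ) (a₂ θ)
  · rw [indicator_of_mem hx, indicator_of_mem (by exact ⟨hθ, hx.1, hx.2⟩)]
    ring
  · rw [indicator_of_notMem hx, indicator_of_notMem (fun hm => hx hm.2), zero_mul]

lemma jointDensity_nonneg (h : SmoothEndpoints θ₀ a₁ a₂) (hπ0 : ∀ θ ∈ Ioi θ₀, 0 < π θ)
    (z : ℝ × ℝ) : 0 ≤ jointDensity θ₀ a₁ a₂ π z :=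
  indicator_nonneg (fun _ hz => div_nonneg (hπ0 _ hz.1).le (sub_pos.2 (h.lt _ hz.1)).le) z

lemma lt_of_jointDensity_ne_zero {x θ : ℝ} (hne : jointDensity θ₀ a₁ a₂ π (x, θ) ≠ 0) :
    θ ∈ Ioi θ₀ ∧ a₁ θ < x ∧ x < a₂ θ :=
  mem_of_indicator_ne_zero (s := {z : ℝ × ℝ | z.2 ∈ Ioi θ₀ ∧ a₁ z.2 < z.1 ∧ z.1 < a₂ z.2}) hne

lemma jointDensity_le (h : SmoothEndpoints θ₀ a₁ a₂)
    (hπ1 : ∀ θ ∈ Ioi θ₀, π θ ≤ deriv a₂ θ / (a₂ θ - a₁ θ)) {x θ : ℝ}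
    (hne : jointDensity θ₀ a₁ a₂ π (x, θ) ≠ 0) :
    jointDensity θ₀ a₁ a₂ π (x, θ) ≤ deriv a₂ θ * (1 / (a₂ θ - a₁ θ) ^ 2) := by
  have hm := lt_of_jointDensity_ne_zero hne
  have hD := sub_pos.2 (h.lt θ hm.1)
  have e : jointDensity θ₀ a₁ a₂ π (x, θ) = π θ / (a₂ θ - a₁ θ) :=
    indicator_of_mem (s := {z : ℝ × ℝ | z.2 ∈ Ioi θ₀ ∧ a₁ z.2 < z.1 ∧ z.1 < a₂ z.2}) hm _
  rw [e]
  calc _ ≤ deriv a₂ θ / (a₂ θ - a₁ θ) / (a₂ θ - a₁ θ) := by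
        gcongr; exact hπ1 θ hm.1
    _ = _ := by field_simp

/-- The joint density is at most `a₂' / (a₂ - a₁)²`. Once `a₁` is replaced by a constant `r`, at the
cost of a factor `B`, this is an exact derivative in `a₂`. -/
lemma integral_jointDensity_le_of_le (h : SmoothEndpoints θ₀ a₁ a₂)
    (hπc : ContinuousOn π (Ioi θ₀)) (hπ0 : ∀ θ ∈ Ioi θ₀, 0 < π θ)
    (hπ1 : ∀ θ ∈ Ioi θ₀, π θ ≤ deriv a₂ θ / (a₂ θ - a₁ θ))
    {S : Set ℝ} (hS : MeasurableSet S) (hSs : S ⊆ Ioi θ₀) {x p r B : ℝ}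
    (hB : 0 ≤ B) (hpr : r < p)
    (hb : ∀ θ ∈ S, jointDensity θ₀ a₁ a₂ π (x, θ) ≠ 0 →
      p < a₂ θ ∧ 1 / (a₂ θ - a₁ θ) ^ 2 ≤ B * (1 / (a₂ θ - r) ^ 2)) :
    IntegrableOn (fun θ => jointDensity θ₀ a₁ a₂ π (x, θ)) S ∧
      ∫ θ in S, jointDensity θ₀ a₁ a₂ π (x, θ) ≤ B / (p - r) := by
  have hm : Measurable fun θ => jointDensity θ₀ a₁ a₂ π (x, θ) :=
    (h.measurable_jointDensity hπc).comp measurable_prodMk_left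
  set S' := S ∩ {θ | jointDensity θ₀ a₁ a₂ π (x, θ) ≠ 0} with hS'
  have hS'm : MeasurableSet S' := hS.inter (hm (measurableSet_singleton 0).compl)
  obtain ⟨hi, hv⟩ := h.integral_deriv_div_sq_le hS'm (inter_subset_left.trans hSs) hpr
    fun θ hθ => (hb θ hθ.1 hθ.2).1
  have hle : ∀ θ ∈ S', jointDensity θ₀ a₁ a₂ π (x, θ) ≤
      B * (deriv a₂ θ * (1 / (a₂ θ - r) ^ 2)) := by
    intro θ hθ
    have hθ0 := hSs hθ.1
    have hd : 0 < deriv a₂ θ := (h.deriv_pos θ hθ0).trans (h.deriv_lt θ hθ0)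
    calc _ ≤ _ := h.jointDensity_le hπ1 hθ.2
      _ ≤ deriv a₂ θ * (B * (1 / (a₂ θ - r) ^ 2)) :=
        mul_le_mul_of_nonneg_left (hb θ hθ.1 hθ.2).2 hd.le
      _ = _ := by ring
  have hi' : IntegrableOn (fun θ => jointDensity θ₀ a₁ a₂ π (x, θ)) S' := by
    refine (hi.const_mul B).mono' hm.aestronglyMeasurable ?_
    filter_upwards [ae_restrict_mem hS'm] with θ hθ
    rw [Real.norm_of_nonneg (h.jointDensity_nonneg hπ0 _)]
    exact hle θ hθ
  have h0 : ∀ θ ∈ S \ S', jointDensity θ₀ a₁ a₂ π (x, θ) = 0 := fun θ hθ => by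
    by_contra hne
    exact hθ.2 ⟨hθ.1, hne⟩
  constructor
  · rw [← sdiff_union_of_subset (inter_subset_left : S' ⊆ S)]
    exact (integrableOn_zero.congr_fun (fun θ hθ => (h0 θ hθ).symm) (hS.diff hS'm)).union hi'
  · rw [setIntegral_eq_of_subset_of_forall_sdiff_eq_zero hS inter_subset_left h0]
    refine (setIntegral_mono_on hi' (hi.const_mul B) hS'm hle).trans ?_
    rw [integral_const_mul, div_eq_mul_one_div]
    exact mul_le_mul_of_nonneg_left hv hB

/-- For `θ ≤ α` one has `a₁ θ ≤ a₁ α`, so `r = a₁ α` serves, and `x < a₂ θ` allows `p = x`. -/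
lemma integral_jointDensity_left (h : SmoothEndpoints θ₀ a₁ a₂)
    (hπc : ContinuousOn π (Ioi θ₀)) (hπ0 : ∀ θ ∈ Ioi θ₀, 0 < π θ)
    (hπ1 : ∀ θ ∈ Ioi θ₀, π θ ≤ deriv a₂ θ / (a₂ θ - a₁ θ))
    {α x : ℝ} (hα : α ∈ Ioi θ₀) (hx : a₁ α < x) :
    IntegrableOn (fun θ => jointDensity θ₀ a₁ a₂ π (x, θ)) (Ioc θ₀ α) ∧
      ∫ θ in Ioc θ₀ α, jointDensity θ₀ a₁ a₂ π (x, θ) ≤ 1 / (x - a₁ α) := by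
  refine h.integral_jointDensity_le_of_le hπc hπ0 hπ1 measurableSet_Ioc (fun θ hθ => hθ.1)
    zero_le_one hx fun θ hθ hne => ?_
  obtain ⟨h0, h1, h2⟩ := lt_of_jointDensity_ne_zero hne
  have := h.strictMonoOn₁.monotoneOn h0 hα hθ.2
  refine ⟨h2, ?_⟩
  rw [one_mul]
  have : 0 < a₂ θ - a₁ α := by linarith
  gcongr

/-- When `a₁ θ < x < a₂ β`, the length at `θ` is at least `a₂ θ - a₂ β` and, by monotonicity, at
least `a₂ β - a₁ β`. Averaging the two gives `(a₂ θ - a₁ β) / 2`, whence `B = 4`. -/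
lemma integral_jointDensity_right (h : SmoothEndpoints θ₀ a₁ a₂)
    (hπc : ContinuousOn π (Ioi θ₀)) (hπ0 : ∀ θ ∈ Ioi θ₀, 0 < π θ)
    (hπ1 : ∀ θ ∈ Ioi θ₀, π θ ≤ deriv a₂ θ / (a₂ θ - a₁ θ))
    {β x : ℝ} (hβ : β ∈ Ioi θ₀) (hx : x < a₂ β) :
    IntegrableOn (fun θ => jointDensity θ₀ a₁ a₂ π (x, θ)) (Ioi β) ∧
      ∫ θ in Ioi β, jointDensity θ₀ a₁ a₂ π (x, θ) ≤ 4 / (a₂ β - a₁ β) := by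
  refine h.integral_jointDensity_le_of_le hπc hπ0 hπ1 measurableSet_Ioi
    (fun θ hθ => lt_trans (mem_Ioi.1 hβ) hθ) (by norm_num) (h.lt β hβ) fun θ hθ hne => ?_
  obtain ⟨h0, h1, h2⟩ := lt_of_jointDensity_ne_zero hne
  have hm := h.strictMonoOn₂ hβ h0 hθ
  have hg : a₂ β - a₁ β ≤ a₂ θ - a₁ θ := h.monotoneOn_gap hβ h0 (le_of_lt hθ)
  have hD := sub_pos.2 (h.lt β hβ)
  refine ⟨hm, ?_⟩
  have e : 4 * (1 / (a₂ θ - a₁ β) ^ 2) = 1 / ((a₂ θ - a₁ β) / 2) ^ 2 := by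
    rw [div_pow]; field_simp; ring
  rw [e]
  have : 0 < (a₂ θ - a₁ β) / 2 := by linarith
  gcongr
  linarith

lemma integrableOn_jointDensity (h : SmoothEndpoints θ₀ a₁ a₂)
    (hπc : ContinuousOn π (Ioi θ₀)) (hπ0 : ∀ θ ∈ Ioi θ₀, 0 < π θ)
    (hπ1 : ∀ θ ∈ Ioi θ₀, π θ ≤ deriv a₂ θ / (a₂ θ - a₁ θ))
    (x : ℝ) :
    IntegrableOn (fun θ => jointDensity θ₀ a₁ a₂ π (x, θ)) (Ioi θ₀) := by
  by_cases hne : ∃ θ, jointDensity θ₀ a₁ a₂ π (x, θ) ≠ 0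
  · obtain ⟨θ, hθ⟩ := hne
    obtain ⟨h0, h1, h2⟩ := lt_of_jointDensity_ne_zero hθ
    rw [← Ioc_union_Ioi_eq_Ioi (le_of_lt h0)]
    exact (h.integral_jointDensity_left hπc hπ0 hπ1 h0 h1).1.union
      (h.integral_jointDensity_right hπc hπ0 hπ1 h0 h2).1
  · push Not at hne
    simp_rw [hne]
    exact integrableOn_zero

end Joint

end SmoothEndpoints

/-- The integral of the joint density `p(x | θ) π(θ)` over a set of parameters. -/
def partialMarginal (θ₀ : ℝ) (a₁ a₂ π : ℝ → ℝ) (S : Set ℝ) (x : ℝ) : ℝ :=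
  ∫ θ in S, jointDensity θ₀ a₁ a₂ π (x, θ)

namespace SmoothEndpoints

variable {θ₀ : ℝ} {a₁ a₂ π : ℝ → ℝ}

lemma stronglyMeasurable_partialMarginal (h : SmoothEndpoints θ₀ a₁ a₂)
    (hπc : ContinuousOn π (Ioi θ₀)) (S : Set ℝ) :
    StronglyMeasurable (partialMarginal θ₀ a₁ a₂ π S) :=
  StronglyMeasurable.integral_prod_right (f := fun x θ => jointDensity θ₀ a₁ a₂ π (x, θ))
    (h.measurable_jointDensity hπc).stronglyMeasurable

lemma partialMarginal_nonneg (h : SmoothEndpoints θ₀ a₁ a₂) (hπ0 : ∀ θ ∈ Ioi θ₀, 0 < π θ)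
    (S : Set ℝ) (x : ℝ) : 0 ≤ partialMarginal θ₀ a₁ a₂ π S x :=
  integral_nonneg fun _ => h.jointDensity_nonneg hπ0 _

lemma exists_ne_zero_of_partialMarginal_ne_zero {S : Set ℝ} {x : ℝ}
    (hne : partialMarginal θ₀ a₁ a₂ π S x ≠ 0) :
    ∃ θ ∈ S, θ ∈ Ioi θ₀ ∧ a₁ θ < x ∧ x < a₂ θ := by
  by_contra! hno
  refine hne (setIntegral_eq_zero_of_forall_eq_zero fun θ hθ => ?_)
  by_contra hj
  obtain ⟨h0, h1, h2⟩ := lt_of_jointDensity_ne_zero hj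
  exact absurd h2 (not_lt.2 (hno θ hθ h0 h1))

lemma partialMarginal_mono (h : SmoothEndpoints θ₀ a₁ a₂)
    (hπc : ContinuousOn π (Ioi θ₀)) (hπ0 : ∀ θ ∈ Ioi θ₀, 0 < π θ)
    (hπ1 : ∀ θ ∈ Ioi θ₀, π θ ≤ deriv a₂ θ / (a₂ θ - a₁ θ)) {S : Set ℝ} (hS : S ⊆ Ioi θ₀) (x : ℝ) :
    partialMarginal θ₀ a₁ a₂ π S x ≤ partialMarginal θ₀ a₁ a₂ π (Ioi θ₀) x :=
  setIntegral_mono_set (h.integrableOn_jointDensity hπc hπ0 hπ1 x)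
    (ae_of_all _ fun _ => h.jointDensity_nonneg hπ0 _) hS.eventuallyLE

lemma marginal_eq (h : SmoothEndpoints θ₀ a₁ a₂) (x : ℝ) :
    (uniformModel θ₀ a₁ a₂ h.lt).marginal π x = partialMarginal θ₀ a₁ a₂ π (Ioi θ₀) x :=
  setIntegral_congr_fun measurableSet_Ioi fun _ hθ => h.density_mul_eq_jointDensity hθ x

lemma density_mul_restrictPrior (h : SmoothEndpoints θ₀ a₁ a₂) (K : Set ℝ) (x : ℝ) {θ : ℝ}
    (hθ : θ ∈ Ioi θ₀) :
    (uniformModel θ₀ a₁ a₂ h.lt).density x θ * restrictPrior π K θ =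
      K.indicator (fun θ => jointDensity θ₀ a₁ a₂ π (x, θ) / ∫ τ in K, π τ) θ := by
  by_cases hK : θ ∈ K
  · rw [restrictPrior, indicator_of_mem hK, indicator_of_mem hK,
      ← h.density_mul_eq_jointDensity hθ x, mul_div_assoc]
  · rw [restrictPrior, indicator_of_notMem hK, indicator_of_notMem hK, mul_zero]

lemma marginal_restrictPrior_eq (h : SmoothEndpoints θ₀ a₁ a₂) {K : Set ℝ} (hK : MeasurableSet K)
    (hKs : K ⊆ Ioi θ₀) (x : ℝ) :
    (uniformModel θ₀ a₁ a₂ h.lt).marginal (restrictPrior π K) x =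
      partialMarginal θ₀ a₁ a₂ π K x / ∫ τ in K, π τ := by
  have e : (uniformModel θ₀ a₁ a₂ h.lt).marginal (restrictPrior π K) x =
      ∫ θ in Ioi θ₀, K.indicator (fun θ => jointDensity θ₀ a₁ a₂ π (x, θ) / ∫ τ in K, π τ) θ :=
    setIntegral_congr_fun measurableSet_Ioi fun _ hθ => h.density_mul_restrictPrior K x hθ
  rw [e, setIntegral_indicator hK, inter_eq_self_of_subset_right hKs, integral_div,
    partialMarginal]

/-- The integrand of the logarithmic divergence of the formal posterior from the posterior of the
restricted prior. -/
lemma posterior_mul_log_eq (h : SmoothEndpoints θ₀ a₁ a₂) {K : Set ℝ}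
    (hK : MeasurableSet K) (hKs : K ⊆ Ioi θ₀) (hc : 0 < ∫ τ in K, π τ) (x : ℝ) {θ : ℝ} (hθ : θ ∈ Ioi θ₀) :
    (uniformModel θ₀ a₁ a₂ h.lt).posterior (restrictPrior π K) x θ *
        Real.log ((uniformModel θ₀ a₁ a₂ h.lt).posterior (restrictPrior π K) x θ /
          (uniformModel θ₀ a₁ a₂ h.lt).posterior π x θ) =
      K.indicator (fun θ => jointDensity θ₀ a₁ a₂ π (x, θ) *
        (Real.log (partialMarginal θ₀ a₁ a₂ π (Ioi θ₀) x / partialMarginal θ₀ a₁ a₂ π K x) /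
          partialMarginal θ₀ a₁ a₂ π K x)) θ := by
  rw [ParametricModel.posterior, ParametricModel.posterior, h.marginal_restrictPrior_eq hK hKs,
    h.density_mul_restrictPrior K x hθ, h.marginal_eq, h.density_mul_eq_jointDensity hθ x]
  by_cases hθK : θ ∈ K
  · rw [indicator_of_mem hθK, indicator_of_mem hθK, div_div_div_cancel_right₀ hc.ne']
    by_cases hj : jointDensity θ₀ a₁ a₂ π (x, θ) = 0
    · simp [hj]
    · rw [div_div_div_eq, mul_comm _ (jointDensity θ₀ a₁ a₂ π (x, θ)), mul_div_mul_left _ _ hj]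
      ring
  · rw [indicator_of_notMem hθK, indicator_of_notMem hθK]
    simp

lemma logDivergenceFinite_posterior (h : SmoothEndpoints θ₀ a₁ a₂)
    (hπc : ContinuousOn π (Ioi θ₀)) (hπ0 : ∀ θ ∈ Ioi θ₀, 0 < π θ)
    (hπ1 : ∀ θ ∈ Ioi θ₀, π θ ≤ deriv a₂ θ / (a₂ θ - a₁ θ)) {K : Set ℝ}
    (hK : MeasurableSet K) (hKs : K ⊆ Ioi θ₀) (hc : 0 < ∫ τ in K, π τ) {x : ℝ}
    (hm : partialMarginal θ₀ a₁ a₂ π K x ≠ 0) :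
    LogDivergenceFinite (Ioi θ₀) ((uniformModel θ₀ a₁ a₂ h.lt).posterior π x)
      ((uniformModel θ₀ a₁ a₂ h.lt).posterior (restrictPrior π K) x) := by
  have hmpos : 0 < partialMarginal θ₀ a₁ a₂ π (Ioi θ₀) x :=
    ((h.partialMarginal_nonneg hπ0 K x).lt_of_ne' hm).trans_le
      (h.partialMarginal_mono hπc hπ0 hπ1 hKs x)
  constructor
  · filter_upwards [ae_restrict_mem measurableSet_Ioi] with θ hθ h0
    rw [ParametricModel.posterior, h.marginal_eq, h.density_mul_eq_jointDensity hθ x,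
      div_eq_zero_iff, or_iff_left hmpos.ne'] at h0
    rw [ParametricModel.posterior, h.density_mul_restrictPrior K x hθ]
    simp [indicator, h0]
  · refine IntegrableOn.congr_fun ?_
      (fun θ hθ => (h.posterior_mul_log_eq hK hKs hc x hθ).symm) measurableSet_Ioi
    exact ((h.integrableOn_jointDensity hπc hπ0 hπ1 x).mul_const _).indicator hK

lemma logDivergence_mul_marginal (h : SmoothEndpoints θ₀ a₁ a₂) {K : Set ℝ}
    (hK : MeasurableSet K) (hKs : K ⊆ Ioi θ₀) (hc : 0 < ∫ τ in K, π τ) (x : ℝ) :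
    logDivergence (Ioi θ₀) ((uniformModel θ₀ a₁ a₂ h.lt).posterior π x)
        ((uniformModel θ₀ a₁ a₂ h.lt).posterior (restrictPrior π K) x) *
        (uniformModel θ₀ a₁ a₂ h.lt).marginal (restrictPrior π K) x =
      partialMarginal θ₀ a₁ a₂ π K x *
        Real.log (partialMarginal θ₀ a₁ a₂ π (Ioi θ₀) x / partialMarginal θ₀ a₁ a₂ π K x) /
        ∫ τ in K, π τ := by
  rw [h.marginal_restrictPrior_eq hK hKs]
  by_cases hm : partialMarginal θ₀ a₁ a₂ π K x = 0
  · simp [hm]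
  · rw [logDivergence, setIntegral_congr_fun measurableSet_Ioi fun θ hθ =>
      h.posterior_mul_log_eq hK hKs hc x hθ, setIntegral_indicator hK,
      inter_eq_self_of_subset_right hKs, integral_mul_const, ← partialMarginal]
    field_simp

/-- A dominating function for the unnormalized expected divergence over `[α, β]`. -/
lemma partialMarginal_mul_log_le (h : SmoothEndpoints θ₀ a₁ a₂)
    (hπc : ContinuousOn π (Ioi θ₀)) (hπ0 : ∀ θ ∈ Ioi θ₀, 0 < π θ)
    (hπ1 : ∀ θ ∈ Ioi θ₀, π θ ≤ deriv a₂ θ / (a₂ θ - a₁ θ)) {α β : ℝ} (hα : α ∈ Ioi θ₀)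
    (hαβ : α ≤ β) (x : ℝ) :
    partialMarginal θ₀ a₁ a₂ π (Icc α β) x *
        Real.log (partialMarginal θ₀ a₁ a₂ π (Ioi θ₀) x /
          partialMarginal θ₀ a₁ a₂ π (Icc α β) x) ≤
      (Ioo (a₁ α) (a₂ α)).indicator (fun x => 4 * (a₂ α - a₁ α) ^ (-(1 / 2) : ℝ) *
        (x - a₁ α) ^ (-(1 / 2) : ℝ)) x +
      (Ioo (a₁ β) (a₂ β)).indicator (fun _ => 4 / (a₂ β - a₁ β)) x := by
  have hβ : β ∈ Ioi θ₀ := lt_of_lt_of_le hα hαβ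
  have hDα := sub_pos.2 (h.lt α hα)
  have hDβ := sub_pos.2 (h.lt β hβ)
  have hH₁ : 0 ≤ (Ioo (a₁ α) (a₂ α)).indicator (fun x => 4 * (a₂ α - a₁ α) ^ (-(1 / 2) : ℝ) *
        (x - a₁ α) ^ (-(1 / 2) : ℝ)) x := indicator_nonneg (fun y hy => by
    have := sub_pos.2 hy.1
    positivity) x
  have hH₂ : 0 ≤ (Ioo (a₁ β) (a₂ β)).indicator (fun _ => 4 / (a₂ β - a₁ β)) x :=
    indicator_nonneg (fun y hy => by positivity) x
  set s := partialMarginal θ₀ a₁ a₂ π (Ioc θ₀ α) x with hs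
  set t := partialMarginal θ₀ a₁ a₂ π (Icc α β) x with ht
  set u := partialMarginal θ₀ a₁ a₂ π (Ioi β) x with hu
  have hs0 : 0 ≤ s := h.partialMarginal_nonneg hπ0 _ x
  have ht0 : 0 ≤ t := h.partialMarginal_nonneg hπ0 _ x
  have hu0 : 0 ≤ u := h.partialMarginal_nonneg hπ0 _ x
  have hint := h.integrableOn_jointDensity hπc hπ0 hπ1 x
  have htot : partialMarginal θ₀ a₁ a₂ π (Ioi θ₀) x = s + t + u := by
    have i1 : IntegrableOn (fun θ => jointDensity θ₀ a₁ a₂ π (x, θ)) (Ioc θ₀ α) :=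
      hint.mono_set Ioc_subset_Ioi_self
    have i2 : IntegrableOn (fun θ => jointDensity θ₀ a₁ a₂ π (x, θ)) (Ioc α β) :=
      hint.mono_set fun θ hθ => lt_trans (mem_Ioi.1 hα) hθ.1
    have i3 : IntegrableOn (fun θ => jointDensity θ₀ a₁ a₂ π (x, θ)) (Ioi β) :=
      hint.mono_set (Ioi_subset_Ioi (le_of_lt hβ))
    rw [hs, ht, hu, partialMarginal, partialMarginal, partialMarginal, partialMarginal,
      integral_Icc_eq_integral_Ioc, ← Ioc_union_Ioi_eq_Ioi (le_of_lt hβ),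
      setIntegral_union (Ioc_disjoint_Ioi le_rfl) measurableSet_Ioi _ i3,
      ← Ioc_union_Ioc_eq_Ioc (le_of_lt hα) hαβ,
      setIntegral_union (Ioc_disjoint_Ioc_of_le le_rfl) measurableSet_Ioc i1 i2]
    rw [← Ioc_union_Ioc_eq_Ioc (le_of_lt hα) hαβ]
    exact i1.union i2
  rcases ht0.eq_or_lt with ht' | ht'
  · rw [← ht']
    simpa using add_nonneg hH₁ hH₂
  obtain ⟨θ, hθ, hθ0, hθ1, hθ2⟩ := exists_ne_zero_of_partialMarginal_ne_zero ht'.ne'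
  have hxα : a₁ α < x := (h.strictMonoOn₁.monotoneOn hα hθ0 hθ.1).trans_lt hθ1
  have hxβ : x < a₂ β := hθ2.trans_le (h.strictMonoOn₂.monotoneOn hθ0 hβ hθ.2)
  rw [htot]
  refine (mul_log_add_div_le hs0 ht0 hu0).trans (add_le_add ?_ ?_)
  -- If `x < a₂ α`, both `s` and `t` have explicit bounds; otherwise no parameter up to `α` can
  -- produce `x`, and `s = 0`.
  · by_cases hx2 : x < a₂ α
    · rw [indicator_of_mem (mem_Ioo.2 ⟨hxα, hx2⟩)]
      have h1 : s ≤ 1 / (x - a₁ α) := (h.integral_jointDensity_left hπc hπ0 hπ1 hα hxα).2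
      have h2 : t ≤ 4 / (a₂ α - a₁ α) := by
        obtain ⟨hi, hv⟩ := h.integral_jointDensity_right hπc hπ0 hπ1 hα hx2
        rw [ht, partialMarginal, integral_Icc_eq_integral_Ioc]
        exact (setIntegral_mono_set hi (ae_of_all _ fun _ => h.jointDensity_nonneg hπ0 _)
          Ioc_subset_Ioi_self.eventuallyLE).trans hv
      have hx0 := sub_pos.2 hxα
      calc 2 * √(t * s) ≤ 2 * √(4 / (a₂ α - a₁ α) * (1 / (x - a₁ α))) := by gcongr
        _ = _ := by
          rw [Real.rpow_neg hDα.le, Real.rpow_neg hx0.le, ← Real.sqrt_eq_rpow,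
            ← Real.sqrt_eq_rpow, Real.sqrt_mul (by positivity), Real.sqrt_div (by norm_num),
            Real.sqrt_div (by norm_num), show (4 : ℝ) = 2 ^ 2 by norm_num,
            Real.sqrt_sq (by norm_num), Real.sqrt_one]
          ring
    · have : s = 0 := by
        by_contra hne
        obtain ⟨η, hη, hη0, -, hη2⟩ :=
          exists_ne_zero_of_partialMarginal_ne_zero hne
        exact hx2 (hη2.trans_le (h.strictMonoOn₂.monotoneOn hη0 hα hη.2))
      rw [this, mul_zero, Real.sqrt_zero, mul_zero]
      exact hH₁
  · by_cases hx1 : a₁ β < x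
    · rw [indicator_of_mem (mem_Ioo.2 ⟨hx1, hxβ⟩)]
      exact (h.integral_jointDensity_right hπc hπ0 hπ1 hβ hxβ).2
    · have : u = 0 := by
        by_contra hne
        obtain ⟨η, hη, hη0, hη1, -⟩ :=
          exists_ne_zero_of_partialMarginal_ne_zero hne
        exact hx1 ((h.strictMonoOn₁ hβ hη0 hη).trans hη1)
      rw [this]
      exact hH₂

/-- The dominating function is scale invariant, so its integral does not depend on `α` or `β`: the
left boundary contributes `4 · 2 = 8` and the right one `4`. -/
lemma integral_partialMarginal_mul_log_le (h : SmoothEndpoints θ₀ a₁ a₂)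
    (hπc : ContinuousOn π (Ioi θ₀)) (hπ0 : ∀ θ ∈ Ioi θ₀, 0 < π θ)
    (hπ1 : ∀ θ ∈ Ioi θ₀, π θ ≤ deriv a₂ θ / (a₂ θ - a₁ θ)) {α β : ℝ} (hα : α ∈ Ioi θ₀)
    (hαβ : α ≤ β) :
    Integrable (fun x => partialMarginal θ₀ a₁ a₂ π (Icc α β) x *
        Real.log (partialMarginal θ₀ a₁ a₂ π (Ioi θ₀) x /
          partialMarginal θ₀ a₁ a₂ π (Icc α β) x)) ∧
      ∫ x, partialMarginal θ₀ a₁ a₂ π (Icc α β) x *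
        Real.log (partialMarginal θ₀ a₁ a₂ π (Ioi θ₀) x /
          partialMarginal θ₀ a₁ a₂ π (Icc α β) x) ≤ 12 := by
  have hβ : β ∈ Ioi θ₀ := lt_of_lt_of_le hα hαβ
  have hDα := sub_pos.2 (h.lt α hα)
  have hDβ := sub_pos.2 (h.lt β hβ)
  obtain ⟨hi, hv⟩ := integral_Ioo_rpow_neg_half (h.lt α hα)
  have i1 := (integrable_indicator_iff measurableSet_Ioo).2
    (hi.const_mul (4 * (a₂ α - a₁ α) ^ (-(1 / 2) : ℝ)))
  have i2 : Integrable ((Ioo (a₁ β) (a₂ β)).indicator fun _ => 4 / (a₂ β - a₁ β)) :=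
    (integrable_indicator_iff measurableSet_Ioo).2 (integrableOn_const (by simp))
  have hle := h.partialMarginal_mul_log_le hπc hπ0 hπ1 hα hαβ
  have hKs : Icc α β ⊆ Ioi θ₀ := fun θ hθ => lt_of_lt_of_le hα hθ.1
  have hF : Integrable fun x => partialMarginal θ₀ a₁ a₂ π (Icc α β) x *
        Real.log (partialMarginal θ₀ a₁ a₂ π (Ioi θ₀) x /
          partialMarginal θ₀ a₁ a₂ π (Icc α β) x) := by
    have m1 := (h.stronglyMeasurable_partialMarginal hπc (Icc α β)).measurable
    have m2 := (h.stronglyMeasurable_partialMarginal hπc (Ioi θ₀)).measurable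
    refine (i1.add i2).mono' (m1.mul (m2.div m1).log).aestronglyMeasurable
      (ae_of_all _ fun x => ?_)
    rw [Real.norm_of_nonneg (mul_log_div_nonneg (h.partialMarginal_nonneg hπ0 _ x)
      (h.partialMarginal_mono hπc hπ0 hπ1 hKs x))]
    exact hle x
  refine ⟨hF, (integral_mono hF (i1.add i2) hle).trans_eq ?_⟩
  simp only [Pi.add_apply]
  rw [integral_add i1 i2, integral_indicator measurableSet_Ioo,
    integral_indicator measurableSet_Ioo, integral_const_mul, hv, setIntegral_const,
    Real.volume_real_Ioo_of_le (h.lt β hβ).le, smul_eq_mul, mul_div_cancel₀ _ hDβ.ne',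
    Real.rpow_neg hDα.le]
  have : (a₂ α - a₁ α) ^ (1 / 2 : ℝ) ≠ 0 := (Real.rpow_pos_of_pos hDα _).ne'
  field_simp
  norm_num

end SmoothEndpoints

/-- The integral of a nonnegative function over an exhaustion by measurable sets tends to infinity
unless the function is integrable. -/
lemma tendsto_setIntegral_atTop_of_not_integrableOn {f : ℝ → ℝ} {K : ℕ → Set ℝ} (hK : Monotone K)
    (hm : ∀ i, MeasurableSet (K i)) (hf : ∀ x ∈ ⋃ i, K i, 0 ≤ f x)
    (hi : ∀ i, IntegrableOn f (K i)) (hn : ¬ IntegrableOn f (⋃ i, K i)) :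
    Tendsto (fun i => ∫ x in K i, f x) atTop atTop := by
  have hmono : Monotone fun i => ∫ x in K i, f x := fun i j hij =>
    setIntegral_mono_set (hi j) (by
      filter_upwards [ae_restrict_mem (hm j)] with x hx
      exact hf x (mem_iUnion_of_mem j hx)) (hK hij).eventuallyLE
  refine (tendsto_atTop_of_monotone hmono).resolve_right fun ⟨l, hl⟩ => hn ?_
  have hcover : AECover (volume.restrict (⋃ i, K i)) atTop K :=
    { ae_eventually_mem := by
        filter_upwards [ae_restrict_mem (MeasurableSet.iUnion hm)] with x hx
        obtain ⟨i, hx⟩ := mem_iUnion.1 hx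
        exact eventually_atTop.2 ⟨i, fun j hj => hK hj hx⟩
      measurableSet := hm }
  have hres : ∀ i, (volume.restrict (⋃ i, K i)).restrict (K i) = volume.restrict (K i) := fun i =>
    Measure.restrict_restrict_of_subset (subset_iUnion K i)
  refine hcover.integrable_of_integral_norm_tendsto l
    (fun i => by rw [IntegrableOn, hres]; exact hi i) (hl.congr fun i => ?_)
  rw [hres]
  exact setIntegral_congr_fun (hm i) fun x hx =>
    (Real.norm_of_nonneg (hf x (mem_iUnion_of_mem i hx))).symm

lemma isCompact_exhaustion_Ioi (θ₀ : ℝ) :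
    Monotone (fun i : ℕ => Icc (θ₀ + 1 / ((i : ℝ) + 1)) (θ₀ + i + 2)) ∧
      ⋃ i : ℕ, Icc (θ₀ + 1 / ((i : ℝ) + 1)) (θ₀ + i + 2) = Ioi θ₀ := by
  constructor
  · intro i j hij
    have : (i : ℝ) ≤ j := by exact_mod_cast hij
    exact Icc_subset_Icc (by gcongr) (by linarith)
  · ext θ
    simp only [mem_iUnion, mem_Icc, mem_Ioi]
    constructor
    · rintro ⟨i, hi, -⟩
      have : (0 : ℝ) < 1 / ((i : ℝ) + 1) := by positivity
      linarith
    · intro hθ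
      obtain ⟨n, hn⟩ := exists_nat_one_div_lt (sub_pos.2 hθ)
      obtain ⟨k, hk⟩ := exists_nat_ge (θ - θ₀)
      refine ⟨max n k, ?_, ?_⟩
      · have : 1 / (((max n k : ℕ) : ℝ) + 1) ≤ 1 / ((n : ℝ) + 1) := by
          have : (n : ℝ) ≤ (max n k : ℕ) := by exact_mod_cast le_max_left n k
          gcongr
        linarith
      · have : (k : ℝ) ≤ (max n k : ℕ) := by exact_mod_cast le_max_right n k
        linarith

namespace SmoothEndpoints

variable {θ₀ : ℝ} {a₁ a₂ π : ℝ → ℝ}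

lemma integrable_partialMarginal (h : SmoothEndpoints θ₀ a₁ a₂)
    (hπc : ContinuousOn π (Ioi θ₀)) (hπi : IntegrableOn π (Ioi θ₀)) :
    Integrable (partialMarginal θ₀ a₁ a₂ π (Ioi θ₀)) := by
  have hsec : ∀ θ ∈ Ioi θ₀, (fun x => jointDensity θ₀ a₁ a₂ π (x, θ)) =
      (Ioo (a₁ θ) (a₂ θ)).indicator fun _ => π θ / (a₂ θ - a₁ θ) := by
    intro θ hθ
    ext x
    by_cases hx : x ∈ Ioo (a₁ θ) (a₂ θ)
    · rw [indicator_of_mem hx, jointDensity, indicator_of_mem (by exact ⟨hθ, hx.1, hx.2⟩)]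
    · rw [indicator_of_notMem hx, jointDensity, indicator_of_notMem (fun hm => hx hm.2)]
  have hint : Integrable (jointDensity θ₀ a₁ a₂ π) (volume.prod (volume.restrict (Ioi θ₀))) := by
    refine (integrable_prod_iff' (h.measurable_jointDensity hπc).aestronglyMeasurable).2 ⟨?_, ?_⟩
    · filter_upwards [ae_restrict_mem measurableSet_Ioi] with θ hθ
      rw [hsec θ hθ, integrable_indicator_iff measurableSet_Ioo]
      exact integrableOn_const (by simp)
    · refine IntegrableOn.congr_fun hπi.norm (fun θ hθ => ?_) measurableSet_Ioi
      have hD := sub_pos.2 (h.lt θ hθ)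
      have e : (fun x => ‖jointDensity θ₀ a₁ a₂ π (x, θ)‖) =
          (Ioo (a₁ θ) (a₂ θ)).indicator fun _ => ‖π θ / (a₂ θ - a₁ θ)‖ := by
        ext x
        rw [show jointDensity θ₀ a₁ a₂ π (x, θ) = _ from congrFun (hsec θ hθ) x,
          norm_indicator_eq_indicator_norm]
      rw [e, integral_indicator measurableSet_Ioo, setIntegral_const,
        Real.volume_real_Ioo_of_le (h.lt θ hθ).le, norm_div, Real.norm_of_nonneg hD.le,
        smul_eq_mul, mul_div_cancel₀ _ hD.ne']
  exact hint.integral_prod_left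

/-- If the prior is proper, the unnormalized expected divergences vanish along any exhaustion by
compact intervals. -/
lemma tendsto_integral_partialMarginal_mul_log (h : SmoothEndpoints θ₀ a₁ a₂)
    (hπc : ContinuousOn π (Ioi θ₀)) (hπ0 : ∀ θ ∈ Ioi θ₀, 0 < π θ)
    (hπ1 : ∀ θ ∈ Ioi θ₀, π θ ≤ deriv a₂ θ / (a₂ θ - a₁ θ)) (hπi : IntegrableOn π (Ioi θ₀))
    {K : ℕ → Set ℝ} (hK : Monotone K) (hm : ∀ i, MeasurableSet (K i)) (hu : ⋃ i, K i = Ioi θ₀) :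
    Tendsto (fun i => ∫ x, partialMarginal θ₀ a₁ a₂ π (K i) x *
      Real.log (partialMarginal θ₀ a₁ a₂ π (Ioi θ₀) x / partialMarginal θ₀ a₁ a₂ π (K i) x))
      atTop (𝓝 0) := by
  have hKs : ∀ i, K i ⊆ Ioi θ₀ := fun i => hu ▸ subset_iUnion K i
  have m2 := (h.stronglyMeasurable_partialMarginal hπc (Ioi θ₀)).measurable
  have hnn : ∀ i x, 0 ≤ partialMarginal θ₀ a₁ a₂ π (K i) x * Real.log
      (partialMarginal θ₀ a₁ a₂ π (Ioi θ₀) x / partialMarginal θ₀ a₁ a₂ π (K i) x) := fun i x =>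
    mul_log_div_nonneg (h.partialMarginal_nonneg hπ0 _ x)
      (h.partialMarginal_mono hπc hπ0 hπ1 (hKs i) x)
  have hle : ∀ i x, partialMarginal θ₀ a₁ a₂ π (K i) x * Real.log
      (partialMarginal θ₀ a₁ a₂ π (Ioi θ₀) x / partialMarginal θ₀ a₁ a₂ π (K i) x) ≤
        partialMarginal θ₀ a₁ a₂ π (Ioi θ₀) x - partialMarginal θ₀ a₁ a₂ π (K i) x := fun i x =>
    mul_log_div_le_sub (h.partialMarginal_nonneg hπ0 _ x)
      (h.partialMarginal_mono hπc hπ0 hπ1 (hKs i) x)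
  rw [← integral_zero ℝ ℝ (μ := volume)]
  refine tendsto_integral_of_dominated_convergence (partialMarginal θ₀ a₁ a₂ π (Ioi θ₀))
    (fun i => ?_) (h.integrable_partialMarginal hπc hπi) (fun i => ae_of_all _ fun x => ?_)
    (ae_of_all _ fun x => ?_)
  · have m1 := (h.stronglyMeasurable_partialMarginal hπc (K i)).measurable
    exact (m1.mul (m2.div m1).log).aestronglyMeasurable
  · rw [Real.norm_of_nonneg (hnn i x)]
    exact (hle i x).trans (sub_le_self _ (h.partialMarginal_nonneg hπ0 _ x))
  · have ht : Tendsto (fun i => partialMarginal θ₀ a₁ a₂ π (K i) x) atTop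
        (𝓝 (partialMarginal θ₀ a₁ a₂ π (Ioi θ₀) x)) := by
      have := tendsto_setIntegral_of_monotone hm hK
        (hu ▸ h.integrableOn_jointDensity hπc hπ0 hπ1 x)
      rwa [hu] at this
    have hs := ht.const_sub (partialMarginal θ₀ a₁ a₂ π (Ioi θ₀) x)
    rw [sub_self] at hs
    exact squeeze_zero (fun i => hnn i x) (fun i => hle i x) hs

theorem isPermissible (h : SmoothEndpoints θ₀ a₁ a₂)
    (hπc : ContinuousOn π (Ioi θ₀)) (hπ0 : ∀ θ ∈ Ioi θ₀, 0 < π θ)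
    (hπ1 : ∀ θ ∈ Ioi θ₀, π θ ≤ deriv a₂ θ / (a₂ θ - a₁ θ)) :
    (uniformModel θ₀ a₁ a₂ h.lt).IsPermissible π := by
  obtain ⟨hmono, hunion⟩ := isCompact_exhaustion_Ioi θ₀
  -- The offset `2` on the right gives positive length already for `i = 0`.
  set K : ℕ → Set ℝ := fun i => Icc (θ₀ + 1 / ((i : ℝ) + 1)) (θ₀ + i + 2) with hKdef
  have hlow : ∀ i : ℕ, θ₀ + 1 / ((i : ℝ) + 1) ∈ Ioi θ₀ := fun i => by
    have : (0 : ℝ) < 1 / ((i : ℝ) + 1) := by positivity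
    exact mem_Ioi.2 (by linarith)
  have hlt : ∀ i : ℕ, θ₀ + 1 / ((i : ℝ) + 1) < θ₀ + i + 2 := fun i => by
    have : 1 / ((i : ℝ) + 1) ≤ 1 := (div_le_one (by positivity)).2 (by linarith [i.cast_nonneg (α := ℝ)])
    linarith [i.cast_nonneg (α := ℝ)]
  have hKc : ∀ i, IsCompact (K i) := fun i => isCompact_Icc
  have hKm : ∀ i, MeasurableSet (K i) := fun i => measurableSet_Icc
  have hKs : ∀ i, K i ⊆ Ioi θ₀ := fun i => hunion ▸ subset_iUnion K i
  have hKv : ∀ i, 0 < volume (K i) := fun i => by simpa [hKdef] using hlt i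
  have hKi : ∀ i, IntegrableOn π (K i) := fun i => (hπc.mono (hKs i)).integrableOn_compact (hKc i)
  have hc : ∀ i, 0 < ∫ τ in K i, π τ := fun i =>
    integral_pos_of_continuousOn (hKc i) (hKv i) (hπc.mono (hKs i)) fun θ hθ => hπ0 θ (hKs i hθ)
  have hF := fun i => h.integral_partialMarginal_mul_log_le hπc hπ0 hπ1 (hlow i) (hlt i).le
  have hF0 : ∀ i, 0 ≤ ∫ x, partialMarginal θ₀ a₁ a₂ π (K i) x * Real.log
      (partialMarginal θ₀ a₁ a₂ π (Ioi θ₀) x / partialMarginal θ₀ a₁ a₂ π (K i) x) := fun i =>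
    integral_nonneg fun x => mul_log_div_nonneg (h.partialMarginal_nonneg hπ0 _ x)
      (h.partialMarginal_mono hπc hπ0 hπ1 (hKs i) x)
  have heq : ∀ i, (fun x => logDivergence (uniformModel θ₀ a₁ a₂ h.lt).param
        ((uniformModel θ₀ a₁ a₂ h.lt).posterior π x)
        ((uniformModel θ₀ a₁ a₂ h.lt).posterior (restrictPrior π (K i)) x) *
        (uniformModel θ₀ a₁ a₂ h.lt).marginal (restrictPrior π (K i)) x) =
      fun x => partialMarginal θ₀ a₁ a₂ π (K i) x *
        Real.log (partialMarginal θ₀ a₁ a₂ π (Ioi θ₀) x / partialMarginal θ₀ a₁ a₂ π (K i) x) /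
        ∫ τ in K i, π τ := fun i =>
    funext fun x => h.logDivergence_mul_marginal (hKm i) (hKs i) (hc i) x
  refine ⟨hπc, hπ0, fun x => (h.integrableOn_jointDensity hπc hπ0 hπ1 x).congr_fun
    (fun θ hθ => (h.density_mul_eq_jointDensity hθ x).symm) measurableSet_Ioi,
    K, ⟨hmono, hKc, hKv, hunion⟩, fun i => ⟨ae_of_all _ fun x hx => ?_, ?_⟩, ?_⟩
  · refine h.logDivergenceFinite_posterior hπc hπ0 hπ1 (hKm i) (hKs i) (hc i) fun h0 => hx ?_
    rw [h.marginal_restrictPrior_eq (hKm i) (hKs i), h0, zero_div]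
  · rw [heq i]
    exact (hF i).1.div_const _
  · simp_rw [heq, integral_div]
    -- For a proper prior the numerator tends to zero while the normalizer stays above its first
    -- value; for an improper one the numerator is at most `12` while the normalizer diverges.
    by_cases hπi : IntegrableOn π (Ioi θ₀)
    · have h1 := h.tendsto_integral_partialMarginal_mul_log hπc hπ0 hπ1 hπi hmono hKm hunion
      have h2 := h1.div_const (∫ τ in K 0, π τ)
      rw [zero_div] at h2
      refine squeeze_zero (fun i => div_nonneg (hF0 i) (hc i).le) (fun i => ?_) h2
      refine div_le_div_of_nonneg_left (hF0 i) (hc 0) ?_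
      refine setIntegral_mono_set (hKi i) ?_ (hmono (Nat.zero_le i)).eventuallyLE
      filter_upwards [ae_restrict_mem (hKm i)] with θ hθ
      exact (hπ0 θ (hKs i hθ)).le
    · have h1 := tendsto_setIntegral_atTop_of_not_integrableOn hmono hKm
        (fun θ hθ => (hπ0 θ (hunion ▸ hθ)).le) hKi (by rwa [hunion])
      refine squeeze_zero (fun i => div_nonneg (hF0 i) (hc i).le) (fun i => ?_)
        (h1.const_div_atTop 12)
      exact div_le_div_of_nonneg_right (hF i).2 (hc i).le

end SmoothEndpoints

end

/-! ### The reference prior property and its uniqueness. -/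

theorem theorem8 (θ₀ : ℝ) (a₁ a₂ : ℝ → ℝ)
    (ha₁ : ContDiffOn ℝ 1 a₁ (Ioi θ₀)) (ha₂ : ContDiffOn ℝ 1 a₂ (Ioi θ₀))
    (hpos : ∀ θ ∈ Ioi θ₀, 0 < a₁ θ) (hlt : ∀ θ ∈ Ioi θ₀, a₁ θ < a₂ θ)
    (hderiv_pos : ∀ θ ∈ Ioi θ₀, 0 < deriv a₁ θ)
    (hderiv_lt : ∀ θ ∈ Ioi θ₀, deriv a₁ θ < deriv a₂ θ)
    (b₁ b₂ π : ℝ → ℝ)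
    (hb₁ : ∀ θ ∈ Ioi θ₀, b₁ θ = (deriv a₂ θ - deriv a₁ θ) / deriv a₁ θ)
    (hb₂ : ∀ θ ∈ Ioi θ₀, b₂ θ = (deriv a₂ θ - deriv a₁ θ) / deriv a₂ θ)
    (hπ : ∀ θ ∈ Ioi θ₀, π θ = (deriv a₂ θ - deriv a₁ θ) / (a₂ θ - a₁ θ) *
      Real.exp (b₁ θ + 1 / (b₁ θ - b₂ θ) *
        (b₁ θ * realDigamma (1 / b₁ θ) - b₂ θ * realDigamma (1 / b₂ θ)))) :
    (uniformModel θ₀ a₁ a₂ hlt).IsReferencePrior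
        (uniformModel θ₀ a₁ a₂ hlt).standardPriors π ∧
      ∀ π' : ℝ → ℝ,
        (uniformModel θ₀ a₁ a₂ hlt).IsReferencePrior
            (uniformModel θ₀ a₁ a₂ hlt).standardPriors π' →
          ∃ c : ℝ, 0 < c ∧ ∀ θ ∈ Ioi θ₀, π' θ = c * π θ := by
  have h : SmoothEndpoints θ₀ a₁ a₂ := ⟨ha₁, ha₂, hlt, hderiv_pos, hderiv_lt⟩
  have hπ' : ∀ θ ∈ Ioi θ₀, π θ = uniformReference a₁ a₂ θ := fun θ hθ => by
    rw [hπ θ hθ, digamma_exponent_eq (hderiv_pos θ hθ) (hderiv_lt θ hθ) (hb₁ θ hθ) (hb₂ θ hθ),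
      uniformReference]
  have hperm : (uniformModel θ₀ a₁ a₂ hlt).IsPermissible π :=
    h.isPermissible (h.continuousOn_uniformReference.congr hπ')
      (fun θ hθ => by rw [hπ' θ hθ]; exact h.uniformReference_pos hθ)
      (fun θ hθ => by rw [hπ' θ hθ]; exact h.uniformReference_le hθ)
  exact ⟨⟨hperm, h.hasMMI hπ'⟩, fun π' ⟨hp, hm⟩ => h.eq_const_mul_of_hasMMI hπ'
    ⟨hperm.continuousOn, hperm.pos, hperm.integrableOn⟩ hp.continuousOn hp.pos hm⟩
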